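/- **Logics.** Formulas are built from countably many atoms with connectives among $\top,\mathbf 0,\mathbf 1,\bot,{\sim},\parr,\otimes,\multimap,\&,\oplus$; a sequent $\Gamma\vdash\Delta$ consists of two finite multisets of formulas. A logic $\mathsf{LOG}$ (a propositional variant of Linear Logic) is given by a set of these connectives, a subset of the usual two-sided sequent rules of affine MALL (identity, cut, left and right weakening, and the left and right rules of the connectives; exchange is built in, there is no contraction and there are no exponentials), and possibly the intuitionistic restriction to sequents with at most one formula on the right; $\Gamma\vdash\Delta$ is valid if it has a proof by these rules that uses sequents of $\mathsf{LOG}$ only. $\mathsf{LOG}$ is *affine* if it has the (left) weakening rule, and *linear* if it has no weakening. **Games.** An individual resource game $G^\epsilon=(N,\gamma_1,\dots,\gamma_n,\epsilon(1),\dots,\epsilon(n))$ has a finite set of players $N=\{1,\dots,n\}$; player $i$ has a goal $\gamma_i$, a formula of $\mathsf{LOG}$, and an endowment $\epsilon(i)$, a finite multiset of formulas of $\mathsf{LOG}$. A profile $P=(P_1,\dots,P_n)\in\mathsf{ch}(G^\epsilon)$ consists of multisets $P_i\subseteq\epsilon(i)$, and its outcome is $\mathsf{out}(P)=\biguplus_i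 P_i$. Under *dichotomous* preferences, player $i$ strongly prefers $P$ to $Q$ if $\mathsf{out}(P)\vdash\gamma_i$ and $\mathsf{out}(Q)\not\vdash\gamma_i$. Under *parsimonious* preferences, player $i$ strongly prefers $P$ to $Q$ if that holds, or if $P_i\subsetneq Q_i$ and $\mathsf{out}(P)\vdash\gamma_i\Leftrightarrow\mathsf{out}(Q)\vdash\gamma_i$. A profile $P$ is a Nash equilibrium if no player $i$ and no $C\subseteq\epsilon(i)$ are such that $i$ strongly prefers $(P_{-i},C)$ to $P$. A redistribution of $\epsilon$ is an $\epsilon'$ with $\biguplus_i\epsilon'(i)=\biguplus_i\epsilon(i)$. **RATIONAL CONSTRUCTION (RC).** Input: a game $G^\epsilon$ and $P\in\mathsf{ch}(G^\epsilon)$. Question: is there a redistribution $\epsilon'$ of $\epsilon$ and a Nash equilibrium $P'$ of $G^{\epsilon'}$ with $\mathsf{out}(P')=\mathsf{out}(P)$? Inputs are coded as bit strings, with multisets listed occurrence by occurrence. Let $\Sigma^p_0=\mathsf P$ and $\Sigma^p_{i+1}=\mathsf{NP}^{\Sigma^p_i}$. **Proposition.** For every such logic $\mathsf{LOG}$, and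 both under dichotomous and under parsimonious preferences: 1. if $\mathsf{LOG}$ is affine and the problem of sequent validity in $\mathsf{LOG}$ is in $\mathsf{NP}$, then RC is in $\Sigma_2^p$; 2. if the problem of sequent validity in $\mathsf{LOG}$ is in $\mathsf{NP}$ (with or without weakening; in particular if $\mathsf{LOG}$ is linear), then RC is in $\Sigma_3^p$; 3. if the problem of sequent validity in $\mathsf{LOG}$ is in $\mathsf{PSPACE}$ ($\mathsf{LOG}$ affine or linear), then RC is in $\mathsf{PSPACE}$. -/

import Mathlib

namespace ResourceGames

/-! ### Formulas and sequents of propositional (multiplicative additive) linear logic -/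

/-- Formulas; the countably many atoms are named by bit strings. -/
inductive Formula : Type
  | atom (p : List Bool)
  | top | zero | one | bot
  | neg (A : Formula)
  | par (A B : Formula)
  | tensor (A B : Formula)
  | lolli (A B : Formula)
  | amp (A B : Formula)
  | plus (A B : Formula)

inductive Connective : Type
  | top | zero | one | bot | neg | par | tensor | lolli | amp | plus

/-- `A` is built from atoms with the connectives in `S` only. -/
def Formula.UsesOnly (S : Set Connective) : Formula → Prop
  | .atom _ => True
  | .top => .top ∈ S
  | .zero => .zero ∈ S
  | .one => .one ∈ S
  | .bot => .bot ∈ S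
  | .neg A => .neg ∈ S ∧ A.UsesOnly S
  | .par A B => .par ∈ S ∧ A.UsesOnly S ∧ B.UsesOnly S
  | .tensor A B => .tensor ∈ S ∧ A.UsesOnly S ∧ B.UsesOnly S
  | .lolli A B => .lolli ∈ S ∧ A.UsesOnly S ∧ B.UsesOnly S
  | .amp A B => .amp ∈ S ∧ A.UsesOnly S ∧ B.UsesOnly S
  | .plus A B => .plus ∈ S ∧ A.UsesOnly S ∧ B.UsesOnly S

/-- A sequent `left ⊢ right`; both sides are finite multisets, so exchange is built in. -/
structure Sequent : Type where
  left : Multiset Formula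
  right : Multiset Formula

/-- Names of the rules of the sequent calculus of affine MALL. -/
inductive Rule : Type
  | ax | cut | weakL | weakR | negL | negR
  | tensorR | tensorL | parL | parR | lolliL | lolliR
  | oneL | oneR | botL | botR
  | ampR | ampL | plusL | plusR | topR | zeroL

/-- `r.Instance ps s`: the rule `r` allows one to pass from the premises `ps` to `s`. -/
inductive Rule.Instance : Rule → List Sequent → Sequent → Prop
  | ax (A) : Rule.Instance .ax [] ⟨{A}, {A}⟩
  | cut (Γ Γ' Δ Δ' A) :
      Rule.Instance .cut [⟨A ::ₘ Γ, Δ⟩, ⟨Γ', A ::ₘ Δ'⟩] ⟨Γ + Γ', Δ + Δ'⟩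
  | weakL (Γ Δ A) : Rule.Instance .weakL [⟨Γ, Δ⟩] ⟨A ::ₘ Γ, Δ⟩
  | weakR (Γ Δ A) : Rule.Instance .weakR [⟨Γ, Δ⟩] ⟨Γ, A ::ₘ Δ⟩
  | negL (Γ Δ A) : Rule.Instance .negL [⟨Γ, A ::ₘ Δ⟩] ⟨.neg A ::ₘ Γ, Δ⟩
  | negR (Γ Δ A) : Rule.Instance .negR [⟨A ::ₘ Γ, Δ⟩] ⟨Γ, .neg A ::ₘ Δ⟩
  | tensorR (Γ Γ' Δ Δ' A B) :
      Rule.Instance .tensorR [⟨Γ, A ::ₘ Δ⟩, ⟨Γ', B ::ₘ Δ'⟩]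
        ⟨Γ + Γ', .tensor A B ::ₘ (Δ + Δ')⟩
  | tensorL (Γ Δ A B) :
      Rule.Instance .tensorL [⟨A ::ₘ B ::ₘ Γ, Δ⟩] ⟨.tensor A B ::ₘ Γ, Δ⟩
  | parL (Γ Γ' Δ Δ' A B) :
      Rule.Instance .parL [⟨A ::ₘ Γ, Δ⟩, ⟨B ::ₘ Γ', Δ'⟩]
        ⟨.par A B ::ₘ (Γ + Γ'), Δ + Δ'⟩
  | parR (Γ Δ A B) : Rule.Instance .parR [⟨Γ, A ::ₘ B ::ₘ Δ⟩] ⟨Γ, .par A B ::ₘ Δ⟩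
  | lolliL (Γ Γ' Δ Δ' A B) :
      Rule.Instance .lolliL [⟨Γ, A ::ₘ Δ⟩, ⟨B ::ₘ Γ', Δ'⟩]
        ⟨.lolli A B ::ₘ (Γ + Γ'), Δ + Δ'⟩
  | lolliR (Γ Δ A B) :
      Rule.Instance .lolliR [⟨A ::ₘ Γ, B ::ₘ Δ⟩] ⟨Γ, .lolli A B ::ₘ Δ⟩
  | oneL (Γ Δ) : Rule.Instance .oneL [⟨Γ, Δ⟩] ⟨.one ::ₘ Γ, Δ⟩
  | oneR : Rule.Instance .oneR [] ⟨0, {.one}⟩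
  | botL : Rule.Instance .botL [] ⟨{.bot}, 0⟩
  | botR (Γ Δ) : Rule.Instance .botR [⟨Γ, Δ⟩] ⟨Γ, .bot ::ₘ Δ⟩
  | ampR (Γ Δ A B) :
      Rule.Instance .ampR [⟨Γ, A ::ₘ Δ⟩, ⟨Γ, B ::ₘ Δ⟩] ⟨Γ, .amp A B ::ₘ Δ⟩
  | ampL₀ (Γ Δ A B) : Rule.Instance .ampL [⟨A ::ₘ Γ, Δ⟩] ⟨.amp A B ::ₘ Γ, Δ⟩
  | ampL₁ (Γ Δ A B) : Rule.Instance .ampL [⟨B ::ₘ Γ, Δ⟩] ⟨.amp A B ::ₘ Γ, Δ⟩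
  | plusL (Γ Δ A B) :
      Rule.Instance .plusL [⟨A ::ₘ Γ, Δ⟩, ⟨B ::ₘ Γ, Δ⟩] ⟨.plus A B ::ₘ Γ, Δ⟩
  | plusR₀ (Γ Δ A B) : Rule.Instance .plusR [⟨Γ, A ::ₘ Δ⟩] ⟨Γ, .plus A B ::ₘ Δ⟩
  | plusR₁ (Γ Δ A B) : Rule.Instance .plusR [⟨Γ, B ::ₘ Δ⟩] ⟨Γ, .plus A B ::ₘ Δ⟩
  | topR (Γ Δ) : Rule.Instance .topR [] ⟨Γ, .top ::ₘ Δ⟩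
  | zeroL (Γ Δ) : Rule.Instance .zeroL [] ⟨.zero ::ₘ Γ, Δ⟩

/-- A propositional variant of linear logic: a choice of connectives, a choice of rules of
affine MALL, and whether sequents are restricted to at most one formula on the right. For
example MLL, MALL, affine MLL, affine MALL, intuitionistic MLL and intuitionistic MALL. -/
structure Logic : Type where
  connectives : Set Connective
  rules : Set Rule
  intuitionistic : Bool

namespace Logic

/-- The formulas of the logic. -/
def Fml (L : Logic) : Type := {A : Formula // A.UsesOnly L.connectives}

/-- The sequents of the logic. -/
def IsSequent (L : Logic) (s : Sequent) : Prop :=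
  (∀ A ∈ s.left, A.UsesOnly L.connectives) ∧
  (∀ A ∈ s.right, A.UsesOnly L.connectives) ∧
  (L.intuitionistic = true → s.right.card ≤ 1)

/-- `L.Provable s`: there is a proof of `s` by the rules of `L` in which only sequents of `L`
occur. -/
inductive Provable (L : Logic) : Sequent → Prop
  | rule {r : Rule} {ps : List Sequent} {s : Sequent} (hr : r ∈ L.rules)
      (hi : r.Instance ps s) (hs : L.IsSequent s) (hp : ∀ p ∈ ps, Provable L p) :
      Provable L s

/-- The logic is affine: it has the rule of (left) weakening. -/
def Affine (L : Logic) : Prop := Rule.weakL ∈ L.rules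

/-- `X ⊢ γ` in the logic `L`. -/
def Proves (L : Logic) (X : Multiset L.Fml) (γ : L.Fml) : Prop :=
  L.Provable ⟨X.map Subtype.val, {γ.val}⟩

end Logic

/-! ### Individual resource games -/

/-- An individual resource game with players `Fin n`, goals and endowments. -/
structure Game (L : Logic) : Type where
  n : ℕ
  goal : Fin n → L.Fml
  endow : Fin n → Multiset L.Fml

/-- The two kinds of preferences. -/
inductive Preference : Type
  | dichotomous | parsimonious

namespace Game

variable {L : Logic} (G : Game L)

/-- One multiset of formulas per player (used for contributions and for endowments). -/
abbrev Profile : Type := Fin G.n → Multiset L.Fml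

/-- The set of profiles of the game: each player contributes a part of her endowment. -/
def ch : Set G.Profile := {P | ∀ i, P i ≤ G.endow i}

/-- The outcome of a profile: the multiset sum of the contributions. -/
def out (P : G.Profile) : Multiset L.Fml := ∑ i, P i

/-- The goal of player `i` is realized in `P`. -/
def Sat (i : Fin G.n) (P : G.Profile) : Prop := L.Proves (G.out P) (G.goal i)

/-- `G.StronglyPrefers π i P Q`: player `i` strongly prefers `P` over `Q`. -/
def StronglyPrefers : Preference → Fin G.n → G.Profile → G.Profile → Prop
  | .dichotomous, i, P, Q => G.Sat i P ∧ ¬ G.Sat i Q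
  | .parsimonious, i, P, Q =>
      (¬ G.Sat i P ∧ ¬ G.Sat i Q ∧ P i < Q i) ∨
      (G.Sat i P ∧ ¬ G.Sat i Q) ∨
      (G.Sat i P ∧ G.Sat i Q ∧ P i < Q i)

/-- The set of Nash equilibria of the game. -/
def NE (π : Preference) : Set G.Profile :=
  {P | P ∈ G.ch ∧
    ∀ i, ∀ C ≤ G.endow i, ¬ G.StronglyPrefers π i (Function.update P i C) P}

/-- The redistributions of the endowment function. -/
def redis : Set G.Profile := {ε' | ∑ i, G.endow i = ∑ i, ε' i}

/-- The game with its endowment function replaced by `ε'`. -/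
def withEndow (ε' : G.Profile) : Game L := ⟨G.n, G.goal, ε'⟩

/-- The profile `P` can be rationally constructed. -/
def RationallyConstructible (π : Preference) (P : G.Profile) : Prop :=
  ∃ ε' ∈ G.redis, ∃ P' ∈ (G.withEndow ε').ch,
    (G.withEndow ε').out P' = G.out P ∧ P' ∈ (G.withEndow ε').NE π

end Game

/-! ### Encodings as bit strings -/

/-- Self-delimiting code of a list, from a self-delimiting code of its elements. -/
def encodeList {α : Type} (e : α → List Bool) : List α → List Bool
  | [] => [false]
  | a :: l => true :: (e a ++ encodeList e l)

/-- Code of a formula: prefix notation, with four bits for each connective. -/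
def Formula.encode : Formula → List Bool
  | .atom p => [false, false, false, false] ++ encodeList (fun b => [b]) p
  | .top => [false, false, false, true]
  | .zero => [false, false, true, false]
  | .one => [false, false, true, true]
  | .bot => [false, true, false, false]
  | .neg A => [false, true, false, true] ++ A.encode
  | .par A B => [false, true, true, false] ++ (A.encode ++ B.encode)
  | .tensor A B => [false, true, true, true] ++ (A.encode ++ B.encode)
  | .lolli A B => [true, false, false, false] ++ (A.encode ++ B.encode)
  | .amp A B => [true, false, false, true] ++ (A.encode ++ B.encode)
  | .plus A B => [true, false, true, false] ++ (A.encode ++ B.encode)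

/-- Code of a multiset of formulas, each occurrence listed, in some order. -/
def encodeFmls {L : Logic} : List L.Fml → List Bool :=
  encodeList fun A => A.val.encode

/-- Code of a sequent. -/
def encodeSequent (Γ Δ : List Formula) : List Bool :=
  encodeList Formula.encode Γ ++ encodeList Formula.encode Δ

/-- Code of one player: goal, endowment, contribution. -/
def encodePlayer {L : Logic} (x : L.Fml × List L.Fml × List L.Fml) : List Bool :=
  x.1.val.encode ++ (encodeFmls x.2.1 ++ encodeFmls x.2.2)

/-- `w` is a code of the game `G` together with the profile `P`. -/
def Encodes {L : Logic} (w : List Bool) (G : Game L) (P : G.Profile) : Prop :=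
  ∃ ε C : Fin G.n → List L.Fml,
    (∀ i, G.endow i = ↑(ε i)) ∧ (∀ i, P i = ↑(C i)) ∧
    w = encodeList encodePlayer (List.ofFn fun i => (G.goal i, ε i, C i))

/-- A code is prefix-free. -/
def PrefixFree {α : Type} (e : α → List Bool) : Prop :=
  ∀ a b u v, e a ++ u = e b ++ v → a = b ∧ u = v

theorem PrefixFree.injective {α : Type} {e : α → List Bool} (h : PrefixFree e) :
    Function.Injective e := fun a b hab => (h a b [] [] (by rw [hab])).1

theorem PrefixFree.encodeList {α : Type} {e : α → List Bool} (h : PrefixFree e) :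
    PrefixFree (encodeList e) := by
  intro a
  induction a with
  | nil => intro b u v hh; cases b <;> simp_all [ResourceGames.encodeList]
  | cons x l ih =>
    intro b u v hh
    cases b with
    | nil => simp [ResourceGames.encodeList] at hh
    | cons y m =>
      simp only [ResourceGames.encodeList, List.cons_append, List.append_assoc,
        List.cons.injEq, true_and] at hh
      obtain ⟨rfl, h2⟩ := h _ _ _ _ hh
      obtain ⟨rfl, h3⟩ := ih _ _ _ h2
      exact ⟨rfl, h3⟩

theorem Formula.prefixFree_encode : PrefixFree Formula.encode := by
  have hb : PrefixFree (fun b : Bool => [b]) := by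
    intro a b u v h
    simpa using h
  have hl := hb.encodeList
  intro A
  induction A with
  | atom p =>
    intro B u v h
    cases B <;> simp [Formula.encode] at h
    obtain ⟨rfl, h2⟩ := hl _ _ _ _ h
    exact ⟨rfl, h2⟩
  | top | zero | one | bot =>
    intro B u v h
    cases B <;> simp_all [Formula.encode]
  | neg A ih =>
    intro B u v h
    cases B <;> simp [Formula.encode] at h
    obtain ⟨rfl, h2⟩ := ih _ _ _ h
    exact ⟨rfl, h2⟩
  | par A B ih ih' | tensor A B ih ih' | lolli A B ih ih' | amp A B ih ih' | plus A B ih ih' =>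
    intro B u v h
    cases B <;> simp [Formula.encode] at h
    obtain ⟨rfl, h2⟩ := ih _ _ _ h
    obtain ⟨rfl, h3⟩ := ih' _ _ _ h2
    exact ⟨rfl, h3⟩

theorem encodeFmls_prefixFree {L : Logic} : PrefixFree (encodeFmls (L := L)) :=
  PrefixFree.encodeList fun A B u v h =>
    have h' := Formula.prefixFree_encode A.val B.val u v h
    ⟨Subtype.ext h'.1, h'.2⟩

theorem encodePlayer_prefixFree {L : Logic} : PrefixFree (encodePlayer (L := L)) := by
  rintro ⟨a, b, c⟩ ⟨a', b', c'⟩ u v h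
  simp only [encodePlayer, List.append_assoc] at h
  obtain ⟨h1, h2⟩ := Formula.prefixFree_encode _ _ _ _ h
  obtain ⟨rfl, h3⟩ := encodeFmls_prefixFree _ _ _ _ h2
  obtain ⟨rfl, h4⟩ := encodeFmls_prefixFree _ _ _ _ h3
  exact ⟨by rw [Subtype.ext h1], h4⟩

/-- A string codes at most one game with a profile. -/
theorem Encodes.unique {L : Logic} {w : List Bool} {G H : Game L} {P : G.Profile}
    {Q : H.Profile} (h₁ : Encodes w G P) (h₂ : Encodes w H Q) : G = H ∧ HEq P Q := by
  obtain ⟨n, g, e⟩ := G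
  obtain ⟨m, g', e'⟩ := H
  obtain ⟨ε, C, h1, h2, rfl⟩ := h₁
  obtain ⟨ε', C', h1', h2', h⟩ := h₂
  have hl := encodePlayer_prefixFree.encodeList.injective h
  have hn : n = m := by simpa using congrArg List.length hl
  subst hn
  have hf := List.ofFn_injective hl
  have hg : g = g' := funext fun i => congrArg Prod.fst (congrFun hf i)
  have hε : ε = ε' := funext fun i => congrArg (fun x => x.2.1) (congrFun hf i)
  have hC : C = C' := funext fun i => congrArg (fun x => x.2.2) (congrFun hf i)
  subst hg hε hC
  have he : e = e' := funext fun i => (h1 i).trans (h1' i).symm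
  subst he
  exact ⟨rfl, heq_of_eq (funext fun i => (h2 i).trans (h2' i).symm)⟩

/-! ### Decision problems as languages -/

/-- Sequent validity in the logic `L`. -/
def SequentValidity (L : Logic) : Language Bool :=
  {w | ∃ Γ Δ : List Formula, w = encodeSequent Γ Δ ∧ L.Provable ⟨Γ, Δ⟩}

/-- RATIONAL CONSTRUCTION. -/
def RationalConstruction (L : Logic) (π : Preference) : Language Bool :=
  {w | ∃ (G : Game L) (P : G.Profile),
    P ∈ G.ch ∧ Encodes w G P ∧ G.RationallyConstructible π P}

/-! ### Oracle machines

Turing machines in the form with finitely many stacks (a tape is a pair of stacks), with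
nondeterministic choices and with an oracle. One instruction is one step. -/

inductive Instr (Q K S : Type) : Type
  | push (k : K) (a : S) (q : Q)
  /-- Remove the top of stack `k` and branch on it (`none` if the stack is empty). -/
  | pop (k : K) (next : Option S → Q)
  | choose (q₁ q₂ : Q)
  /-- Ask the oracle about the string on stack `k`. -/
  | query (k : K) (yes no : Q)
  | accept
  | reject

/-- A nondeterministic oracle machine with control states `Q`, stacks `K` and alphabet `S`. -/
structure Machine : Type 1 where
  Q : Type
  K : Type
  S : Type
  [finQ : Fintype Q]
  [finK : Fintype K]
  [decK : DecidableEq K]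
  [finS : Fintype S]
  bit : Bool ↪ S
  start : Q
  input : K
  prog : Q → Instr Q K S

namespace Machine

attribute [instance] finQ finK decK finS

variable (M : Machine)

structure Cfg : Type where
  state : M.Q
  stack : M.K → List M.S

/-- At the start the input stack holds the input, first bit on top; other stacks are empty. -/
def init (x : List Bool) : M.Cfg :=
  ⟨M.start, Function.update (fun _ => []) M.input (x.map M.bit)⟩

/-- One step of computation with the oracle `A`. -/
inductive Step (A : Language Bool) : M.Cfg → M.Cfg → Prop
  | push {q s k a q'} : M.prog q = .push k a q' →
      Step A ⟨q, s⟩ ⟨q', Function.update s k (a :: s k)⟩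
  | pop {q s k f} : M.prog q = .pop k f →
      Step A ⟨q, s⟩ ⟨f (s k).head?, Function.update s k (s k).tail⟩
  | choose₁ {q s q₁ q₂} : M.prog q = .choose q₁ q₂ → Step A ⟨q, s⟩ ⟨q₁, s⟩
  | choose₂ {q s q₁ q₂} : M.prog q = .choose q₁ q₂ → Step A ⟨q, s⟩ ⟨q₂, s⟩
  | query_yes {q s k q₁ q₂} : M.prog q = .query k q₁ q₂ →
      (∃ w ∈ A, s k = w.map M.bit) → Step A ⟨q, s⟩ ⟨q₁, s⟩
  | query_no {q s k q₁ q₂} : M.prog q = .query k q₁ q₂ →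
      ¬ (∃ w ∈ A, s k = w.map M.bit) → Step A ⟨q, s⟩ ⟨q₂, s⟩

/-- `M.Reaches A t c d`: some computation of exactly `t` steps leads from `c` to `d`. -/
inductive Reaches (A : Language Bool) : ℕ → M.Cfg → M.Cfg → Prop
  | refl (c) : Reaches A 0 c c
  | step {t c d e} : Reaches A t c d → M.Step A d e → Reaches A (t + 1) c e

/-- The language of the inputs on which some computation accepts. -/
def language (A : Language Bool) : Language Bool :=
  {x | ∃ t c, M.Reaches A t (M.init x) c ∧ M.prog c.state = .accept}

/-- All computations, whatever the choices, stop within polynomially many steps. -/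
def PolyTime (A : Language Bool) : Prop :=
  ∃ p : Polynomial ℕ, ∀ x t c, M.Reaches A t (M.init x) c → t ≤ p.eval x.length

/-- All reachable configurations have polynomial size. -/
def PolySpace (A : Language Bool) : Prop :=
  ∃ p : Polynomial ℕ, ∀ x t c, M.Reaches A t (M.init x) c →
    ∑ k, (c.stack k).length ≤ p.eval x.length

/-- Every input has a computation that stops. -/
def Halts (A : Language Bool) : Prop :=
  ∀ x, ∃ t c, M.Reaches A t (M.init x) c ∧
    (M.prog c.state = .accept ∨ M.prog c.state = .reject)

def Deterministic : Prop := ∀ q q₁ q₂, M.prog q ≠ .choose q₁ q₂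

def OracleFree : Prop := ∀ q k q₁ q₂, M.prog q ≠ .query k q₁ q₂

end Machine

/-! ### Complexity classes -/

/-- The class P. (Machines without queries are run with the empty oracle.) -/
def P : Set (Language Bool) :=
  {S | ∃ M : Machine, M.Deterministic ∧ M.OracleFree ∧ M.PolyTime 0 ∧ M.language 0 = S}

/-- The class NP. -/
def NP : Set (Language Bool) :=
  {S | ∃ M : Machine, M.OracleFree ∧ M.PolyTime 0 ∧ M.language 0 = S}

/-- The class NP relative to an oracle from the class `C`. -/
def NPOracle (C : Set (Language Bool)) : Set (Language Bool) :=
  {S | ∃ A ∈ C, ∃ M : Machine, M.PolyTime A ∧ M.language A = S}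

/-- The levels `Σᵢ` of the polynomial hierarchy. -/
def SigmaP : ℕ → Set (Language Bool)
  | 0 => P
  | i + 1 => NPOracle (SigmaP i)

/-- The class PSPACE. -/
def PSPACE : Set (Language Bool) :=
  {S | ∃ M : Machine, M.Deterministic ∧ M.OracleFree ∧ M.PolySpace 0 ∧ M.Halts 0 ∧
    M.language 0 = S}

end ResourceGames

/-! A redistribution together with a profile that has the prescribed outcome is no larger than the
input, so it can be guessed. It remains to verify that no player has a profitable deviation, which
is a universal quantifier over contributions `C`, again of polynomial size, followed by finitely
many questions `X ⊢ γ`. If validity is in NP, then "some player can deviate" is in NP with an oracle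
for validity, hence in Σ₂; guessing the redistribution and asking that question once puts the
problem in Σ₃.

In an affine logic provability is monotone in the left side, and this removes the inner quantifier.
A player who can gain the goal at all gains it by contributing the whole endowment. A parsimonious
player who saves resources without realizing the goal can as well contribute nothing, and one who
saves while keeping the goal can as well save a single formula. So polynomially many candidates
suffice (`exists_deviates_iff`), they are tested with the validity oracle, and one level of the
hierarchy is saved. If validity is in PSPACE, both quantifiers are resolved by exhaustive search,
reusing the space.

The bulk of the proof makes this precise for the stack machines. Deterministic pieces of program
(`Frag`) are composed sequentially and in loops; their data are binary trees, written in prefix code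
on one main stack. A context `Ctx` fixes alphabet, extra stacks and oracle, and its proposition
`timed` chooses between polynomial time with oracle access and polynomial space without it. Hence
the closure properties of the computable functions `PT` are proved once for both: pairs, case
distinction, folds, equality and multiset difference all rest on `Ctx.Comp.cases` and
`Ctx.Comp.whileLoop`, and the number of rounds of a loop has to be polynomial only if `timed` holds.
Three theorems lead back to the classes: `mem_NPOracle_of_guess`, `mem_PSPACE_of_pt` and, for
calling a given PSPACE machine, `Machine.pt_language`.

The input is never parsed. Instead a program for a small stack machine is tried whose instructions
assemble players (`Store.decode`). Every bit string is such a program and yields formulas of the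
logic only, every list of players has a short program, and a correct guess is recognized by encoding
the players again and comparing the result with the input (`valid`). This turns RC into the
quantifier pattern of `mem_rationalConstruction_iff_short`. -/

namespace ResourceGames

/-! ### Machine fragments -/

/-- The work stacks of a fragment. -/
inductive Reg : Type
  | m | x | y | z
  deriving DecidableEq

instance : Fintype Reg := ⟨{.m, .x, .y, .z}, fun r => by cases r <;> decide⟩

/-- What fragments of machines have in common: stacks `κ` besides the four work stacks, the
alphabet, and the oracle. Fragments may ask the oracle and have to run in polynomial time if
`timed` holds; otherwise they may not ask the oracle and have to run in polynomial space. -/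
structure Ctx : Type 1 where
  κ : Type
  [finκ : Fintype κ]
  [decκ : DecidableEq κ]
  Sym : Type
  [finSym : Fintype Sym]
  bit : Bool ↪ Sym
  oracle : Language Bool
  timed : Prop

attribute [instance] Ctx.finκ Ctx.decκ Ctx.finSym

/-- The stacks. -/
abbrev Ctx.Key (Γ : Ctx) : Type := Reg ⊕ Γ.κ

/-- The contents of the stacks. -/
abbrev Ctx.Stk (Γ : Ctx) : Type := Γ.Key → List Γ.Sym

/-- The total number of symbols on the stacks. -/
def Ctx.size {Γ : Ctx} (s : Γ.Stk) : ℕ := ∑ k, (s k).length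

/-- Deterministic instructions. -/
inductive Op (Γ : Ctx) (Q : Type) : Type
  | push (k : Γ.Key) (a : Γ.Sym) (q : Q)
  | pop (k : Γ.Key) (next : Option Γ.Sym → Q)
  | query (h : Γ.timed) (k : Γ.Key) (yes no : Q)

namespace Op

variable {Γ : Ctx} {Q R : Type}

def map (φ : Q → R) : Op Γ Q → Op Γ R
  | push k a q => push k a (φ q)
  | pop k f => pop k (φ ∘ f)
  | query h k q₁ q₂ => query h k (φ q₁) (φ q₂)

open Classical in
/-- The effect of an instruction. -/
noncomputable def exec : Op Γ Q → Γ.Stk → Q × Γ.Stk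
  | push k a q, s => (q, Function.update s k (a :: s k))
  | pop k f, s => (f (s k).head?, Function.update s k (s k).tail)
  | query _ k q₁ q₂, s => (if ∃ w ∈ Γ.oracle, s k = w.map Γ.bit then q₁ else q₂, s)

theorem exec_map (φ : Q → R) (o : Op Γ Q) (s : Γ.Stk) :
    (o.map φ).exec s = (φ (o.exec s).1, (o.exec s).2) := by
  cases o <;> simp [map, exec, apply_ite φ]

theorem size_exec_le (o : Op Γ Q) (s : Γ.Stk) : Ctx.size (o.exec s).2 ≤ Ctx.size s + 1 := by
  cases o with
  | push k a q =>
    simp only [exec, Ctx.size]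
    rw [← Finset.add_sum_erase _ _ (Finset.mem_univ k),
      ← Finset.add_sum_erase (a := k) _ (fun k => (s k).length) (Finset.mem_univ k)]
    have : ∀ j ∈ Finset.univ.erase k,
        (Function.update s k (a :: s k) j).length = (s j).length := by
      intro j hj
      rw [Function.update_of_ne (Finset.ne_of_mem_erase hj)]
    rw [Finset.sum_congr rfl this]
    simp only [Function.update_self, List.length_cons]
    omega
  | pop k f =>
    refine (Finset.sum_le_sum fun j _ => ?_).trans (Nat.le_succ _)
    simp only [exec]
    by_cases h : j = k
    · subst h; simp
    · rw [Function.update_of_ne h]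
  | query h k q₁ q₂ => simp [exec]

end Op

/-- A fragment of a machine, which is left through one of the exits in `E`. -/
structure Frag (Γ : Ctx) (E : Type) : Type 1 where
  Pos : Type
  [finPos : Fintype Pos]
  entry : Pos
  code : Pos → Op Γ (Pos ⊕ E)

attribute [instance] Frag.finPos

namespace Frag

variable {Γ : Ctx} {E E' : Type}

/-- `F.Run ok t c s d s'`: a computation of `t` steps leads from `c`, `s` to `d`, `s'`, and the
stacks satisfy `ok` all the time. -/
inductive Run (F : Frag Γ E) (ok : Γ.Stk → Prop) :
    ℕ → F.Pos ⊕ E → Γ.Stk → F.Pos ⊕ E → Γ.Stk → Prop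
  | refl {c s} : ok s → Run F ok 0 c s c s
  | step {t p s d s'} : ok s →
      Run F ok t ((F.code p).exec s).1 ((F.code p).exec s).2 d s' →
      Run F ok (t + 1) (.inl p) s d s'

namespace Run

variable {F : Frag Γ E} {G : Frag Γ E'} {ok ok' : Γ.Stk → Prop} {t u : ℕ}
  {c d e : F.Pos ⊕ E} {s s' s'' : Γ.Stk}

theorem trans (h : F.Run ok t c s d s') (h' : F.Run ok u d s' e s'') :
    F.Run ok (t + u) c s e s'' := by
  induction h with
  | refl _ => simpa using h'
  | step hs _ ih => rw [add_right_comm]; exact .step hs (ih h')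

theorem mono (h : F.Run ok t c s d s') (hok : ∀ s, ok s → ok' s) : F.Run ok' t c s d s' := by
  induction h with
  | refl hs => exact .refl (hok _ hs)
  | step hs _ ih => exact .step (hok _ hs) ih

theorem ok_last (h : F.Run ok t c s d s') : ok s' := by
  induction h with
  | refl hs => exact hs
  | step _ _ ih => exact ih

/-- A step adds at most one symbol, so a bound for the time is also a bound for the space. Most
fragments therefore need only a time analysis. -/
theorem of_size (h : F.Run (fun _ => True) t c s d s') {m : ℕ} (hm : Ctx.size s + t ≤ m) :
    F.Run (fun s => Ctx.size s ≤ m) t c s d s' := by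
  induction h with
  | refl hs => exact .refl (by omega)
  | @step t p s d s' hs _ ih =>
    have := (F.code p).size_exec_le s
    exact .step (by omega) (ih (by omega))

/-- This embeds a fragment into a larger one. Positions must go to positions, but exits may go
anywhere: to the entry of the next fragment in `bind`, back to the own entry in `loop`. -/
theorem map (φ : F.Pos ⊕ E → G.Pos ⊕ E') (ψ : F.Pos → G.Pos) (hφ : ∀ p, φ (.inl p) = .inl (ψ p))
    (hc : ∀ p, G.code (ψ p) = (F.code p).map φ) (h : F.Run ok t c s d s') :
    G.Run ok t (φ c) s (φ d) s' := by
  induction h with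
  | refl hs => exact .refl hs
  | step hs _ ih =>
    rw [hφ]
    refine .step hs ?_
    rw [hc, Op.exec_map]
    exact ih

end Run

/-- The fragment, started on the stacks `s`, leaves through `e` with the stacks `s'`. -/
def Exec (F : Frag Γ E) (ok : Γ.Stk → Prop) (t : ℕ) (s : Γ.Stk) (e : E) (s' : Γ.Stk) : Prop :=
  F.Run ok t (.inl F.entry) s (.inr e) s'

/-- First `F`, then the fragment that belongs to the exit of `F`. -/
def bind [Fintype E] (F : Frag Γ E) (G : E → Frag Γ E') : Frag Γ E' where
  Pos := F.Pos ⊕ Σ e, (G e).Pos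
  entry := .inl F.entry
  code
    | .inl p => (F.code p).map
        (Sum.elim (fun p => .inl (.inl p)) fun e => .inl (.inr ⟨e, (G e).entry⟩))
    | .inr ⟨e, p⟩ => ((G e).code p).map (Sum.map (fun p => .inr ⟨e, p⟩) id)

theorem Exec.bind [Fintype E] {F : Frag Γ E} {G : E → Frag Γ E'} {ok : Γ.Stk → Prop} {t u : ℕ}
    {s s' s'' : Γ.Stk} {e : E} {e' : E'} (h : F.Exec ok t s e s')
    (h' : (G e).Exec ok u s' e' s'') : (F.bind G).Exec ok (t + u) s e' s'' :=
  (Run.map (G := F.bind G)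
    (Sum.elim (fun p => .inl (.inl p)) fun e => .inl (.inr ⟨e, (G e).entry⟩)) _
    (fun _ => rfl) (fun _ => rfl) h).trans
  (Run.map (G := F.bind G) (Sum.map (fun p => .inr ⟨e, p⟩) id) (fun p => .inr ⟨e, p⟩)
    (fun _ => rfl) (fun _ => rfl) h')

/-- Repeat `F` as long as it leaves through `none`. -/
def loop (F : Frag Γ (Option E)) : Frag Γ E where
  Pos := F.Pos
  entry := F.entry
  code p := (F.code p).map
    (Sum.elim .inl fun e => Option.elim e (.inl F.entry) .inr)

theorem Exec.loop_none {F : Frag Γ (Option E)} {ok : Γ.Stk → Prop} {t u : ℕ}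
    {s s' s'' : Γ.Stk} {e : E} (h : F.Exec ok t s none s') (h' : F.loop.Exec ok u s' e s'') :
    F.loop.Exec ok (t + u) s e s'' :=
  (Run.map (F := F) (G := F.loop) (Sum.elim .inl fun e => Option.elim e (.inl F.entry) .inr) id
    (fun _ => rfl) (fun _ => rfl) h).trans h'

theorem Exec.loop_some {F : Frag Γ (Option E)} {ok : Γ.Stk → Prop} {t : ℕ}
    {s s' : Γ.Stk} {e : E} (h : F.Exec ok t s (some e) s') : F.loop.Exec ok t s e s' :=
  Run.map (F := F) (G := F.loop) (Sum.elim .inl fun e => Option.elim e (.inl F.entry) .inr) id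
    (fun _ => rfl) (fun _ => rfl) h

theorem Exec.ok_last {F : Frag Γ E} {ok : Γ.Stk → Prop} {t : ℕ} {s s' : Γ.Stk} {e : E}
    (h : F.Exec ok t s e s') : ok s' := Run.ok_last h

theorem Exec.mono {F : Frag Γ E} {ok ok' : Γ.Stk → Prop} {t : ℕ} {s s' : Γ.Stk} {e : E}
    (h : F.Exec ok t s e s') (hok : ∀ s, ok s → ok' s) : F.Exec ok' t s e s' := Run.mono h hok

/-- The fragment leaves through `e` with the stacks `s'` after at most `n` steps. -/
def Fast (F : Frag Γ E) (n : ℕ) (s : Γ.Stk) (e : E) (s' : Γ.Stk) : Prop :=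
  ∃ t ≤ n, F.Exec (fun _ => True) t s e s'

theorem Fast.bind [Fintype E] {F : Frag Γ E} {G : E → Frag Γ E'} {t u : ℕ}
    {s s' s'' : Γ.Stk} {e : E} {e' : E'} (h : F.Fast t s e s')
    (h' : (G e).Fast u s' e' s'') : (F.bind G).Fast (t + u) s e' s'' := by
  obtain ⟨a, ha, h⟩ := h
  obtain ⟨b, hb, h'⟩ := h'
  exact ⟨a + b, by omega, h.bind h'⟩

theorem Fast.mono {F : Frag Γ E} {n n' : ℕ} {s s' : Γ.Stk} {e : E} (h : F.Fast n s e s')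
    (hn : n ≤ n') : F.Fast n' s e s' := by
  obtain ⟨a, ha, h⟩ := h
  exact ⟨a, by omega, h⟩

theorem Fast.congr {F : Frag Γ E} {n n' : ℕ} {s s' s'' : Γ.Stk} {e : E} (h : F.Fast n s e s')
    (hs : s' = s'') (hn : n ≤ n') : F.Fast n' s e s'' :=
  hs ▸ h.mono hn

theorem Fast.loop_none {F : Frag Γ (Option E)} {t u : ℕ} {s s' s'' : Γ.Stk} {e : E}
    (h : F.Fast t s none s') (h' : F.loop.Fast u s' e s'') : F.loop.Fast (t + u) s e s'' := by
  obtain ⟨a, ha, h⟩ := h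
  obtain ⟨b, hb, h'⟩ := h'
  exact ⟨a + b, by omega, h.loop_none h'⟩

theorem Fast.loop_some {F : Frag Γ (Option E)} {t : ℕ} {s s' : Γ.Stk} {e : E}
    (h : F.Fast t s (some e) s') : F.loop.Fast t s e s' := by
  obtain ⟨a, ha, h⟩ := h
  exact ⟨a, ha, h.loop_some⟩

theorem Fast.exec {F : Frag Γ E} {n m : ℕ} {s s' : Γ.Stk} {e : E} (h : F.Fast n s e s')
    (hm : Ctx.size s + n ≤ m) : ∃ t ≤ n, F.Exec (fun s => Ctx.size s ≤ m) t s e s' := by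
  obtain ⟨a, ha, h⟩ := h
  exact ⟨a, ha, Run.of_size h (by omega)⟩

/-! #### Single instructions -/

def push (k : Γ.Key) (a : Γ.Sym) : Frag Γ Unit where
  Pos := Unit
  entry := ()
  code _ := .push k a (.inr ())

def pop (k : Γ.Key) : Frag Γ (Option Γ.Sym) where
  Pos := Unit
  entry := ()
  code _ := .pop k .inr

def query (h : Γ.timed) (k : Γ.Key) : Frag Γ Bool where
  Pos := Unit
  entry := ()
  code _ := .query h k (.inr true) (.inr false)

/-- Do nothing and leave through `e`. -/
def done (e : E) : Frag Γ E where
  Pos := Bool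
  entry := true
  code
    -- The entry has to carry an instruction, so doing nothing takes two steps; popping what has
    -- just been pushed is safe even if the stack is not empty.
    | true => .push (.inl .z) (Γ.bit true) (.inl false)
    | false => .pop (.inl .z) fun _ => .inr e

theorem fast_push (k : Γ.Key) (a : Γ.Sym) (s : Γ.Stk) :
    (push k a).Fast 1 s () (Function.update s k (a :: s k)) :=
  ⟨1, le_rfl, .step trivial (.refl trivial)⟩

theorem fast_pop (k : Γ.Key) (s : Γ.Stk) :
    (pop k).Fast 1 s (s k).head? (Function.update s k (s k).tail) :=
  ⟨1, le_rfl, .step trivial (.refl trivial)⟩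

open Classical in
theorem fast_query (h : Γ.timed) (k : Γ.Key) (s : Γ.Stk) :
    (query h k).Fast 1 s (decide (∃ w ∈ Γ.oracle, s k = w.map Γ.bit)) s := by
  refine ⟨1, le_rfl, .step trivial ?_⟩
  by_cases hw : ∃ w ∈ Γ.oracle, s k = w.map Γ.bit
  · simpa only [query, Op.exec, hw, if_true, decide_true] using .refl trivial
  · simpa only [query, Op.exec, hw, if_false, decide_false] using .refl trivial

theorem fast_done (e : E) (s : Γ.Stk) : (done e).Fast 2 s e s := by
  have h : ((done e : Frag Γ E).code false).exec (((done e : Frag Γ E).code true).exec s).2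
      = (.inr e, s) := by
    simp [done, Op.exec]
  have h' : (done e : Frag Γ E).Run (fun _ => True) 0
      (((done e : Frag Γ E).code false).exec (((done e : Frag Γ E).code true).exec s).2).1
      (((done e : Frag Γ E).code false).exec (((done e : Frag Γ E).code true).exec s).2).2
      (.inr e) s := by
    rw [h]; exact .refl trivial
  exact ⟨2, le_rfl, .step trivial (.step trivial h')⟩

/-! #### Moving the contents of a stack -/

def pourStep (k : Γ.Key) (F : Γ.Sym → Frag Γ Unit) : Frag Γ (Option Unit) :=
  (pop k).bind fun
    | none => done (some ())
    | some a => (F a).bind fun _ => done none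

/-- Pop the stack `k` until it is empty, and treat each symbol with `F`. -/
def pour (k : Γ.Key) (F : Γ.Sym → Frag Γ Unit) : Frag Γ Unit := loop (pourStep k F)

theorem fast_pour_of_nil {k : Γ.Key} {F : Γ.Sym → Frag Γ Unit} {s : Γ.Stk} (h : s k = []) :
    (pour k F).Fast 3 s () s := by
  refine ((fast_pop k s).bind (u := 2) (s'' := s) ?_).loop_some
  rw [h]
  exact (fast_done _ _).congr (by rw [List.tail_nil, ← h, Function.update_eq_self]) le_rfl

theorem fast_pour_of_cons {k : Γ.Key} {F : Γ.Sym → Frag Γ Unit} {s s' s'' : Γ.Stk} {a : Γ.Sym}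
    {l : List Γ.Sym} {n u : ℕ} (h : s k = a :: l)
    (hF : (F a).Fast n (Function.update s k l) () s') (h' : (pour k F).Fast u s' () s'') :
    (pour k F).Fast (n + 3 + u) s () s'' := by
  refine Fast.loop_none ?_ h'
  refine ((fast_pop k s).bind (u := n + 2) ?_).mono (by omega)
  rw [h]
  exact hF.bind (fast_done _ _)

theorem fast_clear (k : Γ.Key) (s : Γ.Stk) :
    (pour k fun _ => done ()).Fast (5 * (s k).length + 3) s () (Function.update s k []) := by
  generalize hn : s k = l
  induction l generalizing s with
  | nil => exact (fast_pour_of_nil hn).congr (by simp [← hn]) (by simp)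
  | cons a l ih =>
    exact (fast_pour_of_cons hn (fast_done _ _) (ih _ (by simp))).congr (by simp) (by simp; omega)

theorem fast_move (k j : Γ.Key) (hkj : k ≠ j) (s : Γ.Stk) :
    (pour k (push j)).Fast (4 * (s k).length + 3) s ()
      (Function.update (Function.update s k []) j ((s k).reverse ++ s j)) := by
  generalize hn : s k = l
  induction l generalizing s with
  | nil =>
    refine (fast_pour_of_nil hn).congr ?_ (by simp)
    rw [← hn, Function.update_eq_self, hn]; simp
  | cons a l ih =>
    refine (fast_pour_of_cons hn (fast_push _ _ _) (ih _ (by simp [hkj]))).congr ?_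
      (by simp; omega)
    ext i : 1
    by_cases h1 : i = j
    · subst h1; simp [hkj.symm]
    · by_cases h2 : i = k
      · subst h2; simp [h1]
      · simp [h1, h2]

theorem fast_move₂ (k i j : Γ.Key) (hki : k ≠ i) (hkj : k ≠ j) (hij : i ≠ j) (s : Γ.Stk) :
    (pour k fun a => (push i a).bind fun _ => push j a).Fast (5 * (s k).length + 3) s ()
      (Function.update (Function.update (Function.update s k []) i ((s k).reverse ++ s i))
        j ((s k).reverse ++ s j)) := by
  generalize hn : s k = l
  induction l generalizing s with
  | nil =>
    refine (fast_pour_of_nil hn).congr ?_ (by simp)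
    ext r : 1
    by_cases h1 : r = j
    · subst h1; simp
    · by_cases h2 : r = i
      · subst h2; simp [h1]
      · by_cases h3 : r = k
        · subst h3; simp [hki, hkj, hn]
        · simp [h1, h2, h3]
  | cons a l ih =>
    refine (fast_pour_of_cons hn ((fast_push _ _ _).bind (fast_push _ _ _))
      (ih _ (by simp [hki, hkj]))).congr ?_ (by simp; omega)
    ext r : 1
    by_cases h1 : r = j
    · subst h1; simp [hkj.symm, hij.symm]
    · by_cases h2 : r = i
      · subst h2; simp [h1, hki.symm]
      · by_cases h3 : r = k
        · subst h3; simp [hki, hkj]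
        · simp [h1, h2, h3]

end Frag

end ResourceGames

namespace ResourceGames

/-! ### Binary trees as data -/

inductive BinTree : Type
  | leaf
  | node (l r : BinTree)

namespace BinTree

/-- The length of the prefix code of a tree. -/
def size : BinTree → ℕ
  | leaf => 1
  | node l r => 1 + l.size + r.size

/-- Prefix code of a tree. -/
def ser (Γ : Ctx) : BinTree → List Γ.Sym
  | leaf => [Γ.bit false]
  | node l r => Γ.bit true :: (l.ser Γ ++ r.ser Γ)

@[simp] theorem length_ser (Γ : Ctx) (t : BinTree) : (t.ser Γ).length = t.size := by
  induction t with
  | leaf => rfl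
  | node l r h₁ h₂ => simp [ser, size, h₁, h₂]; omega

theorem one_le_size (t : BinTree) : 1 ≤ t.size := by
  cases t <;> simp [size]; omega

end BinTree

/-- The coefficients are natural numbers. Because of this, bounds can be composed freely. -/
theorem polynomial_eval_mono (p : Polynomial ℕ) {m n : ℕ} (h : m ≤ n) : p.eval m ≤ p.eval n := by
  induction p using Polynomial.induction_on' with
  | add p q hp hq => simpa using add_le_add hp hq
  | monomial k a => simpa using Nat.mul_le_mul_left _ (Nat.pow_le_pow_left h k)

/-- The stacks with the given contents of the work stacks. -/
def Ctx.st {Γ : Ctx} (m x y z : List Γ.Sym) (r : Γ.κ → List Γ.Sym) : Γ.Stk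
  | .inl .m => m
  | .inl .x => x
  | .inl .y => y
  | .inl .z => z
  | .inr k => r k

/-- The stacks that hold data on the main stack only. -/
abbrev Ctx.ms {Γ : Ctx} (m : List Γ.Sym) : Γ.Stk := Ctx.st m [] [] [] fun _ => []

section st

open Ctx

variable {Γ : Ctx} (m x y z v : List Γ.Sym) (r : Γ.κ → List Γ.Sym)

@[simp] theorem st_m : st m x y z r (.inl .m) = m := rfl
@[simp] theorem st_x : st m x y z r (.inl .x) = x := rfl
@[simp] theorem st_y : st m x y z r (.inl .y) = y := rfl
@[simp] theorem st_z : st m x y z r (.inl .z) = z := rfl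
@[simp] theorem st_inr (k : Γ.κ) : st m x y z r (.inr k) = r k := rfl

@[simp] theorem update_st_m : Function.update (st m x y z r) (.inl .m) v = st v x y z r := by
  ext i : 1; rcases i with (_ | _ | _ | _) | _ <;> simp

@[simp] theorem update_st_x : Function.update (st m x y z r) (.inl .x) v = st m v y z r := by
  ext i : 1; rcases i with (_ | _ | _ | _) | _ <;> simp

@[simp] theorem update_st_y : Function.update (st m x y z r) (.inl .y) v = st m x v z r := by
  ext i : 1; rcases i with (_ | _ | _ | _) | _ <;> simp

@[simp] theorem update_st_z : Function.update (st m x y z r) (.inl .z) v = st m x y v r := by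
  ext i : 1; rcases i with (_ | _ | _ | _) | _ <;> simp

@[simp] theorem update_st_inr (k : Γ.κ) :
    Function.update (st m x y z r) (.inr k) v = st m x y z (Function.update r k v) := by
  ext i : 1; rcases i with (_ | _ | _ | _) | _ <;> simp [Function.update_apply]

@[simp] theorem size_st : Ctx.size (st m x y z r) =
    m.length + x.length + y.length + z.length + ∑ k, (r k).length := by
  have : (Finset.univ : Finset Reg) = {.m, .x, .y, .z} := rfl
  simp [Ctx.size, Fintype.sum_sum_type, this]
  ring

end st

/-! ### Moving, deleting, duplicating and exchanging trees on the main stack -/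

namespace Frag

open Ctx

variable {Γ : Ctx}

open Classical in
noncomputable def takeStep : Frag Γ Unit :=
  (pop (.inl .m)).bind fun a =>
    if a = some (Γ.bit true) then
      (push (.inl .x) (Γ.bit true)).bind fun _ =>
        (push (.inl .z) (Γ.bit true)).bind fun _ => push (.inl .z) (Γ.bit true)
    else push (.inl .x) (Γ.bit false)

/-- Move the tree on top of the main stack to the stack `x`, reversing its code. -/
noncomputable def take : Frag Γ Unit :=
  (push (.inl .z) (Γ.bit true)).bind fun _ => pour (.inl .z) fun _ => takeStep

theorem fast_takeStep_false (m x y z : List Γ.Sym) (r : Γ.κ → List Γ.Sym) :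
    takeStep.Fast 2 (st (Γ.bit false :: m) x y z r) () (st m (Γ.bit false :: x) y z r) := by
  refine (fast_pop _ _).bind (u := 1) ?_
  simpa using fast_push (.inl .x) (Γ.bit false) (st m x y z r)

theorem fast_takeStep_true (m x y z : List Γ.Sym) (r : Γ.κ → List Γ.Sym) :
    takeStep.Fast 4 (st (Γ.bit true :: m) x y z r) ()
      (st m (Γ.bit true :: x) y (Γ.bit true :: Γ.bit true :: z) r) := by
  refine (fast_pop _ _).bind (u := 3) ?_
  simp only [st_m, List.head?_cons, if_true, update_st_m, List.tail_cons]
  refine ((fast_push _ _ _).bind ((fast_push _ _ _).bind (fast_push _ _ _))).congr ?_ le_rfl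
  simp

/-- The stack `z` is a unary counter with one mark for each subtree still to be read: a leaf uses up
its mark, a node replaces it by two. This finds the end of a prefix code without recursion. The
continuation from the stacks after `t` is a hypothesis so that the induction can chain both
subtrees. -/
theorem fast_take_aux (t : BinTree) {u : ℕ} {m x y z : List Γ.Sym} {r : Γ.κ → List Γ.Sym}
    {a : Γ.Sym} {s : Γ.Stk}
    (h : (pour (.inl .z) fun _ => takeStep).Fast u (st m ((t.ser Γ).reverse ++ x) y z r) () s) :
    (pour (.inl .z) fun _ => takeStep).Fast (7 * t.size + u)
      (st (t.ser Γ ++ m) x y (a :: z) r) () s := by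
  induction t generalizing u m x z a with
  | leaf =>
    refine (fast_pour_of_cons (n := 2) rfl ?_ h).mono (by simp [BinTree.size])
    simpa [BinTree.ser] using fast_takeStep_false m x y z r
  | node l r' h₁ h₂ =>
    refine (fast_pour_of_cons (n := 4) rfl ?_
      (h₁ (a := Γ.bit true) (z := Γ.bit true :: z) (x := Γ.bit true :: x)
        (h₂ (u := u) (m := m) ?_))).mono (by simp [BinTree.size]; omega)
    · simpa [BinTree.ser] using fast_takeStep_true (l.ser Γ ++ (r'.ser Γ ++ m)) x y z r
    · simpa [BinTree.ser] using h

theorem fast_take (t : BinTree) (m x y : List Γ.Sym) (r : Γ.κ → List Γ.Sym) :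
    take.Fast (7 * t.size + 4) (st (t.ser Γ ++ m) x y [] r) ()
      (st m ((t.ser Γ).reverse ++ x) y [] r) := by
  refine ((fast_push _ _ _).bind (u := 7 * t.size + 3) ?_).mono (by omega)
  simpa using fast_take_aux t (fast_pour_of_nil rfl)

/-- Remove the tree on top. -/
noncomputable def drop : Frag Γ Unit :=
  take.bind fun _ => pour (.inl .x) fun _ => done ()

theorem fast_drop (t : BinTree) (m y : List Γ.Sym) (r : Γ.κ → List Γ.Sym) :
    drop.Fast (12 * t.size + 7) (st (t.ser Γ ++ m) [] y [] r) () (st m [] y [] r) :=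
  ((fast_take t _ _ _ _).bind (fast_clear _ _)).congr (by simp) (by simp; omega)

/-- Duplicate the tree on top. -/
noncomputable def dup : Frag Γ Unit :=
  take.bind fun _ =>
    (pour (.inl .x) fun a => (push (.inl .m) a).bind fun _ => push (.inl .y) a).bind fun _ =>
      (pour (.inl .y) (push (.inl .x))).bind fun _ => pour (.inl .x) (push (.inl .m))

theorem fast_dup (t : BinTree) (m : List Γ.Sym) (r : Γ.κ → List Γ.Sym) :
    dup.Fast (20 * t.size + 13) (st (t.ser Γ ++ m) [] [] [] r) ()
      (st (t.ser Γ ++ (t.ser Γ ++ m)) [] [] [] r) := by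
  refine ((fast_take t _ _ _ _).bind ((fast_move₂ _ _ _ ?_ ?_ ?_ _).bind
    ((fast_move _ _ ?_ _).bind (fast_move _ _ ?_ _)))).congr (by simp) (by simp; omega) <;> simp

theorem fast_move_xy (m x y z : List Γ.Sym) (r : Γ.κ → List Γ.Sym) :
    (pour (.inl .x) (push (.inl .y))).Fast (4 * x.length + 3) (st m x y z r) ()
      (st m [] (x.reverse ++ y) z r) := by
  simpa using fast_move (.inl .x) (.inl .y) (by simp) (st m x y z r)

theorem fast_move_yx (m x y z : List Γ.Sym) (r : Γ.κ → List Γ.Sym) :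
    (pour (.inl .y) (push (.inl .x))).Fast (4 * y.length + 3) (st m x y z r) ()
      (st m (y.reverse ++ x) [] z r) := by
  simpa using fast_move (.inl .y) (.inl .x) (by simp) (st m x y z r)

theorem fast_move_xm (m x y z : List Γ.Sym) (r : Γ.κ → List Γ.Sym) :
    (pour (.inl .x) (push (.inl .m))).Fast (4 * x.length + 3) (st m x y z r) ()
      (st (x.reverse ++ m) [] y z r) := by
  simpa using fast_move (.inl .x) (.inl .m) (by simp) (st m x y z r)

/-- Exchange the two trees on top. -/
noncomputable def swap : Frag Γ Unit :=
  take.bind fun _ => (pour (.inl .x) (push (.inl .y))).bind fun _ =>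
    take.bind fun _ => (pour (.inl .y) (push (.inl .x))).bind fun _ =>
      pour (.inl .x) (push (.inl .m))

/-- Each move reverses a code. The first tree goes through `y` and comes back to lie reversed above
the reversed second tree on `x`, so the last move restores both codes in exchanged order. -/
theorem fast_swap (t u : BinTree) (m : List Γ.Sym) (r : Γ.κ → List Γ.Sym) :
    swap.Fast (20 * t.size + 20 * u.size + 17) (st (t.ser Γ ++ (u.ser Γ ++ m)) [] [] [] r) ()
      (st (u.ser Γ ++ (t.ser Γ ++ m)) [] [] [] r) := by
  have h₁ := fast_take t (u.ser Γ ++ m) [] [] r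
  have h₂ := fast_move_xy (u.ser Γ ++ m) ((t.ser Γ).reverse ++ []) [] [] r
  have h₃ := fast_take u m [] (t.ser Γ) r
  have h₄ := fast_move_yx m ((u.ser Γ).reverse ++ []) (t.ser Γ) [] r
  have h₅ := fast_move_xm m ((t.ser Γ).reverse ++ ((u.ser Γ).reverse ++ [])) [] [] r
  simp only [List.append_nil, List.reverse_reverse, List.reverse_append, List.append_assoc,
    List.length_append, List.length_reverse, BinTree.length_ser] at h₁ h₂ h₃ h₄ h₅
  exact (h₁.bind (h₂.bind (h₃.bind (h₄.bind h₅)))).mono (by omega)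

/-! #### Fragments with bounds for time and space -/

/-- The fragment leaves through `e` with the stacks `s'`, in space `m` and, if time matters,
in time `n`. -/
def Cost (F : Frag Γ E) (m n : ℕ) (s : Γ.Stk) (e : E) (s' : Γ.Stk) : Prop :=
  ∃ t, F.Exec (fun s => Ctx.size s ≤ m) t s e s' ∧ (Γ.timed → t ≤ n)

variable {E E' : Type} {m m' n n' : ℕ} {s s' s'' : Γ.Stk} {e : E} {e' : E'}

theorem Fast.cost {F : Frag Γ E} (h : F.Fast n s e s') (hm : Ctx.size s + n ≤ m) :
    F.Cost m n s e s' := by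
  obtain ⟨t, ht, h⟩ := h.exec hm
  exact ⟨t, h, fun _ => ht⟩

theorem Cost.mono {F : Frag Γ E} (h : F.Cost m n s e s') (hm : m ≤ m') (hn : n ≤ n') :
    F.Cost m' n' s e s' := by
  obtain ⟨t, h, ht⟩ := h
  exact ⟨t, h.mono fun _ hs => hs.trans hm, fun hT => (ht hT).trans hn⟩

theorem Cost.bind [Fintype E] {F : Frag Γ E} {G : E → Frag Γ E'} (h : F.Cost m n s e s')
    (h' : (G e).Cost m n' s' e' s'') : (F.bind G).Cost m (n + n') s e' s'' := by
  obtain ⟨t, h, ht⟩ := h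
  obtain ⟨u, h', hu⟩ := h'
  exact ⟨t + u, h.bind h', fun hT => add_le_add (ht hT) (hu hT)⟩

theorem Cost.loop_none {F : Frag Γ (Option E)} (h : F.Cost m n s none s')
    (h' : F.loop.Cost m n' s' e s'') : F.loop.Cost m (n + n') s e s'' := by
  obtain ⟨t, h, ht⟩ := h
  obtain ⟨u, h', hu⟩ := h'
  exact ⟨t + u, h.loop_none h', fun hT => add_le_add (ht hT) (hu hT)⟩

theorem Cost.loop_some {F : Frag Γ (Option E)} (h : F.Cost m n s (some e) s') :
    F.loop.Cost m n s e s' := by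
  obtain ⟨t, h, ht⟩ := h
  exact ⟨t, h.loop_some, ht⟩

theorem Cost.size_le {F : Frag Γ E} (h : F.Cost m n s e s') : Ctx.size s' ≤ m := by
  obtain ⟨t, h, -⟩ := h
  exact h.ok_last

end Frag

end ResourceGames

/-! ### Computable maps between families of trees, and their closure properties -/

namespace ResourceGames

open Ctx

namespace Frag

variable {Γ : Ctx} {E : Type}

theorem Fast.cost_ms {F : Frag Γ E} {n m : ℕ} {L : List Γ.Sym} {e : E} {s' : Γ.Stk}
    (h : F.Fast n (ms L) e s') (hm : L.length + n ≤ m) : F.Cost m n (ms L) e s' :=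
  h.cost (by simpa using hm)

theorem fast_push_ms (a : Γ.Sym) (L : List Γ.Sym) :
    (push (.inl .m) a).Fast 1 (ms L) () (ms (a :: L)) := by
  simpa using fast_push (.inl .m) a (ms L)

theorem fast_pop_ms (a : Γ.Sym) (L : List Γ.Sym) :
    (pop (.inl .m)).Fast 1 (ms (a :: L)) (some a) (ms L) := by
  simpa using fast_pop (.inl .m) (ms (a :: L))

/-- Push a list, its last symbol first. -/
def pushAll (l : List Γ.Sym) : Frag Γ Unit :=
  l.foldr (fun a F => F.bind fun _ => push (.inl .m) a) (done ())

theorem fast_pushAll (l L : List Γ.Sym) :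
    (pushAll l).Fast (l.length + 2) (ms L) () (ms (l ++ L)) := by
  induction l with
  | nil => exact (fast_done _ _).mono (by simp)
  | cons a l ih => exact (ih.bind (fast_push_ms _ _)).mono (by simp)

open Classical in
/-- Remove the root of the tree on top; the exit tells whether the tree has branches. -/
noncomputable def split : Frag Γ Bool :=
  (pop (.inl .m)).bind fun a => done (decide (a = some (Γ.bit true)))

theorem fast_split_leaf (L : List Γ.Sym) :
    split.Fast 3 (ms (BinTree.leaf.ser Γ ++ L)) false (ms L) := by
  classical
  have h := (fast_pop_ms (Γ.bit false) L).bind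
    (G := fun a => done (decide (a = some (Γ.bit true)))) (fast_done _ _)
  simpa [split, BinTree.ser] using h

theorem fast_split_node (l r : BinTree) (L : List Γ.Sym) :
    split.Fast 3 (ms ((BinTree.node l r).ser Γ ++ L)) true (ms (l.ser Γ ++ (r.ser Γ ++ L))) := by
  classical
  have h := (fast_pop_ms (Γ.bit true) (l.ser Γ ++ (r.ser Γ ++ L))).bind
    (G := fun a => done (decide (a = some (Γ.bit true)))) (fast_done _ _)
  simpa [split, BinTree.ser] using h

end Frag

open Frag

/-- Some fragment computes `g a` from `e a`, both for trees on the main stack, within polynomial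
space and, if time matters, time. -/
def Ctx.Comp (Γ : Ctx) {α : Type} (e g : α → BinTree) : Prop :=
  ∃ (F : Frag Γ Unit) (p : Polynomial ℕ), ∀ a rest,
    F.Cost (p.eval (e a).size + rest.length) (p.eval (e a).size)
      (ms ((e a).ser Γ ++ rest)) () (ms ((g a).ser Γ ++ rest))

namespace Ctx.Comp

variable {Γ : Ctx} {α β : Type} {e g h : α → BinTree}

theorem of_fast (F : Frag Γ Unit) (p : Polynomial ℕ)
    (hF : ∀ a rest, F.Fast (p.eval (e a).size) (ms ((e a).ser Γ ++ rest)) ()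
      (ms ((g a).ser Γ ++ rest))) : Γ.Comp e g :=
  ⟨F, Polynomial.X + p, fun a rest => ((hF a rest).cost_ms (by simp; omega)).mono le_rfl (by simp)⟩

/-- The result is on the stacks at the end, so the space bound, with nothing below the argument,
bounds its size. -/
theorem size_le (hg : Γ.Comp e g) :
    ∃ p : Polynomial ℕ, ∀ a, (g a).size ≤ p.eval (e a).size := by
  obtain ⟨F, p, hF⟩ := hg
  refine ⟨p, fun a => ?_⟩
  have := (hF a []).size_le
  simpa using this

theorem congr {g' : α → BinTree} (hg : Γ.Comp e g) (h : ∀ a, g a = g' a) : Γ.Comp e g' :=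
  funext h ▸ hg

/-- Restriction of the family. -/
theorem restrict (hg : Γ.Comp e g) (φ : β → α) : Γ.Comp (e ∘ φ) (g ∘ φ) := by
  obtain ⟨F, p, hF⟩ := hg
  exact ⟨F, p, fun a => hF (φ a)⟩

theorem refl : Γ.Comp e e :=
  of_fast (done ()) 2 fun _ _ => by
    simpa using fast_done _ _

theorem trans (hg : Γ.Comp e g) (hh : Γ.Comp g h) : Γ.Comp e h := by
  obtain ⟨p', hp'⟩ := hg.size_le
  obtain ⟨F, p, hF⟩ := hg
  obtain ⟨G, q, hG⟩ := hh
  refine ⟨F.bind fun _ => G, p + q.comp p', fun a rest => ?_⟩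
  have hq := polynomial_eval_mono q (hp' a)
  refine Cost.mono (((hF a rest).mono ?_ le_rfl).bind ((hG a rest).mono ?_ le_rfl)) le_rfl ?_ <;>
    simp <;> omega

theorem const (t : BinTree) : Γ.Comp e fun _ => t :=
  of_fast (drop.bind fun _ => pushAll (t.ser Γ)) (12 * Polynomial.X + 7 + ((t.size : Polynomial ℕ) + 2))
    fun a rest => ((fast_drop (e a) rest _ _).bind (fast_pushAll _ _)).mono (by simp)

theorem left {l r : α → BinTree} (h : Γ.Comp e fun a => .node (l a) (r a)) : Γ.Comp e l := by
  refine h.trans (of_fast (split.bind fun _ => swap.bind fun _ => drop) (40 * Polynomial.X + 40)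
    fun a rest => ?_)
  refine ((fast_split_node _ _ _).bind ((fast_swap _ _ _ _).bind (fast_drop _ _ _ _))).mono ?_
  simp [BinTree.size]
  omega

theorem right {l r : α → BinTree} (h : Γ.Comp e fun a => .node (l a) (r a)) : Γ.Comp e r := by
  refine h.trans (of_fast (split.bind fun _ => drop) (40 * Polynomial.X + 40) fun a rest => ?_)
  refine ((fast_split_node _ _ _).bind (fast_drop _ _ _ _)).mono ?_
  simp [BinTree.size]
  omega

/-- A fragment works above an arbitrary `rest` and preserves it, so a copy of the argument can wait
below for the second computation. The factor 100 in the polynomial is slack. -/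
theorem node (hg : Γ.Comp e g) (hh : Γ.Comp e h) : Γ.Comp e fun a => .node (g a) (h a) := by
  obtain ⟨p', hp'⟩ := hg.size_le
  obtain ⟨q', hq'⟩ := hh.size_le
  obtain ⟨F, p, hF⟩ := hg
  obtain ⟨G, q, hG⟩ := hh
  refine ⟨dup.bind fun _ => F.bind fun _ => swap.bind fun _ => G.bind fun _ => swap.bind fun _ =>
    push (.inl .m) (Γ.bit true), 100 * (1 + Polynomial.X + p + q + p' + q'), fun a rest => ?_⟩
  have h1 := hp' a
  have h2 := hq' a
  set P := 100 * (1 + Polynomial.X + p + q + p' + q') with hP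
  have e1 := fast_dup (Γ := Γ) (e a) rest fun _ => []
  have e2 := hF a ((e a).ser Γ ++ rest)
  have e3 := fast_swap (Γ := Γ) (g a) (e a) rest fun _ => []
  have e4 := hG a ((g a).ser Γ ++ rest)
  have e5 := fast_swap (Γ := Γ) (h a) (g a) rest fun _ => []
  have e6 := fast_push_ms (Γ := Γ) (Γ.bit true) ((g a).ser Γ ++ ((h a).ser Γ ++ rest))
  have c1 := e1.cost_ms (m := P.eval (e a).size + rest.length) (by simp [hP]; omega)
  have c2 := e2.mono (m' := P.eval (e a).size + rest.length) (by simp [hP]; omega) le_rfl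
  have c3 := e3.cost_ms (m := P.eval (e a).size + rest.length) (by simp [hP]; omega)
  have c4 := e4.mono (m' := P.eval (e a).size + rest.length) (by simp [hP]; omega) le_rfl
  have c5 := e5.cost_ms (m := P.eval (e a).size + rest.length) (by simp [hP]; omega)
  have c6 := e6.cost_ms (m := P.eval (e a).size + rest.length) (by simp [hP]; omega)
  simp only [BinTree.ser, List.cons_append, List.append_assoc]
  refine (c1.bind (c2.bind (c3.bind (c4.bind (c5.bind c6))))).mono le_rfl ?_
  simp [hP]; omega

/-- Case distinction on the shape of a computed tree. -/
theorem cases {l : α → BinTree} (hl : Γ.Comp e l)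
    (h₀ : Γ.Comp (fun a : {a // l a = .leaf} => e a) fun a => g a)
    (h₁ : Γ.Comp (fun a : {a : α × BinTree × BinTree // l a.1 = .node a.2.1 a.2.2} =>
      .node (e a.1.1) (.node a.1.2.1 a.1.2.2)) fun a => g a.1.1) : Γ.Comp e g := by
  obtain ⟨p', hp'⟩ := hl.size_le
  obtain ⟨F, p, hF⟩ := hl
  obtain ⟨G, q, hG⟩ := h₀
  obtain ⟨H, r, hH⟩ := h₁
  -- In the second case the two branches lie above `e a` after `split`. Pushing a root joins them
  -- again, `swap` brings `e a` to the top, and one more root joins everything to the argument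
  -- expected by `H`.
  refine ⟨dup.bind fun _ => F.bind fun _ => split.bind fun b => bif b then
      (push (.inl .m) (Γ.bit true)).bind fun _ => swap.bind fun _ =>
        (push (.inl .m) (Γ.bit true)).bind fun _ => H else G,
    100 * (1 + Polynomial.X + p + p' + q + r.comp (Polynomial.X + p' + 1)), fun a rest => ?_⟩
  set P := 100 * (1 + Polynomial.X + p + p' + q + r.comp (Polynomial.X + p' + 1)) with hP
  have h1 := hp' a
  have e1 := fast_dup (Γ := Γ) (e a) rest fun _ => []
  have e2 := hF a ((e a).ser Γ ++ rest)
  have c1 := e1.cost_ms (m := P.eval (e a).size + rest.length) (by simp [hP]; omega)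
  have c2 := e2.mono (m' := P.eval (e a).size + rest.length) (by simp [hP]; omega) le_rfl
  cases hla : l a with
  | leaf =>
    rw [hla] at c2
    have e3 := fast_split_leaf (Γ := Γ) ((e a).ser Γ ++ rest)
    have c3 := e3.cost_ms (m := P.eval (e a).size + rest.length) (by
      have := BinTree.one_le_size (e a); simp [hP, BinTree.size]; omega)
    have e4 := hG ⟨a, hla⟩ rest
    have c4 := e4.mono (m' := P.eval (e a).size + rest.length) (by simp [hP]; omega) le_rfl
    exact (c1.bind (c2.bind (c3.bind c4))).mono le_rfl (by simp [hP]; omega)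
  | node b c =>
    rw [hla] at c2 h1
    have e3 := fast_split_node (Γ := Γ) b c ((e a).ser Γ ++ rest)
    have c3 := e3.cost_ms (m := P.eval (e a).size + rest.length) (by simp [hP]; omega)
    have e4 := fast_push_ms (Γ := Γ) (Γ.bit true) (b.ser Γ ++ (c.ser Γ ++ ((e a).ser Γ ++ rest)))
    have c4 := e4.cost_ms (m := P.eval (e a).size + rest.length) (by
      simp [hP, BinTree.size] at h1 ⊢; omega)
    have e5 := fast_swap (Γ := Γ) (.node b c) (e a) rest fun _ => []
    have c5 := e5.cost_ms (m := P.eval (e a).size + rest.length) (by simp [hP]; omega)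
    have e6 := fast_push_ms (Γ := Γ) (Γ.bit true)
      ((e a).ser Γ ++ ((BinTree.node b c).ser Γ ++ rest))
    have c6 := e6.cost_ms (m := P.eval (e a).size + rest.length) (by simp [hP]; omega)
    have e7 := hH ⟨(a, b, c), hla⟩ rest
    have hr := polynomial_eval_mono r (m := 1 + (e a).size + (BinTree.node b c).size)
      (n := (e a).size + p'.eval (e a).size + 1) (by omega)
    have c7 := e7.mono (m' := P.eval (e a).size + rest.length)
      (by simp [hP]; simp [BinTree.size] at hr ⊢; omega) le_rfl
    simp only [BinTree.ser, List.cons_append, List.append_assoc] at c2 c3 c4 c5 c6 c7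
    refine (c1.bind (c2.bind (c3.bind (c4.bind (c5.bind (c6.bind c7)))))).mono le_rfl ?_
    simp [hP]; simp [BinTree.size] at hr h1 ⊢; omega

/-- While loops. -/
theorem whileLoop {σ : Type} {s : σ → BinTree} {c : σ → BinTree} {f : σ → σ} (hc : Γ.Comp s c)
    (hf : Γ.Comp s fun a => s (f a)) (i : α → σ) (n : α → ℕ) (q : Polynomial ℕ)
    (hn : ∀ a, ∀ k < n a, c (f^[k] (i a)) ≠ .leaf) (hn' : ∀ a, c (f^[n a] (i a)) = .leaf)
    (hs : ∀ a, ∀ k ≤ n a, (s (f^[k] (i a))).size ≤ q.eval (s (i a)).size)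
    (ht : Γ.timed → ∀ a, n a ≤ q.eval (s (i a)).size) :
    Γ.Comp (fun a => s (i a)) fun a => s (f^[n a] (i a)) := by
  obtain ⟨p', hp'⟩ := hc.size_le
  obtain ⟨F, p, hF⟩ := hc
  obtain ⟨G, r, hG⟩ := hf
  let B : Polynomial ℕ := 100 * (1 + q + p.comp q + p'.comp q + r.comp q)
  let body : Frag Γ (Option Unit) := dup.bind fun _ => F.bind fun _ => split.bind fun b =>
    bif b then drop.bind fun _ => drop.bind fun _ => G.bind fun _ => done none
    else done (some ())
  -- One round costs at most `B`, and there are at most `q` rounds and a final failing test. The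
  -- space is reused, so `B` alone bounds it; the factor `q + 1` is needed only for the time.
  refine ⟨loop body, (q + 1) * B, fun a rest => ?_⟩
  dsimp only
  have hB : B.eval (s (i a)).size ≤ ((q + 1) * B).eval (s (i a)).size := by
    simp only [Polynomial.eval_mul]
    exact Nat.le_mul_of_pos_left _ (by simp)
  -- one round
  have start : ∀ k ≤ n a, dup.Cost (B.eval (s (i a)).size + rest.length)
      (20 * (s (f^[k] (i a))).size + 13) (ms ((s (f^[k] (i a))).ser Γ ++ rest)) ()
      (ms ((s (f^[k] (i a))).ser Γ ++ ((s (f^[k] (i a))).ser Γ ++ rest))) ∧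
      F.Cost (B.eval (s (i a)).size + rest.length) (p.eval (s (f^[k] (i a))).size)
      (ms ((s (f^[k] (i a))).ser Γ ++ ((s (f^[k] (i a))).ser Γ ++ rest))) ()
      (ms ((c (f^[k] (i a))).ser Γ ++ ((s (f^[k] (i a))).ser Γ ++ rest))) := by
    intro k hk
    have h1 := hs a k hk
    have h2 := polynomial_eval_mono p h1
    refine ⟨(fast_dup _ _ _).cost_ms ?_, (hF (f^[k] (i a)) _).mono ?_ le_rfl⟩ <;>
      simp [B] <;> omega
  have next : ∀ k < n a, body.Cost (B.eval (s (i a)).size + rest.length)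
      (B.eval (s (i a)).size) (ms ((s (f^[k] (i a))).ser Γ ++ rest)) none
      (ms ((s (f^[k + 1] (i a))).ser Γ ++ rest)) := by
    intro k hk
    obtain ⟨c1, c2⟩ := start k hk.le
    have h1 := hs a k hk.le
    have h2 := polynomial_eval_mono p h1
    have h3 := polynomial_eval_mono p' h1
    have h4 := polynomial_eval_mono r h1
    have h5 := hp' (f^[k] (i a))
    have h6 := hs a (k + 1) hk
    have hk' := hn a k hk
    rw [Function.iterate_succ_apply'] at h6 ⊢
    cases hck : c (f^[k] (i a)) with
    | leaf => exact absurd hck hk'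
    | node x y =>
      rw [hck] at c2 h5
      have c3 := (fast_split_node (Γ := Γ) x y ((s (f^[k] (i a))).ser Γ ++ rest)).cost_ms
        (m := B.eval (s (i a)).size + rest.length) (by simp [B]; omega)
      simp only [BinTree.size] at h5
      have c4 := (fast_drop (Γ := Γ) x (y.ser Γ ++ ((s (f^[k] (i a))).ser Γ ++ rest)) []
        fun _ => []).cost_ms
        (m := B.eval (s (i a)).size + rest.length) (by simp [B]; omega)
      have c5 := (fast_drop (Γ := Γ) y ((s (f^[k] (i a))).ser Γ ++ rest) []
        fun _ => []).cost_ms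
        (m := B.eval (s (i a)).size + rest.length) (by simp [B]; omega)
      have c6 := (hG (f^[k] (i a)) rest).mono (m' := B.eval (s (i a)).size + rest.length)
        (by simp [B]; omega) le_rfl
      have c7 := (fast_done (none : Option Unit) (ms ((s (f (f^[k] (i a)))).ser Γ ++ rest))).cost_ms
        (m := B.eval (s (i a)).size + rest.length) (by simp [B]; omega)
      refine (c1.bind (c2.bind (c3.bind (c4.bind (c5.bind (c6.bind c7)))))).mono le_rfl ?_
      simp [B]; omega
  have last : body.Cost (B.eval (s (i a)).size + rest.length)
      (B.eval (s (i a)).size) (ms ((s (f^[n a] (i a))).ser Γ ++ rest)) (some ())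
      (ms ((s (f^[n a] (i a))).ser Γ ++ rest)) := by
    obtain ⟨c1, c2⟩ := start (n a) le_rfl
    have h1 := hs a (n a) le_rfl
    have h2 := polynomial_eval_mono p h1
    rw [hn' a] at c2
    have c3 := (fast_split_leaf (Γ := Γ) ((s (f^[n a] (i a))).ser Γ ++ rest)).cost_ms
      (m := B.eval (s (i a)).size + rest.length) (by simp [B, BinTree.size]; omega)
    have c7 := (fast_done (some ()) (ms ((s (f^[n a] (i a))).ser Γ ++ rest))).cost_ms
      (m := B.eval (s (i a)).size + rest.length) (by simp [B]; omega)
    refine (c1.bind (c2.bind (c3.bind c7))).mono le_rfl ?_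
    simp [B]; omega
  -- Induction on the number `j` of rounds that remain.
  have all : ∀ j k, k + j = n a → (loop body).Cost (B.eval (s (i a)).size + rest.length)
      ((j + 1) * B.eval (s (i a)).size) (ms ((s (f^[k] (i a))).ser Γ ++ rest)) ()
      (ms ((s (f^[n a] (i a))).ser Γ ++ rest)) := by
    intro j
    induction j with
    | zero =>
      rintro k rfl
      simpa using last.loop_some
    | succ j ih =>
      intro k hk
      refine ((next k (by omega)).loop_none (ih (k + 1) (by omega))).mono le_rfl ?_
      ring_nf
      rfl
  obtain ⟨t, h, hT⟩ := all (n a) 0 (by simp)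
  refine Cost.mono (n := ((q + 1) * B).eval (s (i a)).size) ⟨t, h, fun hT' => ?_⟩ (by omega) le_rfl
  refine (hT hT').trans ?_
  simp only [Polynomial.eval_mul, Polynomial.eval_add, Polynomial.eval_one]
  exact Nat.mul_le_mul_right _ (Nat.succ_le_succ (ht hT' a))

end Ctx.Comp

end ResourceGames

namespace ResourceGames

/-! ### Functions on data -/

/-- Types whose elements are represented by trees. -/
class TreeEnc (α : Type) where
  tree : α → BinTree

open TreeEnc

/-- The size of the representation. -/
def tsize {α : Type} [TreeEnc α] (a : α) : ℕ := (tree a).size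

instance : TreeEnc Unit := ⟨fun _ => .leaf⟩

instance : TreeEnc Bool := ⟨fun b => bif b then .node .leaf .leaf else .leaf⟩

instance {α β : Type} [TreeEnc α] [TreeEnc β] : TreeEnc (α × β) :=
  ⟨fun p => .node (tree p.1) (tree p.2)⟩

/-- The tree of a list. -/
def treeList {α : Type} [TreeEnc α] : List α → BinTree
  | [] => .leaf
  | a :: l => .node (tree a) (treeList l)

instance {α : Type} [TreeEnc α] : TreeEnc (List α) := ⟨treeList⟩

section tsize

variable {α β : Type} [TreeEnc α] [TreeEnc β]

@[simp] theorem tsize_pair (a : α) (b : β) : tsize (a, b) = 1 + tsize a + tsize b := rfl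

@[simp] theorem tsize_nil : tsize ([] : List α) = 1 := rfl

@[simp] theorem tsize_cons (a : α) (l : List α) : tsize (a :: l) = 1 + tsize a + tsize l := rfl

theorem one_le_tsize (a : α) : 1 ≤ tsize a := (tree a).one_le_size

theorem tsize_bool_le (b : Bool) : tsize b ≤ 3 := by cases b <;> decide

theorem length_lt_tsize (l : List α) : l.length < tsize l := by
  induction l with
  | nil => simp
  | cons a l ih => simp; omega

theorem tsize_le_of_mem {a : α} {l : List α} (h : a ∈ l) : tsize a ≤ tsize l := by
  induction h with
  | head => simp; omega
  | tail _ _ ih => simp; omega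

theorem tsize_le_of_sublist {l l' : List α} (h : l.Sublist l') : tsize l ≤ tsize l' := by
  induction h with
  | slnil => rfl
  | cons _ _ ih => simp; omega
  | cons_cons _ _ ih => simp; omega

theorem tsize_append (l l' : List α) : tsize (l ++ l') + 1 = tsize l + tsize l' := by
  induction l with
  | nil => simp; omega
  | cons a l ih => simp; omega

end tsize

/-- The function is computed by a fragment, in polynomial space and, if time matters, time. -/
@[fun_prop]
def PT (Γ : Ctx) {α β : Type} [TreeEnc α] [TreeEnc β] (f : α → β) : Prop :=
  Γ.Comp (fun a => tree a) fun a => tree (f a)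

namespace PT

variable {Γ : Ctx} {α β γ δ σ : Type} [TreeEnc α] [TreeEnc β] [TreeEnc γ] [TreeEnc δ] [TreeEnc σ]

theorem size_le {f : α → β} (hf : PT Γ f) :
    ∃ p : Polynomial ℕ, ∀ a, tsize (f a) ≤ p.eval (tsize a) := Ctx.Comp.size_le hf

theorem of_eq {f g : α → β} (hf : PT Γ f) (h : ∀ a, f a = g a) : PT Γ g := funext h ▸ hf

@[fun_prop] theorem id : PT Γ (fun a : α => a) := Ctx.Comp.refl

@[fun_prop] theorem const (b : β) : PT Γ (fun _ : α => b) := Ctx.Comp.const _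

@[fun_prop] theorem comp {g : β → γ} {f : α → β} (hg : PT Γ g) (hf : PT Γ f) :
    PT Γ fun a => g (f a) :=
  Ctx.Comp.trans hf (Ctx.Comp.restrict hg f)

@[fun_prop] theorem prodMk {f : α → β} {g : α → γ} (hf : PT Γ f) (hg : PT Γ g) :
    PT Γ fun a => (f a, g a) := Ctx.Comp.node hf hg

@[fun_prop] theorem fst {f : α → β × γ} (hf : PT Γ f) : PT Γ fun a => (f a).1 :=
  Ctx.Comp.left (r := fun a => tree (f a).2) hf

@[fun_prop] theorem snd {f : α → β × γ} (hf : PT Γ f) : PT Γ fun a => (f a).2 :=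
  Ctx.Comp.right (l := fun a => tree (f a).1) hf

@[fun_prop] theorem cons {f : α → β} {g : α → List β} (hf : PT Γ f) (hg : PT Γ g) :
    PT Γ fun a => f a :: g a := Ctx.Comp.node hf hg

theorem list_cases {l : α → List β} {f : α → γ} {g : α → β → List β → γ} (hl : PT Γ l)
    (hf : PT Γ f) (hg : PT Γ fun p : α × β × List β => g p.1 p.2.1 p.2.2) :
    PT Γ fun a => (match l a with
      | [] => f a
      | b :: t => g a b t : γ) := by
  let R (a : α) : γ := match l a with
      | [] => f a
      | b :: t => g a b t
  refine Ctx.Comp.cases (g := fun a => tree (R a)) hl ?_ ?_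
  · refine (Ctx.Comp.restrict (β := {a // tree (l a) = .leaf}) hf Subtype.val).congr ?_
    rintro ⟨a, ha⟩
    cases h : l a with
    | nil => simp [R, h]
    | cons b t => rw [h] at ha; cases ha
  · let S := {a : α × BinTree × BinTree // tree (l a.1) = .node a.2.1 a.2.2}
    -- Case distinction on trees yields two bare subtrees; since together they are the tree of `l
    -- a`, they represent the head and the tail of that list.
    have key : ∀ a : S, ∃ p : α × β × List β, p.1 = a.1.1 ∧ a.1.2.1 = tree p.2.1 ∧
        a.1.2.2 = tree p.2.2 ∧ l a.1.1 = p.2.1 :: p.2.2 := by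
      rintro ⟨⟨a, x, y⟩, h⟩
      cases hl : l a with
      | nil => simp only [hl] at h; cases h
      | cons b t => simp only [hl] at h; cases h; exact ⟨(a, b, t), rfl, rfl, rfl, rfl⟩
    choose φ h1 h2 h3 h4 using key
    have := Ctx.Comp.restrict hg φ
    convert this using 1
    · ext a : 1
      simp only [Function.comp_apply, ← h1 a, h2 a, h3 a]
      rfl
    · ext a : 1
      simp only [R, h4 a, Function.comp_apply, h1 a]

@[fun_prop] theorem cond {c : α → Bool} {f g : α → β} (hc : PT Γ c) (hf : PT Γ f) (hg : PT Γ g) :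
    PT Γ fun a => bif c a then f a else g a := by
  -- The trees of `true` and `false` are those of the lists `[()]` and `[]`, so a Boolean test is a
  -- case distinction on lists.
  have h := list_cases (Γ := Γ) (l := fun a => bif c a then [()] else []) (f := g)
    (g := fun a _ _ => f a) (by
      refine Ctx.Comp.congr (g := fun a => tree (c a)) hc fun a => ?_
      change tree (c a) = tree (bif c a then [()] else [])
      cases c a <;> rfl) hg (by fun_prop)
  refine h.of_eq fun a => ?_
  cases c a <;> rfl

/-- Computability for each fixed value of a Boolean gives computability in the Boolean as an
argument; iterated, this dispatches the sixteen instructions of the decoder. -/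
theorem bool_family {f : Bool → α → β} (hf : ∀ b, PT Γ (f b)) :
    PT Γ fun p : Bool × α => f p.1 p.2 := by
  have h1 := hf true
  have h0 := hf false
  refine (PT.cond (Γ := Γ) (c := fun p : Bool × α => p.1) (f := fun p => f true p.2)
    (g := fun p => f false p.2) (by fun_prop) (by fun_prop) (by fun_prop)).of_eq ?_
  rintro ⟨_ | _, a⟩ <;> rfl

@[fun_prop] theorem and {f g : α → Bool} (hf : PT Γ f) (hg : PT Γ g) :
    PT Γ fun a => f a && g a :=
  (PT.cond hf hg (PT.const false)).of_eq fun a => by cases f a <;> rfl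

@[fun_prop] theorem or {f g : α → Bool} (hf : PT Γ f) (hg : PT Γ g) :
    PT Γ fun a => f a || g a :=
  (PT.cond hf (PT.const true) hg).of_eq fun a => by cases f a <;> rfl

@[fun_prop] theorem not {f : α → Bool} (hf : PT Γ f) : PT Γ fun a => !f a :=
  (PT.cond hf (PT.const false) (PT.const true)).of_eq fun a => by cases f a <;> rfl

@[fun_prop] theorem isEmpty {l : α → List β} (hl : PT Γ l) : PT Γ fun a => (l a).isEmpty :=
  (list_cases hl (PT.const true) (g := fun _ _ _ => false) (PT.const false)).of_eq fun a => by
    cases l a <;> rfl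

@[fun_prop] theorem tail {l : α → List β} (hl : PT Γ l) : PT Γ fun a => (l a).tail :=
  (list_cases hl (PT.const []) (g := fun _ _ t => t) (by fun_prop)).of_eq fun a => by
    cases l a <;> rfl

/-! #### Iteration over a list -/

/-- The fold is a while loop on triples of parameter, accumulator and remaining list. The remaining
list itself is the loop test, as only the empty list has a leaf as its tree. -/
theorem foldl_of_bound {l : α → List β} {i : α → σ} {f : α → σ → β → σ} (hl : PT Γ l)
    (hi : PT Γ i) (hf : PT Γ fun p : α × σ × β => f p.1 p.2.1 p.2.2)
    (hb : ∃ q : Polynomial ℕ, ∀ a, ∀ l' : List β, l'.IsPrefix (l a) →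
      tsize (l'.foldl (f a) (i a)) ≤ q.eval (tsize a)) :
    PT Γ fun a => (l a).foldl (f a) (i a) := by
  obtain ⟨q, hq⟩ := hb
  let step : α × σ × List β → α × σ × List β := fun p => match p.2.2 with
    | [] => p
    | b :: t => (p.1, f p.1 p.2.1 b, t)
  have hstep : PT Γ step := by
    refine list_cases (l := fun p : α × σ × List β => p.2.2) (by fun_prop) PT.id
      (g := fun p b t => (p.1, f p.1 p.2.1 b, t)) ?_
    have := hf.comp (f := fun p : (α × σ × List β) × β × List β => (p.1.1, p.1.2.1, p.2.1)) (by fun_prop)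
    fun_prop
  have hit : ∀ k a, k ≤ (l a).length → step^[k] (a, i a, l a) =
      (a, ((l a).take k).foldl (f a) (i a), (l a).drop k) := by
    intro k a
    induction k with
    | zero => simp
    | succ k ih =>
      intro hk
      rw [Function.iterate_succ_apply', ih (by omega), List.take_succ_eq_append_getElem (by omega),
        List.drop_eq_getElem_cons (i := k) (by omega), List.foldl_append]
      rfl
  have hstart : PT Γ fun a => (a, i a, l a) := by fun_prop
  have hloop := Ctx.Comp.whileLoop (Γ := Γ) (s := fun p : α × σ × List β => tree p)
    (c := fun p : α × σ × List β => tree p.2.2) (f := step) (PT.snd (PT.snd PT.id)) hstep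
    (fun a => (a, i a, l a)) (fun a => (l a).length) (q + Polynomial.X)
    (fun a k hk => by
      rw [hit k a hk.le, List.drop_eq_getElem_cons hk]
      intro h; cases h)
    (fun a => by
      rw [hit _ a le_rfl, List.drop_length]
      rfl)
    (fun a k hk => by
      rw [hit k a hk]
      have h1 := hq a _ (List.take_prefix k (l a))
      have h2 := tsize_le_of_sublist (List.drop_sublist k (l a))
      have h3 : tsize a ≤ tsize (a, i a, l a) := by simp; omega
      have h4 := polynomial_eval_mono q h3
      change tsize (a, _, _) ≤ Polynomial.eval (tsize (a, i a, l a)) _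
      rw [Polynomial.eval_add, Polynomial.eval_X]
      have h5 := one_le_tsize (i a)
      have h6 : tsize (a, ((l a).take k).foldl (f a) (i a), (l a).drop k) ≤
        (1 + tsize a + (1 + q.eval (tsize a) + tsize (l a))) := by
        simp only [tsize_pair]; omega
      refine h6.trans ?_
      simp only [tsize_pair] at h4 ⊢
      omega)
    (fun _ a => by
      have := length_lt_tsize (l a)
      change _ ≤ Polynomial.eval (tsize (a, i a, l a)) _
      rw [Polynomial.eval_add, Polynomial.eval_X]
      simp only [tsize_pair]
      omega)
  refine Ctx.Comp.trans hstart (Ctx.Comp.trans hloop ?_)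
  have hproj := Ctx.Comp.restrict (PT.fst (PT.snd (PT.id (Γ := Γ) (α := α × σ × List β))))
    fun a => step^[(l a).length] (a, i a, l a)
  refine hproj.congr fun a => ?_
  simp [hit _ a le_rfl]

/-- If each step adds to the accumulator an amount that does not depend on it, then polynomially
many steps keep it polynomial. Growth by a constant factor in each step would not. -/
theorem foldl {l : α → List β} {i : α → σ} {f : α → σ → β → σ} (hl : PT Γ l)
    (hi : PT Γ i) (hf : PT Γ fun p : α × σ × β => f p.1 p.2.1 p.2.2)
    (hb : ∃ q : Polynomial ℕ, ∀ a s b, tsize (f a s b) ≤ tsize s + q.eval (tsize a + tsize b)) :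
    PT Γ fun a => (l a).foldl (f a) (i a) := by
  obtain ⟨q, hq⟩ := hb
  obtain ⟨pl, hpl⟩ := hl.size_le
  obtain ⟨pi, hpi⟩ := hi.size_le
  refine foldl_of_bound hl hi hf ⟨pi + pl * q.comp (Polynomial.X + pl), fun a l' hl' => ?_⟩
  have key : ∀ l₁ : List β, (∀ b ∈ l₁, tsize b ≤ tsize (l a)) → ∀ s, tsize (l₁.foldl (f a) s) ≤
      tsize s + l₁.length * q.eval (tsize a + pl.eval (tsize a)) := by
    intro l₁
    induction l₁ with
    | nil => simp
    | cons b t ih =>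
      intro h s
      have h1 := hq a s b
      have h2 := ih (fun c hc => h c (List.mem_cons_of_mem _ hc)) (f a s b)
      have h3 := polynomial_eval_mono q (m := tsize a + tsize b)
        (n := tsize a + pl.eval (tsize a)) (by
          have := h b List.mem_cons_self
          have := hpl a
          omega)
      simp only [List.foldl_cons, List.length_cons, add_mul, one_mul]
      omega
  have h1 := key l' (fun b hb => tsize_le_of_mem (hl'.subset hb)) (i a)
  have h2 : l'.length ≤ pl.eval (tsize a) :=
    hl'.length_le.trans ((length_lt_tsize _).le.trans (hpl a))
  have h3 := Nat.mul_le_mul_right (q.eval (tsize a + pl.eval (tsize a))) h2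
  have h4 := hpi a
  simp only [Polynomial.eval_add, Polynomial.eval_mul, Polynomial.eval_comp, Polynomial.eval_X]
  omega

@[fun_prop] theorem reverse {l : α → List β} (hl : PT Γ l) : PT Γ fun a => (l a).reverse := by
  have := foldl (f := fun _ (s : List β) b => b :: s) hl (PT.const []) (by fun_prop)
    ⟨1 + Polynomial.X, fun a s b => by simp; omega⟩
  refine this.of_eq fun a => ?_
  simp

@[fun_prop] theorem append {l l' : α → List β} (hl : PT Γ l) (hl' : PT Γ l') :
    PT Γ fun a => l a ++ l' a := by
  have := foldl (f := fun _ (s : List β) b => b :: s) (PT.reverse hl) hl' (by fun_prop)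
    ⟨1 + Polynomial.X, fun a s b => by simp; omega⟩
  refine this.of_eq fun a => ?_
  simp

theorem flatMap {l : α → List β} {g : α → β → List γ} (hl : PT Γ l)
    (hg : PT Γ fun p : α × β => g p.1 p.2) : PT Γ fun a => (l a).flatMap (g a) := by
  obtain ⟨q, hq⟩ := hg.size_le
  have hg' := hg.comp (f := fun p : α × List γ × β => (p.1, p.2.2)) (by fun_prop)
  have := foldl (f := fun a (s : List γ) b => s ++ g a b) hl (PT.const []) (by fun_prop)
    ⟨q.comp (Polynomial.X + 1), fun a s b => by
      have h1 := tsize_append s (g a b)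
      have h2 := hq (a, b)
      simp only [tsize_pair, add_assoc, Nat.add_comm 1] at h2
      simp only [Polynomial.eval_comp, Polynomial.eval_add, Polynomial.eval_X,
        Polynomial.eval_one, add_assoc]
      omega⟩
  refine this.of_eq fun a => ?_
  have key : ∀ (l : List β) s, l.foldl (fun s b => s ++ g a b) s = s ++ l.flatMap (g a) := by
    intro l
    induction l with
    | nil => simp
    | cons b t ih => intro s; simp [ih]
  simp [key]

theorem map {l : α → List β} {g : α → β → γ} (hl : PT Γ l)
    (hg : PT Γ fun p : α × β => g p.1 p.2) : PT Γ fun a => (l a).map (g a) :=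
  (flatMap (g := fun a b => [g a b]) hl (by fun_prop)).of_eq fun a => by
    induction l a <;> simp_all

theorem any {l : α → List β} {g : α → β → Bool} (hl : PT Γ l)
    (hg : PT Γ fun p : α × β => g p.1 p.2) : PT Γ fun a => (l a).any (g a) := by
  have hg' := hg.comp (f := fun p : α × Bool × β => (p.1, p.2.2)) (by fun_prop)
  have := foldl (f := fun a (s : Bool) b => s || g a b) hl (PT.const false) (by fun_prop)
    ⟨3, fun a s b => by have := tsize_bool_le (s || g a b); simp; omega⟩
  refine this.of_eq fun a => ?_
  have key : ∀ (l : List β) s, l.foldl (fun s b => s || g a b) s = (s || l.any (g a)) := by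
    intro l
    induction l with
    | nil => simp
    | cons b t ih => intro s; simp [ih, Bool.or_assoc]
  simp [key]

theorem all {l : α → List β} {g : α → β → Bool} (hl : PT Γ l)
    (hg : PT Γ fun p : α × β => g p.1 p.2) : PT Γ fun a => (l a).all (g a) :=
  (PT.not (any (g := fun a b => !g a b) hl (by fun_prop))).of_eq fun a => by
    simp [List.not_any_eq_all_not]

/-! #### Equality and multisets -/

/-- A fold over the first string. The accumulator records whether all bits agreed so far and what
remains of the second string, which has to be empty at the end. -/
theorem decide_eq_bits :
    PT Γ fun p : List Bool × List Bool => decide (p.1 = p.2) := by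
  let f : Bool × List Bool → Bool → Bool × List Bool := fun s a => match s.2 with
    | [] => (false, [])
    | b :: t => (s.1 && (bif a then b else !b), t)
  have hf : PT Γ fun p : (List Bool × List Bool) × (Bool × List Bool) × Bool =>
      f p.2.1 p.2.2 :=
    list_cases (Γ := Γ) (l := fun p : (List Bool × List Bool) × (Bool × List Bool) × Bool => p.2.1.2)
      (f := fun _ => (false, [])) (g := fun p b t => (p.2.1.1 && (bif p.2.2 then b else !b), t))
      (by fun_prop) (by fun_prop) (by fun_prop) |>.of_eq fun p => by
        obtain ⟨_, ⟨_, _ | _⟩, _⟩ := p <;> rfl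
  have := foldl (Γ := Γ) (α := List Bool × List Bool) (l := fun p => p.1)
    (i := fun p => (true, p.2)) (f := fun _ => f) (by fun_prop) (by fun_prop) hf
    ⟨5, fun a s b => by
      obtain ⟨c, l⟩ := s
      cases l with
      | nil => have := tsize_bool_le false; simp [f]; omega
      | cons d t => have := tsize_bool_le (c && (bif b then d else !d)); simp [f]; omega⟩
  have h2 := PT.and (PT.fst this) (PT.isEmpty (PT.snd this))
  refine h2.of_eq fun p => ?_
  obtain ⟨l, l'⟩ := p
  have key : ∀ (l l' : List Bool) (c : Bool),
      ((l.foldl f (c, l')).1 && (l.foldl f (c, l')).2.isEmpty) = (c && decide (l = l')) := by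
    intro l
    induction l with
    | nil => intro l' c; cases l' <;> simp
    | cons a l ih =>
      intro l' c
      cases l' with
      | nil =>
        have := ih [] false
        simpa [f] using this
      | cons b t =>
        have h := ih t (c && (bif a then b else !b))
        rw [List.foldl_cons]
        refine Eq.trans h ?_
        cases a <;> cases b <;> simp
  simpa using key l l' true

/-- Equality is computable. -/
def DecEq (Γ : Ctx) (β : Type) [TreeEnc β] [DecidableEq β] : Prop :=
  PT Γ fun p : β × β => decide (p.1 = p.2)

variable [DecidableEq β]

theorem erase (hβ : DecEq Γ β) {l : α → List β} {b : α → β} (hl : PT Γ l) (hb : PT Γ b) :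
    PT Γ fun a => (l a).erase (b a) := by
  -- The flag tells whether an occurrence has been removed already; the elements that are kept are
  -- collected in reverse order.
  let f : α → Bool × List β → β → Bool × List β := fun a s c =>
    bif !s.1 && decide (c = b a) then (true, s.2) else (s.1, c :: s.2)
  have hd := PT.comp hβ (f := fun p : α × (Bool × List β) × β => (p.2.2, b p.1)) (by fun_prop)
  have := foldl (f := f) hl (PT.const (false, [])) (by fun_prop)
    ⟨Polynomial.X + 10, fun a s c => by
      obtain ⟨d, t⟩ := s
      have h1 := tsize_bool_le d
      have h2 := tsize_bool_le true
      have h3 := one_le_tsize d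
      simp only [f]
      cases h : (!d && decide (c = b a)) <;> simp <;> omega⟩
  refine (PT.reverse (PT.snd this)).of_eq fun a => ?_
  have k1 : ∀ (l : List β) s, l.foldl (f a) (true, s) = (true, l.reverse ++ s) := by
    intro l
    induction l with
    | nil => simp
    | cons c t ih => intro s; simp [f] at ih ⊢; simp [ih]
  have k2 : ∀ (l : List β) s,
      (l.foldl (f a) (false, s)).2.reverse = s.reverse ++ l.erase (b a) := by
    intro l
    induction l with
    | nil => simp
    | cons c t ih =>
      intro s
      by_cases hc : c = b a
      · have : f a (false, s) c = (true, s) := by simp [f, hc]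
        rw [List.foldl_cons, this, k1]
        simp [hc]
      · have : f a (false, s) c = (false, c :: s) := by simp [f, hc]
        rw [List.foldl_cons, this, ih, List.erase_cons_tail (by simpa using hc)]
        simp
  simpa using k2 (l a) []

theorem diff (hβ : DecEq Γ β) {l l' : α → List β} (hl : PT Γ l) (hl' : PT Γ l') :
    PT Γ fun a => (l a).diff (l' a) := by
  have := foldl (f := fun _ (s : List β) b => s.erase b) hl' hl
    (erase hβ (l := fun p : α × List β × β => p.2.1) (by fun_prop) (by fun_prop))
    ⟨0, fun a s b => by simpa using tsize_le_of_sublist List.erase_sublist⟩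
  refine this.of_eq fun a => ?_
  rw [List.diff_eq_foldl]

end PT

end ResourceGames

namespace ResourceGames

open Ctx TreeEnc

namespace Frag

variable {Γ : Ctx}

/-! ### Input, oracle queries, and calls of machines -/

open Classical in
noncomputable def loadStep (a : Γ.Sym) : Frag Γ Unit :=
  pushAll (Γ.bit true :: (tree (decide (a = Γ.bit true))).ser Γ)

/-- Convert the string on the stack `x` into a tree on the main stack. -/
noncomputable def load : Frag Γ Unit :=
  (pour (.inl .x) (push (.inl .y))).bind fun _ =>
    (push (.inl .m) (Γ.bit false)).bind fun _ => pour (.inl .y) loadStep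

open Classical in
theorem fast_loadStep (b : Bool) (m x y z : List Γ.Sym) (r : Γ.κ → List Γ.Sym) :
    (loadStep (Γ.bit b)).Fast 6 (st m x y z r) ()
      (st (Γ.bit true :: ((tree b).ser Γ ++ m)) x y z r) := by
  have key : ∀ l : List Γ.Sym, (pushAll l).Fast (l.length + 2) (st m x y z r) ()
      (st (l ++ m) x y z r) := by
    intro l
    induction l with
    | nil => exact (fast_done _ _).mono (by simp)
    | cons a l ih =>
      refine (ih.bind (fast_push _ _ _)).congr (by simp) (by simp)
  refine (key _).congr (by simp) ?_
  have := tsize_bool_le b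
  have h : b = decide (Γ.bit b = Γ.bit true) := by simp
  simp only [List.length_cons, BinTree.length_ser, ← h]
  change tsize b + 1 + 2 ≤ 6
  omega

/-- The string lies reversed on `y`, so its last bit comes first and the list can be built by
putting bits in front. -/
theorem fast_load_aux (l l' : List Bool) (m x z : List Γ.Sym) (r : Γ.κ → List Γ.Sym) :
    (pour (.inl .y) loadStep).Fast (9 * l.length + 3)
      (st ((tree l').ser Γ ++ m) x (l.map Γ.bit) z r) ()
      (st ((tree (l.reverse ++ l')).ser Γ ++ m) x [] z r) := by
  induction l generalizing l' with
  | nil => exact (fast_pour_of_nil rfl).mono (by simp)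
  | cons b l ih =>
    have h := ih (b :: l')
    refine (fast_pour_of_cons rfl ?_ h).congr (by simp) (n := 6 + 3 + _) (by simp; omega)
    rw [List.map_cons, update_st_y]
    simpa [tree, treeList, BinTree.ser] using
      fast_loadStep (Γ := Γ) b ((tree l').ser Γ ++ m) x (l.map Γ.bit) z r

theorem fast_load (l : List Bool) (m : List Γ.Sym) :
    load.Fast (13 * l.length + 7) (st m (l.map Γ.bit) [] [] fun _ => []) ()
      (ms ((tree l).ser Γ ++ m)) := by
  have h₁ := fast_move_xy m (l.map Γ.bit) [] [] fun _ => []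
  have h₂ := fast_push (.inl .m) (Γ.bit false) (st m [] (l.reverse.map Γ.bit) [] fun _ => [])
  have h₃ := fast_load_aux l.reverse [] m [] [] fun _ => []
  simp only [List.append_nil, ← List.map_reverse, update_st_m, st_m, List.reverse_reverse] at h₁ h₂ h₃
  exact (h₁.bind (h₂.bind h₃)).mono (by simp; omega)

/-- One round of `unload`. -/
noncomputable def unloadStep : Frag Γ (Option Unit) :=
  split.bind fun b => bif b then
      split.bind fun c => bif c then drop.bind fun _ => drop.bind fun _ =>
          (push (.inl .y) (Γ.bit true)).bind fun _ => done none
        else (push (.inl .y) (Γ.bit false)).bind fun _ => done none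
    else done (some ())

/-- Convert the list of bits on the main stack into a string on the stack `k`. -/
noncomputable def unload (k : Γ.Key) : Frag Γ Unit :=
  (loop unloadStep).bind fun _ => pour (.inl .y) (push k)

theorem fast_split_leaf' (m x y z : List Γ.Sym) (r : Γ.κ → List Γ.Sym) :
    split.Fast 3 (st (BinTree.leaf.ser Γ ++ m) x y z r) false (st m x y z r) := by
  classical
  have h := (fast_pop (.inl .m) (st (BinTree.leaf.ser Γ ++ m) x y z r)).bind
    (G := fun a => done (decide (a = some (Γ.bit true)))) (fast_done _ _)
  simpa [split, BinTree.ser] using h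

theorem fast_split_node' (t u : BinTree) (m x y z : List Γ.Sym) (r : Γ.κ → List Γ.Sym) :
    split.Fast 3 (st ((BinTree.node t u).ser Γ ++ m) x y z r) true
      (st (t.ser Γ ++ (u.ser Γ ++ m)) x y z r) := by
  classical
  have h := (fast_pop (.inl .m) (st ((BinTree.node t u).ser Γ ++ m) x y z r)).bind
    (G := fun a => done (decide (a = some (Γ.bit true)))) (fast_done _ _)
  simpa [split, BinTree.ser] using h

theorem fast_unloadStep (b : Bool) (l : List Bool) (m y : List Γ.Sym) (r : Γ.κ → List Γ.Sym) :
    unloadStep.Fast 50 (st ((tree (b :: l)).ser Γ ++ m) [] y [] r) none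
      (st ((tree l).ser Γ ++ m) [] (Γ.bit b :: y) [] r) := by
  have h₁ := fast_split_node' (Γ := Γ) (tree b) (tree l) m [] y [] r
  cases b with
  | false =>
    have h₂ := fast_split_leaf' (Γ := Γ) ((tree l).ser Γ ++ m) [] y [] r
    have h₃ := fast_push (.inl .y) (Γ.bit false) (st ((tree l).ser Γ ++ m) [] y [] r)
    simp only [update_st_y, st_y] at h₃
    exact (h₁.bind (h₂.bind (h₃.bind (fast_done none _)))).mono (by simp)
  | true =>
    have h₂ := fast_split_node' (Γ := Γ) .leaf .leaf ((tree l).ser Γ ++ m) [] y [] r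
    have h₃ := fast_drop (Γ := Γ) .leaf (BinTree.leaf.ser Γ ++ ((tree l).ser Γ ++ m)) y r
    have h₄ := fast_drop (Γ := Γ) .leaf ((tree l).ser Γ ++ m) y r
    have h₅ := fast_push (.inl .y) (Γ.bit true) (st ((tree l).ser Γ ++ m) [] y [] r)
    simp only [update_st_y, st_y] at h₅
    exact (h₁.bind (h₂.bind (h₃.bind (h₄.bind (h₅.bind (fast_done none _)))))).mono
      (by simp [BinTree.size])

theorem fast_unload_aux (l : List Bool) (m y : List Γ.Sym) (r : Γ.κ → List Γ.Sym) :
    (loop unloadStep).Fast (50 * l.length + 5) (st ((tree l).ser Γ ++ m) [] y [] r) ()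
      (st m [] ((l.map Γ.bit).reverse ++ y) [] r) := by
  induction l generalizing y with
  | nil =>
    have h : unloadStep.Fast 5 (st (BinTree.leaf.ser Γ ++ m) [] y [] r) (some ())
        (st m [] y [] r) := by
      have h₁ := fast_split_leaf' (Γ := Γ) m [] y [] r
      refine Fast.bind (u := 2) h₁ ?_
      exact fast_done (some ()) _
    exact h.loop_some
  | cons b l ih =>
    exact ((fast_unloadStep b l m y r).loop_none (ih _)).congr (by simp) (by simp; omega)

theorem fast_unload (l : List Bool) (m : List Γ.Sym) (k : Γ.Key) (hk : k ≠ .inl .y) :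
    (unload k).Fast (54 * l.length + 8) (ms ((tree l).ser Γ ++ m)) ()
      (Function.update (ms m) k (l.map Γ.bit ++ ms m k)) := by
  refine ((fast_unload_aux l m [] _).bind (fast_move _ k hk.symm _)).congr ?_ ?_
  · rcases k with (_ | _ | _ | _) | k <;> simp at hk ⊢
  · simp; omega

/-- Answer the oracle query on the main stack. -/
noncomputable def ask (h : Γ.timed) : Frag Γ Unit :=
  (unload (.inl .x)).bind fun _ => (query h (.inl .x)).bind fun b =>
    (pour (.inl .x) fun _ => done ()).bind fun _ => pushAll ((tree b).ser Γ)

open Classical in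
theorem fast_ask (h : Γ.timed) (l : List Bool) (m : List Γ.Sym) :
    (ask h).Fast (59 * l.length + 17) (ms ((tree l).ser Γ ++ m)) ()
      (ms ((tree (decide (l ∈ Γ.oracle))).ser Γ ++ m)) := by
  have h₁ := fast_unload (Γ := Γ) l m (.inl .x) (by simp)
  have h₂ := fast_query h (.inl .x) (st m (l.map Γ.bit) [] [] fun _ => [])
  have h₃ := fast_clear (.inl .x) (st m (l.map Γ.bit) [] [] fun _ => [])
  have h₄ := fast_pushAll ((tree (decide (l ∈ Γ.oracle))).ser Γ) m
  have e : (∃ w ∈ Γ.oracle, l.map Γ.bit = w.map Γ.bit) ↔ l ∈ Γ.oracle := by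
    constructor
    · rintro ⟨w, hw, e⟩
      rwa [List.map_injective_iff.2 Γ.bit.injective e]
    · exact fun h => ⟨l, h, rfl⟩
  simp only [update_st_x, st_x, List.append_nil, e] at h₁ h₂ h₃
  have := tsize_bool_le (decide (l ∈ Γ.oracle))
  refine (h₁.bind (h₂.bind (h₃.bind h₄))).mono ?_
  simp only [BinTree.length_ser, List.length_map]
  change _ + (_ + (_ + (tsize (decide (l ∈ Γ.oracle)) + 2))) ≤ _
  omega

end Frag

open Frag

open Classical in
theorem PT.oracle {Γ : Ctx} (h : Γ.timed) : PT Γ fun w : List Bool => decide (w ∈ Γ.oracle) :=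
  Ctx.Comp.of_fast (ask h) (59 * Polynomial.X + 17) fun w rest =>
    (fast_ask h w rest).mono (by
      have : w.length < (tree w).size := length_lt_tsize w
      simp
      omega)

/-! #### Computations of machines -/

namespace Machine

variable {M : Machine} {A : Language Bool} {c d e : M.Cfg} {t : ℕ}

/-- Some computation from `c` accepts. -/
def Accepts (M : Machine) (A : Language Bool) (c : M.Cfg) : Prop :=
  ∃ t d, M.Reaches A t c d ∧ M.prog d.state = .accept

/-- All computations from `c` have at most `n` steps. -/
def Within (M : Machine) (A : Language Bool) (n : ℕ) (c : M.Cfg) : Prop :=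
  ∀ t d, M.Reaches A t c d → t ≤ n

theorem Reaches.head (h : M.Step A c d) (h' : M.Reaches A t d e) : M.Reaches A (t + 1) c e := by
  induction h' with
  | refl => exact (Reaches.refl c).step h
  | step _ hs ih => exact (ih h).step hs

theorem Reaches.cases_head (h : M.Reaches A t c e) :
    (t = 0 ∧ c = e) ∨ ∃ u d, t = u + 1 ∧ M.Step A c d ∧ M.Reaches A u d e := by
  induction h with
  | refl => exact .inl ⟨rfl, rfl⟩
  | @step t c d e _ hs ih =>
    rcases ih with ⟨rfl, rfl⟩ | ⟨u, d', rfl, h₁, h₂⟩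
    · exact .inr ⟨0, e, rfl, hs, .refl _⟩
    · exact .inr ⟨u + 1, d', rfl, h₁, h₂.step hs⟩

theorem not_step_of_halted (h : M.prog c.state = .accept ∨ M.prog c.state = .reject) :
    ¬ M.Step A c d := by
  rintro (h | h | h | h | h | h) <;> simp_all

theorem accepts_iff_of_halted (h : M.prog c.state = .accept ∨ M.prog c.state = .reject) :
    M.Accepts A c ↔ M.prog c.state = .accept := by
  constructor
  · rintro ⟨t, d, hr, hd⟩
    rcases hr.cases_head with ⟨rfl, rfl⟩ | ⟨u, e, rfl, hs, -⟩
    · exact hd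
    · exact absurd hs (not_step_of_halted h)
  · exact fun h => ⟨0, c, .refl _, h⟩

/-- Here `S` describes the successors of `c`. That there is one excludes that `c` accepts at once.
Both deterministic steps and choices are instances. -/
theorem accepts_iff_of_forall {S : M.Cfg → Prop} (hS : ∀ d, M.Step A c d ↔ S d)
    (hne : ∃ d, S d) : M.Accepts A c ↔ ∃ d, S d ∧ M.Accepts A d := by
  constructor
  · rintro ⟨t, d, hr, hd⟩
    rcases hr.cases_head with ⟨rfl, rfl⟩ | ⟨u, e, rfl, hs, h'⟩
    · obtain ⟨e, he⟩ := hne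
      exact absurd ((hS e).2 he) (not_step_of_halted (.inl hd))
    · exact ⟨e, (hS e).1 hs, u, d, h', hd⟩
  · rintro ⟨d, hd, t, e, hr, he⟩
    exact ⟨t + 1, e, hr.head ((hS d).2 hd), he⟩

theorem within_of_forall {n : ℕ} (h : ∀ d, M.Step A c d → M.Within A n d) :
    M.Within A (n + 1) c := by
  intro t e hr
  rcases hr.cases_head with ⟨rfl, rfl⟩ | ⟨u, d, rfl, hs, h'⟩
  · omega
  · have := h d hs u e h'
    omega

theorem Step.unique (hd : ∀ q₁ q₂, M.prog c.state ≠ .choose q₁ q₂) (h : M.Step A c d)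
    (h' : M.Step A c e) : d = e := by
  cases h <;> cases h' <;> grind

theorem accepts_iff_of_step (hd : ∀ q₁ q₂, M.prog c.state ≠ .choose q₁ q₂) (h : M.Step A c d) :
    M.Accepts A c ↔ M.Accepts A d := by
  rw [accepts_iff_of_forall (S := fun e => e = d)
    (fun e => ⟨fun he => Step.unique hd he h, fun he => he ▸ h⟩) ⟨d, rfl⟩]
  simp

theorem accepts_iff_of_reaches (hd : M.Deterministic) (h : M.Reaches A t c d) :
    M.Accepts A c ↔ M.Accepts A d := by
  induction h with
  | refl => rfl
  | step _ hs ih => exact ih.trans (accepts_iff_of_step (hd _) hs)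

end Machine

namespace Frag.Run

variable {Γ : Ctx} {E : Type} {F : Frag Γ E} {ok : Γ.Stk → Prop} {p : F.Pos}
  {m x y z : List Γ.Sym} {r : Γ.κ → List Γ.Sym}

theorem push_inr {k : Γ.κ} {a : Γ.Sym} {c : F.Pos ⊕ E} (hc : F.code p = .push (.inr k) a c)
    (h : ok (st m x y z r)) (h' : ok (st m x y z (Function.update r k (a :: r k)))) :
    F.Run ok 1 (.inl p) (st m x y z r) c (st m x y z (Function.update r k (a :: r k))) := by
  refine .step h ?_
  rw [hc]
  simp only [Op.exec, st_inr, update_st_inr]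
  exact .refl h'

theorem pop_inr {k : Γ.κ} {f : Option Γ.Sym → F.Pos ⊕ E} (hc : F.code p = .pop (.inr k) f)
    (h : ok (st m x y z r)) (h' : ok (st m x y z (Function.update r k (r k).tail))) :
    F.Run ok 1 (.inl p) (st m x y z r) (f (r k).head?)
      (st m x y z (Function.update r k (r k).tail)) := by
  refine .step h ?_
  rw [hc]
  simp only [Op.exec, st_inr, update_st_inr]
  exact .refl h'

theorem pop_z {c : F.Pos ⊕ E} (hc : F.code p = .pop (.inl .z) fun _ => c)
    (h : ok (st m x y [] r)) :
    F.Run ok 1 (.inl p) (st m x y [] r) c (st m x y [] r) := by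
  refine .step h ?_
  rw [hc]
  simp only [Op.exec, st_z, update_st_z, List.tail_nil]
  exact .refl h

end Frag.Run

/-! #### Calls of machines -/

namespace Machine

variable (M : Machine)

/-- The stacks of the machine, besides the work stacks. -/
abbrev ctx : Ctx where
  κ := M.K
  Sym := M.S
  bit := M.bit
  oracle := 0
  timed := False

/-- The machine as a fragment. -/
def frag : Frag M.ctx Bool where
  Pos := M.Q
  entry := M.start
  code q := match M.prog q with
    | .push k a q' => .push (.inr k) a (.inl q')
    | .pop k f => .pop (.inr k) fun a => .inl (f a)
    | .accept => .pop (.inl .z) fun _ => .inr true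
    | _ => .pop (.inl .z) fun _ => .inr false

variable {M}

/-- The stacks of the machine are the extra stacks of its context, so the machine runs beside the
work stacks and leaves the data on the main stack alone. Choices and queries, which `frag` does not
simulate, are excluded by the hypotheses. -/
theorem run_frag (hd : M.Deterministic) (ho : M.OracleFree) {c d : M.Cfg} {t n : ℕ}
    {A : Language Bool} (m : List M.S) (h : M.Reaches A t c d)
    (hn : ∀ t d, M.Reaches A t c d → ∑ k, (d.stack k).length ≤ n) :
    M.frag.Run (fun s => Ctx.size s ≤ n + m.length) t (.inl c.state)
      (st (Γ := M.ctx) m [] [] [] c.stack) (.inl d.state)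
      (st (Γ := M.ctx) m [] [] [] d.stack) := by
  have hs : ∀ t d, M.Reaches A t c d →
      Ctx.size (st (Γ := M.ctx) m [] [] [] d.stack) ≤ n + m.length := by
    intro t d hd
    have := hn t d hd
    rw [size_st]
    change m.length + 0 + 0 + 0 + ∑ k : M.K, (d.stack k).length ≤ _
    omega
  induction h with
  | refl => exact .refl (hs _ _ (.refl _))
  | @step t c d e h h' ih =>
    refine (ih hn hs).trans (u := 1) ?_
    have hc := hs _ _ h
    have he := hs _ _ (h.step h')
    cases h' with
    | @push q s k a q' hq =>
      exact Run.push_inr (Γ := M.ctx) (F := M.frag) (p := q) (by simp only [frag, hq]) hc he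
    | @pop q s k f hq =>
      exact Run.pop_inr (Γ := M.ctx) (F := M.frag) (p := q) (f := fun a => .inl (f a))
        (by simp only [frag, hq]) hc he
    | choose₁ hq => exact absurd hq (hd _ _ _)
    | choose₂ hq => exact absurd hq (hd _ _ _)
    | query_yes hq => exact absurd hq (ho _ _ _ _)
    | query_no hq => exact absurd hq (ho _ _ _ _)

/-- Clear stacks of the machine. -/
def clear (l : List M.K) : Frag M.ctx Unit :=
  l.foldr (fun k F => (pour (.inr k) fun _ => done ()).bind fun _ => F) (done ())

theorem fast_clear (l : List M.K) (m : List M.S) (r : M.K → List M.S) :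
    (clear l).Fast ((5 * (∑ k, (r k).length) + 3) * l.length + 2)
      (st (Γ := M.ctx) m [] [] [] r) ()
      (st (Γ := M.ctx) m [] [] [] fun k => if k ∈ l then [] else r k) := by
  induction l generalizing r with
  | nil => exact (fast_done _ _).congr (by simp) (by simp)
  | cons k l ih =>
    have h₁ := Frag.fast_clear (Γ := M.ctx) (.inr k) (st (Γ := M.ctx) m [] [] [] r)
    have h₂ := ih (Function.update r k [])
    rw [update_st_inr, st_inr] at h₁
    have h₃ : (r k).length ≤ ∑ k, (r k).length :=
      Finset.single_le_sum (f := fun k => (r k).length) (fun _ _ => Nat.zero_le _)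
        (Finset.mem_univ k)
    have h₄ : ∑ j, (Function.update r k [] j).length ≤ ∑ j, (r j).length :=
      Finset.sum_le_sum fun j _ => by
        by_cases h : j = k
        · subst h; simp
        · simp [h]
    refine (h₁.bind h₂).congr ?_ ?_
    · congr 1
      ext j : 1
      by_cases hj : j = k
      · subst hj; simp
      · simp [hj]
    · have h₅ := Nat.mul_le_mul_right l.length (Nat.add_le_add_right (Nat.mul_le_mul_left 5 h₄) 3)
      simp only [List.length_cons, mul_add, mul_one]
      simp only [add_mul] at h₅ ⊢
      omega

open Classical in
/-- Polynomial space is closed under calls of deterministic machines. -/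
theorem pt_language (hd : M.Deterministic) (ho : M.OracleFree) (hs : M.PolySpace 0)
    (hh : M.Halts 0) : PT M.ctx fun w : List Bool => decide (w ∈ M.language 0) := by
  obtain ⟨p, hp⟩ := hs
  let F : Frag M.ctx Unit := (unload (.inr M.input)).bind fun _ => M.frag.bind fun b =>
    (clear Finset.univ.toList).bind fun _ => pushAll ((tree b).ser M.ctx)
  let K : ℕ := (Finset.univ (α := M.K)).toList.length
  let B : Polynomial ℕ := 100 * (1 + Polynomial.X + p + (5 * p + 3) * (K : Polynomial ℕ))
  refine ⟨F, B, fun w m => ?_⟩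
  have hw : w.length < (tree w).size := length_lt_tsize w
  have hpw := polynomial_eval_mono p hw.le
  obtain ⟨t, c, hc, hend⟩ := hh w
  -- A deterministic computation that halts decides: acceptance can be read off at the halting
  -- configuration.
  have hacc : w ∈ M.language 0 ↔ M.prog c.state = .accept :=
    (accepts_iff_of_reaches hd hc).trans (accepts_iff_of_halted hend)
  set b := decide (w ∈ M.language 0) with hb
  set S := B.eval (tree w).size + m.length with hS
  have hB : B.eval (tree w).size = 100 * (1 + (tree w).size + p.eval (tree w).size +
      (5 * p.eval (tree w).size + 3) * K) := by simp [B]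
  have c₁ := (fast_unload (Γ := M.ctx) w m (.inr M.input) (by simp)).cost_ms (m := S) (by
    have := BinTree.length_ser M.ctx (tree w)
    rw [List.length_append]; omega)
  have e₁ : Function.update (ms (Γ := M.ctx) m) (.inr M.input) (w.map M.bit ++
      ms (Γ := M.ctx) m (.inr M.input)) = st (Γ := M.ctx) m [] [] [] (M.init w).stack :=
    (update_st_inr (Γ := M.ctx) m [] [] [] _ (fun _ => []) M.input).trans
      (congrArg (fun l => st (Γ := M.ctx) m [] [] [] (Function.update (fun _ => []) M.input l))
        (List.append_nil _))
  rw [e₁] at c₁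
  have r₂ := run_frag hd ho m hc (hp w)
  have hsz : ∑ k, (c.stack k).length ≤ p.eval w.length := hp w t c hc
  have c₂ : M.frag.Cost S 0 (st (Γ := M.ctx) m [] [] [] (M.init w).stack) b
      (st (Γ := M.ctx) m [] [] [] c.stack) := by
    -- Nothing bounds `t`, and nothing has to, because time does not matter in this context. The
    -- additional step leaves the fragment.
    refine ⟨t + 1, ?_, fun h => h.elim⟩
    refine (r₂.trans (u := 1) ?_).mono fun s hs => hs.trans (by omega)
    have hok := r₂.ok_last
    refine Run.pop_z (Γ := M.ctx) (F := M.frag) (p := c.state) ?_ hok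
    rcases hend with hend | hend
    · have hb1 : b = true := by simp [hb, hacc, hend]
      simp only [frag, hend, hb1]
    · have hb1 : b = false := by simp [hb, hacc, hend]
      simp only [frag, hend, hb1]
  have h₃ := fast_clear (M := M) Finset.univ.toList m c.stack
  have e₃ : (fun k => if k ∈ (Finset.univ (α := M.K)).toList then [] else c.stack k) =
      fun _ => ([] : List M.S) := by
    ext k : 1; simp
  rw [e₃] at h₃
  have hK := Nat.mul_le_mul_right K
    (Nat.add_le_add_right (Nat.mul_le_mul_left 5 (hsz.trans hpw)) 3)
  have c₃ := h₃.cost (m := S) (by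
    have : Ctx.size (st (Γ := M.ctx) m [] [] [] c.stack) =
        m.length + ∑ k, (c.stack k).length := size_st (Γ := M.ctx) m [] [] [] c.stack
    rw [this]
    change _ + ((5 * _ + 3) * K + 2) ≤ _
    omega)
  have hbs : ((tree b).ser M.ctx).length ≤ 3 := by
    rw [BinTree.length_ser]; exact tsize_bool_le b
  have c₄ := (fast_pushAll (Γ := M.ctx) ((tree b).ser M.ctx) m).cost_ms (m := S) (by omega)
  have key : F.Cost S ((54 * w.length + 8) + (0 + (_ + _))) _ () _ :=
    c₁.bind (c₂.bind (c₃.bind c₄))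
  obtain ⟨u, hu, -⟩ := key
  exact ⟨u, hu, fun h => h.elim⟩

end Machine

end ResourceGames

namespace ResourceGames

open Ctx TreeEnc Frag

/-! ### From fragments to machines -/

/-- The instruction as an instruction of a machine. -/
def Op.toInstr {Γ : Ctx} {Q : Type} : Op Γ Q → Instr Q Γ.Key Γ.Sym
  | push k a q => .push k a q
  | pop k f => .pop k f
  | query _ k q₁ q₂ => .query k q₁ q₂

/-- The machine with the given program. -/
abbrev Ctx.machine (Γ : Ctx) (Q : Type) [Fintype Q] (start : Q)
    (prog : Q → Instr Q Γ.Key Γ.Sym) : Machine where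
  Q := Q
  K := Γ.Key
  S := Γ.Sym
  bit := Γ.bit
  start := start
  input := .inl .x
  prog := prog

section machine

variable {Γ : Ctx} {Q : Type}

theorem Op.toInstr_ne_choose (o : Op Γ Q) (q₁ q₂ : Q) : o.toInstr ≠ .choose q₁ q₂ := by
  cases o <;> simp [toInstr]

variable [Fintype Q] {start : Q} {prog : Q → Instr Q Γ.Key Γ.Sym}
  {E : Type} {F : Frag Γ E} {φ : F.Pos ⊕ E → Q}

theorem Op.step {o : Op Γ Q} {q : Q} (h : prog q = o.toInstr) (s : Γ.Stk) :
    (Γ.machine Q start prog).Step Γ.oracle ⟨q, s⟩ ⟨(o.exec s).1, (o.exec s).2⟩ := by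
  cases o with
  | push k a q' => exact .push h
  | pop k f => exact .pop h
  | query hT k q₁ q₂ =>
    simp only [exec]
    split_ifs with hw
    · exact .query_yes h hw
    · exact .query_no h hw

/-- Fragments contain no choices, so acceptance does not change along a run, even when the
surrounding machine is nondeterministic. -/
theorem accepts_iff_of_run (hφ : ∀ p, prog (φ (.inl p)) = ((F.code p).map φ).toInstr)
    {ok : Γ.Stk → Prop} {t : ℕ} {c d : F.Pos ⊕ E} {s s' : Γ.Stk} (h : F.Run ok t c s d s') :
    (Γ.machine Q start prog).Accepts Γ.oracle ⟨φ c, s⟩ ↔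
      (Γ.machine Q start prog).Accepts Γ.oracle ⟨φ d, s'⟩ := by
  induction h with
  | refl => rfl
  | @step t p s d s' _ _ ih =>
    rw [← ih]
    have hs := Op.step (start := start) (hφ p) s
    rw [Op.exec_map] at hs
    exact Machine.accepts_iff_of_step (fun q₁ q₂ h =>
      Op.toInstr_ne_choose _ q₁ q₂ ((hφ p).symm.trans h)) hs

theorem within_of_run (hφ : ∀ p, prog (φ (.inl p)) = ((F.code p).map φ).toInstr)
    {ok : Γ.Stk → Prop} {t : ℕ} {c d : F.Pos ⊕ E} {s s' : Γ.Stk} (h : F.Run ok t c s d s') {n : ℕ}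
    (hn : (Γ.machine Q start prog).Within Γ.oracle n ⟨φ d, s'⟩) :
    (Γ.machine Q start prog).Within Γ.oracle (t + n) ⟨φ c, s⟩ := by
  induction h with
  | refl => simpa using hn
  | @step t p s d s' _ _ ih =>
    have hs := Op.step (start := start) (hφ p) s
    rw [Op.exec_map] at hs
    rw [add_right_comm]
    refine Machine.within_of_forall fun e he => ?_
    have := Machine.Step.unique (fun q₁ q₂ h =>
      Op.toInstr_ne_choose _ q₁ q₂ ((hφ p).symm.trans h)) he hs
    rw [this]
    exact ih hn

/-- By determinism, every reachable configuration lies on the run or comes after its end. -/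
theorem safe_of_run (hφ : ∀ p, prog (φ (.inl p)) = ((F.code p).map φ).toInstr)
    {ok : Γ.Stk → Prop} {t : ℕ} {c d : F.Pos ⊕ E} {s s' : Γ.Stk} (h : F.Run ok t c s d s')
    (hn : ∀ u e, (Γ.machine Q start prog).Reaches Γ.oracle u ⟨φ d, s'⟩ e → ok e.stack) :
    ∀ u e, (Γ.machine Q start prog).Reaches Γ.oracle u ⟨φ c, s⟩ e → ok e.stack := by
  induction h with
  | refl => exact hn
  | @step t p s d s' hok _ ih =>
    have hs := Op.step (start := start) (hφ p) s
    rw [Op.exec_map] at hs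
    intro u e he
    rcases he.cases_head with ⟨rfl, rfl⟩ | ⟨u, d, rfl, h₁, h₂⟩
    · exact hok
    · have := Machine.Step.unique (fun q₁ q₂ h =>
        Op.toInstr_ne_choose _ q₁ q₂ ((hφ p).symm.trans h)) h₁ hs
      rw [this] at h₂
      exact ih hn u e h₂

theorem reaches_of_run (hφ : ∀ p, prog (φ (.inl p)) = ((F.code p).map φ).toInstr)
    {ok : Γ.Stk → Prop} {t : ℕ} {c d : F.Pos ⊕ E} {s s' : Γ.Stk} (h : F.Run ok t c s d s') :
    (Γ.machine Q start prog).Reaches Γ.oracle t ⟨φ c, s⟩ ⟨φ d, s'⟩ := by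
  induction h with
  | refl => exact .refl _
  | @step t p s d s' _ _ ih =>
    have hs := Op.step (start := start) (hφ p) s
    rw [Op.exec_map] at hs
    exact ih.head hs

theorem init_eq (w : List Bool) :
    ((Γ.machine Q start prog).init w).stack = st [] (w.map Γ.bit) [] [] fun _ => [] := by
  change Function.update (fun _ => []) (Sum.inl Reg.x : Γ.Key) (w.map Γ.bit) = _
  ext k : 1
  rcases k with (_ | _ | _ | _) | _ <;> simp

end machine

theorem tsize_bits_le (l : List Bool) : tsize l ≤ 4 * l.length + 1 := by
  induction l with
  | nil => simp
  | cons b l ih => have := tsize_bool_le b; simp; omega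

theorem Frag.Cost.fast {Γ : Ctx} {E : Type} {F : Frag Γ E} {m n : ℕ} {s s' : Γ.Stk} {e : E}
    (h : F.Cost m n s e s') (hT : Γ.timed) : F.Fast n s e s' := by
  obtain ⟨t, h, ht⟩ := h
  exact ⟨t, ht hT, h.mono fun _ _ => trivial⟩

/-- The root of the tree of a Boolean is its value. For `true` two leaves stay behind on the stack,
hence the unspecified `m'`. -/
theorem Frag.fast_split_bool {Γ : Ctx} (b : Bool) (m : List Γ.Sym) :
    ∃ m' : List Γ.Sym, m'.length ≤ m.length + 2 ∧
      split.Fast 3 (ms ((tree b).ser Γ ++ m)) b (ms m') := by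
  cases b with
  | false => exact ⟨m, by simp, fast_split_leaf m⟩
  | true => exact ⟨_, by simp [BinTree.size]; omega, fast_split_node .leaf .leaf m⟩

/-! #### Nondeterministic machines -/

section guess

variable {Γ : Ctx} (F₁ : Frag Γ Unit) (F₂ : Frag Γ Bool)

/-- Control states of a machine that first runs `F₁`, then guesses a string on the stack `x`, as
long as the string on the stack `y`, and finally runs `F₂`. -/
abbrev GuessState : Type := F₁.Pos ⊕ Option (Option Bool) ⊕ F₂.Pos ⊕ Bool

def guessProg : GuessState F₁ F₂ → Instr (GuessState F₁ F₂) Γ.Key Γ.Sym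
  | .inl p => ((F₁.code p).map (Sum.elim .inl fun _ => .inr (.inl none))).toInstr
  | .inr (.inl none) => .pop (.inl .y) fun a =>
      if a.isSome then .inr (.inl (some none)) else .inr (.inr (.inl F₂.entry))
  | .inr (.inl (some none)) =>
      .choose (.inr (.inl (some (some true)))) (.inr (.inl (some (some false))))
  | .inr (.inl (some (some b))) => .push (.inl .x) (Γ.bit b) (.inr (.inl none))
  | .inr (.inr (.inl p)) => ((F₂.code p).map fun c => .inr (.inr c)).toInstr
  | .inr (.inr (.inr b)) => if b then .accept else .reject

abbrev guessMachine : Machine :=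
  Γ.machine (GuessState F₁ F₂) (.inl F₁.entry) (guessProg F₁ F₂)

variable {F₁ F₂} {m x y z : List Γ.Sym} {r : Γ.κ → List Γ.Sym}

theorem guess_step_nil (d : (guessMachine F₁ F₂).Cfg) :
    (guessMachine F₁ F₂).Step Γ.oracle ⟨.inr (.inl none), st m x [] z r⟩ d ↔
      d = ⟨.inr (.inr (.inl F₂.entry)), st m x [] z r⟩ := by
  have h : (guessMachine F₁ F₂).Step Γ.oracle ⟨.inr (.inl none), st m x [] z r⟩
      ⟨.inr (.inr (.inl F₂.entry)), st m x [] z r⟩ := by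
    have := Machine.Step.pop (M := guessMachine F₁ F₂) (A := Γ.oracle)
      (s := st m x [] z r) (q := .inr (.inl none)) rfl
    simpa using this
  exact ⟨fun hd => Machine.Step.unique (by simp [guessProg]) hd h, fun hd => hd ▸ h⟩

theorem guess_step_cons (a : Γ.Sym) (d : (guessMachine F₁ F₂).Cfg) :
    (guessMachine F₁ F₂).Step Γ.oracle ⟨.inr (.inl none), st m x (a :: y) z r⟩ d ↔
      d = ⟨.inr (.inl (some none)), st m x y z r⟩ := by
  have h : (guessMachine F₁ F₂).Step Γ.oracle ⟨.inr (.inl none), st m x (a :: y) z r⟩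
      ⟨.inr (.inl (some none)), st m x y z r⟩ := by
    have := Machine.Step.pop (M := guessMachine F₁ F₂) (A := Γ.oracle)
      (s := st m x (a :: y) z r) (q := .inr (.inl none)) rfl
    simpa using this
  exact ⟨fun hd => Machine.Step.unique (by simp [guessProg]) hd h, fun hd => hd ▸ h⟩

theorem guess_step_choose (s : Γ.Stk) (d : (guessMachine F₁ F₂).Cfg) :
    (guessMachine F₁ F₂).Step Γ.oracle ⟨.inr (.inl (some none)), s⟩ d ↔
      ∃ b, d = ⟨.inr (.inl (some (some b))), s⟩ := by
  constructor
  · intro h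
    rcases d with ⟨q, s'⟩
    cases h <;> simp_all [guessProg]
  · rintro ⟨_ | _, rfl⟩
    · exact .choose₂ rfl
    · exact .choose₁ rfl

theorem guess_step_push (b : Bool) (d : (guessMachine F₁ F₂).Cfg) :
    (guessMachine F₁ F₂).Step Γ.oracle ⟨.inr (.inl (some (some b))), st m x y z r⟩ d ↔
      d = ⟨.inr (.inl none), st m (Γ.bit b :: x) y z r⟩ := by
  have h : (guessMachine F₁ F₂).Step Γ.oracle ⟨.inr (.inl (some (some b))), st m x y z r⟩
      ⟨.inr (.inl none), st m (Γ.bit b :: x) y z r⟩ := by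
    have := Machine.Step.push (M := guessMachine F₁ F₂) (A := Γ.oracle)
      (s := st m x y z r) (q := .inr (.inl (some (some b)))) rfl
    simpa using this
  exact ⟨fun hd => Machine.Step.unique (by simp [guessProg]) hd h, fun hd => hd ▸ h⟩

/-- The symbols on `y` only count the bits to be guessed. The bit guessed first ends up deepest, so
the induction splits off the last letter of `l`. -/
theorem accepts_guess (y : List Γ.Sym) (x : List Γ.Sym) :
    (guessMachine F₁ F₂).Accepts Γ.oracle ⟨.inr (.inl none), st m x y z r⟩ ↔
      ∃ l : List Bool, l.length = y.length ∧ (guessMachine F₁ F₂).Accepts Γ.oracle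
        ⟨.inr (.inr (.inl F₂.entry)), st m (l.map Γ.bit ++ x) [] z r⟩ := by
  induction y generalizing x with
  | nil =>
    rw [Machine.accepts_iff_of_forall guess_step_nil ⟨_, rfl⟩]
    simp
  | cons a y ih =>
    rw [Machine.accepts_iff_of_forall (guess_step_cons a) ⟨_, rfl⟩]
    simp only [exists_eq_left]
    rw [Machine.accepts_iff_of_forall (guess_step_choose _) ⟨_, true, rfl⟩]
    have : ∀ b, (guessMachine F₁ F₂).Accepts Γ.oracle
        ⟨.inr (.inl (some (some b))), st m x y z r⟩ ↔
        ∃ l : List Bool, l.length = y.length ∧ (guessMachine F₁ F₂).Accepts Γ.oracle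
          ⟨.inr (.inr (.inl F₂.entry)), st m (l.map Γ.bit ++ Γ.bit b :: x) [] z r⟩ := fun b => by
      rw [Machine.accepts_iff_of_forall (guess_step_push b) ⟨_, rfl⟩]
      simp only [exists_eq_left]
      exact ih (Γ.bit b :: x)
    constructor
    · rintro ⟨d, ⟨b, rfl⟩, h⟩
      obtain ⟨l, hl, h⟩ := (this b).1 h
      exact ⟨l ++ [b], by simp [hl], by simpa using h⟩
    · rintro ⟨l, hl, h⟩
      obtain ⟨l', b, rfl⟩ : ∃ l' b, l = l' ++ [b] := by
        rcases List.eq_nil_or_concat l with rfl | ⟨l', b, rfl⟩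
        · simp at hl
        · exact ⟨l', b, by simp⟩
      exact ⟨_, ⟨b, rfl⟩, (this b).2 ⟨l', by simpa using hl, by simpa using h⟩⟩

/-- Each guessed bit takes three steps (pop, choice, push), and one more pop finds the counter
empty. -/
theorem within_guess (y : List Γ.Sym) (x : List Γ.Sym) {n : ℕ}
    (h : ∀ l : List Bool, l.length = y.length → (guessMachine F₁ F₂).Within Γ.oracle n
        ⟨.inr (.inr (.inl F₂.entry)), st m (l.map Γ.bit ++ x) [] z r⟩) :
    (guessMachine F₁ F₂).Within Γ.oracle (n + 3 * y.length + 1)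
      ⟨.inr (.inl none), st m x y z r⟩ := by
  induction y generalizing x with
  | nil =>
    refine Machine.within_of_forall fun d hd => ?_
    rw [(guess_step_nil d).1 hd]
    simpa using h [] rfl
  | cons a y ih =>
    refine Machine.within_of_forall fun d hd => ?_
    rw [(guess_step_cons a d).1 hd]
    refine Machine.within_of_forall (n := n + 3 * y.length + 2) fun d hd => ?_
    obtain ⟨b, rfl⟩ := (guess_step_choose _ d).1 hd
    refine Machine.within_of_forall fun d hd => ?_
    rw [(guess_step_push b d).1 hd]
    refine ih _ fun l hl => ?_
    simpa using h (l ++ [b]) (by simpa using hl)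

end guess

/-- The description of relativized NP by witnesses. The length of a witness is that of a computable
string `clock w`, which the machine writes down and uses as a counter while guessing. -/
theorem mem_NPOracle_of_guess {Γ : Ctx} (hT : Γ.timed) {clock : List Bool → List Bool}
    {D : List Bool × List Bool → Bool} (hc : PT Γ clock) (hD : PT Γ D)
    {C : Set (Language Bool)} (hA : Γ.oracle ∈ C) {S : Language Bool}
    (hS : ∀ w, w ∈ S ↔ ∃ y, y.length = (clock w).length ∧ D (w, y) = true) : S ∈ NPOracle C := by
  obtain ⟨q, hq⟩ := hc.size_le
  obtain ⟨G₁, p₁, hG₁⟩ := PT.prodMk (PT.id (Γ := Γ) (α := List Bool)) hc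
  obtain ⟨G₂, p₂, hG₂⟩ := hD
  let F₁ : Frag Γ Unit := load.bind fun _ => G₁.bind fun _ => split.bind fun _ =>
    swap.bind fun _ => (unload (.inl .x)).bind fun _ => pour (.inl .x) (push (.inl .y))
  let F₂ : Frag Γ Bool := load.bind fun _ => swap.bind fun _ =>
    (push (.inl .m) (Γ.bit true)).bind fun _ => G₂.bind fun _ => split
  let s : Polynomial ℕ := 4 * Polynomial.X + 1
  -- `s` bounds the tree of the input and `q.comp s` that of the clock, hence also the length of the
  -- witness; `100 * (s + q.comp s)` bounds the tree of the pair of input and witness.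
  let P₁ : Polynomial ℕ := 100 * (s + p₁.comp s + q.comp s)
  let P₂ : Polynomial ℕ := 100 * (1 + s + q.comp s + p₂.comp (100 * (s + q.comp s)))
  have hs : ∀ w : List Bool, tsize w ≤ s.eval w.length := fun w => by
    simpa [s] using tsize_bits_le w
  have hclock : ∀ w, (clock w).length < q.eval (s.eval w.length) := fun w =>
    (length_lt_tsize _).trans_le ((hq w).trans (polynomial_eval_mono q (hs w)))
  have hclock' : ∀ w, tsize (clock w) ≤ q.eval (s.eval w.length) := fun w =>
    (hq w).trans (polynomial_eval_mono q (hs w))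
  have h₁ : ∀ w : List Bool, F₁.Fast (P₁.eval w.length)
      (st [] (w.map Γ.bit) [] [] fun _ => []) ()
      (st ((tree w).ser Γ) [] ((clock w).map Γ.bit).reverse [] fun _ => []) := by
    intro w
    have e₁ := fast_load (Γ := Γ) w []
    have e₂ := (hG₁ w []).fast hT
    have e₃ := fast_split_node (Γ := Γ) (tree w) (tree (clock w)) []
    have e₄ := fast_swap (Γ := Γ) (tree w) (tree (clock w)) [] fun _ => []
    have e₅ := fast_unload (Γ := Γ) (clock w) ((tree w).ser Γ ++ []) (.inl .x) (by simp)
    have e₆ := fast_move_xy (Γ := Γ) ((tree w).ser Γ) ((clock w).map Γ.bit) [] [] fun _ => []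
    simp only [List.append_nil, update_st_x, st_x] at e₁ e₂ e₃ e₄ e₅ e₆
    refine (e₁.bind (e₂.bind (e₃.bind (e₄.bind (e₅.bind e₆))))).mono ?_
    have h1 := hs w
    have h2 := polynomial_eval_mono p₁ h1
    have h3 := hclock w
    have h4 := hclock' w
    have h5 := length_lt_tsize w
    simp only [tsize] at h1 h2 h4 h5
    simp only [List.length_map, P₁, Polynomial.eval_mul, Polynomial.eval_add, Polynomial.eval_comp,
      Polynomial.eval_ofNat]
    omega
  have h₂ : ∀ w y : List Bool, y.length = (clock w).length → ∃ m', F₂.Fast (P₂.eval w.length)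
      (st ((tree w).ser Γ) (y.map Γ.bit) [] [] fun _ => []) (D (w, y)) (ms m') := by
    intro w y hy
    have e₁ := fast_load (Γ := Γ) y ((tree w).ser Γ)
    have e₂ := fast_swap (Γ := Γ) (tree y) (tree w) [] fun _ => []
    have e₃ := fast_push_ms (Γ := Γ) (Γ.bit true) ((tree w).ser Γ ++ ((tree y).ser Γ ++ []))
    have e₄ := (hG₂ (w, y) []).fast hT
    obtain ⟨m', -, e₅⟩ := fast_split_bool (Γ := Γ) (D (w, y)) []
    refine ⟨m', ?_⟩
    -- Pushing a root onto the codes of `w` and `y` forms the tree of the pair.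
    have e : (tree (w, y)).ser Γ ++ [] =
      Γ.bit true :: ((tree w).ser Γ ++ ((tree y).ser Γ ++ [])) := by
      simp [tree, BinTree.ser]
    rw [e] at e₄
    simp only [List.append_nil] at e₁ e₂ e₃ e₄ e₅
    refine (e₁.bind (e₂.bind (e₃.bind (e₄.bind e₅)))).mono ?_
    have h1 := hs w
    have h3 := hclock w
    have h5 := tsize_bits_le y
    have h6 : tsize (w, y) ≤ 100 * (s.eval w.length + q.eval (s.eval w.length)) := by
      rw [tsize_pair]; omega
    have h7 := polynomial_eval_mono p₂ h6
    simp only [tsize] at h1 h5 h7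
    simp only [P₂, Polynomial.eval_mul, Polynomial.eval_add, Polynomial.eval_comp,
      Polynomial.eval_ofNat, Polynomial.eval_one]
    omega
  refine ⟨Γ.oracle, hA, guessMachine F₁ F₂,
    ⟨P₁ + P₂ + 3 * q.comp s + 1, fun w t c hr => ?_⟩, ?_⟩
  · obtain ⟨t₁, ht₁, r₁⟩ := h₁ w
    have k₂ : ∀ l : List Bool, l.length = (((clock w).map Γ.bit).reverse).length →
        (guessMachine F₁ F₂).Within Γ.oracle (P₂.eval w.length)
        ⟨.inr (.inr (.inl F₂.entry)),
          st ((tree w).ser Γ) (l.map Γ.bit ++ []) [] [] fun _ => []⟩ := by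
      intro l hl
      obtain ⟨m', t₂, ht₂, r₂⟩ := h₂ w l (by simpa using hl)
      have := within_of_run (F := F₂) (start := .inl F₁.entry) (prog := guessProg F₁ F₂)
        (φ := fun c => .inr (.inr c)) (fun _ => rfl) r₂ (n := 0) (by
          intro t d hr
          rcases hr.cases_head with ⟨rfl, rfl⟩ | ⟨u, e, rfl, hs, -⟩
          · exact le_rfl
          · refine absurd hs (Machine.not_step_of_halted ?_)
            cases D (w, l) <;> simp [guessProg])
      intro t d hr
      rw [List.append_nil] at hr
      have := this t d hr
      omega
    have k₁ := within_guess (F₁ := F₁) _ _ k₂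
    have := within_of_run (F := F₁) (start := .inl F₁.entry) (prog := guessProg F₁ F₂)
      (φ := Sum.elim .inl fun _ => .inr (.inl none)) (fun _ => rfl) r₁ k₁
    have hi : (guessMachine F₁ F₂).init w = ⟨.inl F₁.entry, st [] (w.map Γ.bit) [] [] fun _ => []⟩ :=
      congrArg (Machine.Cfg.mk _) (init_eq w)
    rw [hi] at hr
    have h3 := hclock w
    refine (this t c hr).trans ?_
    simp only [List.length_reverse, List.length_map, Polynomial.eval_mul, Polynomial.eval_add,
      Polynomial.eval_comp, Polynomial.eval_ofNat, Polynomial.eval_one]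
    omega
  · ext w
    rw [hS]
    have hi : (guessMachine F₁ F₂).init w = ⟨.inl F₁.entry, st [] (w.map Γ.bit) [] [] fun _ => []⟩ :=
      congrArg (Machine.Cfg.mk _) (init_eq w)
    change (guessMachine F₁ F₂).Accepts Γ.oracle ((guessMachine F₁ F₂).init w) ↔ _
    obtain ⟨t₁, ht₁, r₁⟩ := h₁ w
    rw [hi]
    refine (accepts_iff_of_run (F := F₁) (start := .inl F₁.entry) (prog := guessProg F₁ F₂)
      (φ := Sum.elim .inl fun _ => .inr (.inl none)) (fun _ => rfl) r₁).trans ?_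
    refine (accepts_guess _ _).trans (exists_congr fun l => ?_)
    simp only [List.length_reverse, List.length_map, List.append_nil]
    refine and_congr_right fun hl => ?_
    obtain ⟨m', t₂, ht₂, r₂⟩ := h₂ w l hl
    refine (accepts_iff_of_run (F := F₂) (start := .inl F₁.entry) (prog := guessProg F₁ F₂)
        (φ := fun c => .inr (.inr c)) (fun _ => rfl) r₂).trans ?_
    rw [Machine.accepts_iff_of_halted (by cases D (w, l) <;> simp [guessProg])]
    cases D (w, l) <;> simp [guessProg]

/-! #### Deterministic machines -/

section decide

variable {Γ : Ctx} (F : Frag Γ Bool)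

def deciderProg : F.Pos ⊕ Bool → Instr (F.Pos ⊕ Bool) Γ.Key Γ.Sym
  | .inl p => (F.code p).toInstr
  | .inr b => if b then .accept else .reject

abbrev decider : Machine := Γ.machine (F.Pos ⊕ Bool) (.inl F.entry) (deciderProg F)

end decide

/-- An untimed fragment cannot query, since a query requires a proof of `timed`. The machine is thus
deterministic and oracle-free, and its single run provides both halting and the space bound. -/
theorem mem_PSPACE_of_pt {Γ : Ctx} (hT : ¬ Γ.timed) (hA : Γ.oracle = 0) {D : List Bool → Bool}
    (hD : PT Γ D) {S : Language Bool} (hS : ∀ w, w ∈ S ↔ D w = true) : S ∈ PSPACE := by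
  obtain ⟨G, p, hG⟩ := hD
  let F : Frag Γ Bool := load.bind fun _ => G.bind fun _ => split
  let s : Polynomial ℕ := 4 * Polynomial.X + 1
  let P : Polynomial ℕ := 100 * (s + p.comp s)
  have hφ : ∀ q, deciderProg F (id (.inl q)) = ((F.code q).map id).toInstr := fun q => by
    cases h : F.code q <;> simp only [deciderProg, id, h] <;> rfl
  have key : ∀ w : List Bool, ∃ t m', F.Exec (fun s => Ctx.size s ≤ P.eval w.length) t
      (st [] (w.map Γ.bit) [] [] fun _ => []) (D w) (ms m') := by
    intro w
    have h1 : tsize w ≤ s.eval w.length := by simpa [s] using tsize_bits_le w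
    have h2 := polynomial_eval_mono p h1
    have h3 := length_lt_tsize w
    have h4 := tsize_bool_le (D w)
    have h5 := one_le_tsize (D w)
    have hP : P.eval w.length = 100 * (s.eval w.length + p.eval (s.eval w.length)) := by simp [P]
    obtain ⟨m', -, e₃⟩ := fast_split_bool (Γ := Γ) (D w) []
    simp only [tsize] at h1 h2 h3 h4 h5
    have c₁ := (fast_load (Γ := Γ) w []).cost (m := P.eval w.length) (by simp; omega)
    have c₂ := (hG w []).mono (m' := P.eval w.length) (by simp; omega) le_rfl
    have c₃ := e₃.cost_ms (m := P.eval w.length) (by simp; omega)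
    have c : F.Cost (P.eval w.length) (_ + (_ + _)) _ (D w) (ms m') := c₁.bind (c₂.bind c₃)
    obtain ⟨t, h, -⟩ := c
    exact ⟨t, m', h⟩
  have hi : ∀ w, (decider F).init w = ⟨.inl F.entry, st [] (w.map Γ.bit) [] [] fun _ => []⟩ :=
    fun w => congrArg (Machine.Cfg.mk _) (init_eq w)
  have hhalt : ∀ b, (decider F).prog (.inr b) = .accept ∨ (decider F).prog (.inr b) = .reject :=
    fun b => by cases b <;> simp [deciderProg]
  refine ⟨decider F, ?_, ?_, ⟨P, fun w t c hr => ?_⟩, fun w => ?_, ?_⟩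
  · rintro (q | b) q₁ q₂
    · exact Op.toInstr_ne_choose _ _ _
    · cases b <;> simp [deciderProg]
  · rintro (q | b) k q₁ q₂
    · change (F.code q).toInstr ≠ _
      cases F.code q with
      | query h => exact absurd h hT
      | _ => simp [Op.toInstr]
    · cases b <;> simp [deciderProg]
  · obtain ⟨t', m', h⟩ := key w
    rw [hi, ← hA] at hr
    exact safe_of_run (F := F) (start := .inl F.entry) (prog := deciderProg F) (φ := id) hφ h
      (fun u e he => by
        rcases he.cases_head with ⟨rfl, rfl⟩ | ⟨v, d, rfl, hs, -⟩
        · exact Run.ok_last h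
        · exact absurd hs (Machine.not_step_of_halted (hhalt _))) t c hr
  · obtain ⟨t', m', h⟩ := key w
    rw [hi, ← hA]
    exact ⟨t', _, reaches_of_run (F := F) (start := .inl F.entry) (prog := deciderProg F)
      (φ := id) hφ h, hhalt _⟩
  · ext w
    rw [hS]
    obtain ⟨t', m', h⟩ := key w
    change (decider F).Accepts 0 ((decider F).init w) ↔ _
    rw [hi, ← hA]
    refine (accepts_iff_of_run (F := F) (start := .inl F.entry) (prog := deciderProg F)
        (φ := id) hφ h).trans ?_
    rw [Machine.accepts_iff_of_halted (hhalt _)]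
    cases D w <;> simp [deciderProg]

/-! #### The classes -/

theorem zero_mem_P : (0 : Language Bool) ∈ P := by
  let M : Machine :=
    { Q := Unit, K := Unit, S := Bool, bit := .refl _, start := (), input := (),
      prog := fun _ => .reject }
  have h : ∀ {t : ℕ} {c d : M.Cfg}, M.Reaches 0 t c d → t = 0 := by
    intro t c d hr
    rcases hr.cases_head with ⟨rfl, rfl⟩ | ⟨v, d, rfl, hs, -⟩
    · rfl
    · exact absurd hs (Machine.not_step_of_halted (.inr rfl))
  refine ⟨M, fun _ _ _ => by simp [M], fun _ _ _ _ => by simp [M],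
    ⟨0, fun x t c hr => by simp [h hr]⟩, ?_⟩
  ext x
  constructor
  · rintro ⟨t, c, -, hc⟩
    simp [M] at hc
  · exact fun h => h.elim

theorem mem_sigmaP_one {S : Language Bool} (h : S ∈ NP) : S ∈ SigmaP 1 := by
  obtain ⟨M, -, h₁, h₂⟩ := h
  exact ⟨0, zero_mem_P, M, h₁, h₂⟩

/-! #### Exhaustive search -/

/-- Addition of a carry to a binary number, least significant bit first. -/
def addCarry : Bool → List Bool → List Bool
  | _, [] => []
  | c, b :: l => xor c b :: addCarry (c && b) l

theorem addCarry_false (l : List Bool) : addCarry false l = l := by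
  induction l with
  | nil => rfl
  | cons b l ih => simp [addCarry, ih]

/-- The last `n` binary digits of a number. -/
def bitsOf : ℕ → ℕ → List Bool
  | 0, _ => []
  | n + 1, k => decide (k % 2 = 1) :: bitsOf n (k / 2)

@[simp] theorem length_bitsOf (n k : ℕ) : (bitsOf n k).length = n := by
  induction n generalizing k with
  | zero => rfl
  | succ n ih => simp [bitsOf, ih]

theorem addCarry_bitsOf (n k : ℕ) : addCarry true (bitsOf n k) = bitsOf n (k + 1) := by
  induction n generalizing k with
  | zero => rfl
  | succ n ih =>
    rcases Nat.mod_two_eq_zero_or_one k with h | h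
    · have h1 : (k + 1) % 2 = 1 := by omega
      have h2 : (k + 1) / 2 = k / 2 := by omega
      simp [bitsOf, addCarry, h, h1, h2, addCarry_false]
    · have h1 : (k + 1) % 2 = 0 := by omega
      have h2 : (k + 1) / 2 = k / 2 + 1 := by omega
      simp [bitsOf, addCarry, h, h1, h2, ih]

theorem bitsOf_zero (n : ℕ) : bitsOf n 0 = List.replicate n false := by
  induction n with
  | zero => rfl
  | succ n ih => simp [bitsOf, ih, List.replicate_succ]

/-- The counter has reached its last value exactly when all its bits are `true`; this is how the
search knows when to stop. -/
theorem all_bitsOf {n k : ℕ} (hk : k < 2 ^ n) :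
    (bitsOf n k).all (fun b => b) = decide (k + 1 = 2 ^ n) := by
  induction n generalizing k with
  | zero => simp_all [bitsOf]
  | succ n ih =>
    rw [pow_succ] at hk
    rw [bitsOf, List.all_cons, ih (by omega), pow_succ, ← Bool.decide_and, decide_eq_decide]
    omega

theorem exists_bitsOf (l : List Bool) : ∃ k < 2 ^ l.length, bitsOf l.length k = l := by
  induction l with
  | nil => exact ⟨0, by simp, rfl⟩
  | cons b l ih =>
    obtain ⟨k, hk, h⟩ := ih
    refine ⟨2 * k + b.toNat, ?_, ?_⟩
    · rw [List.length_cons, pow_succ]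
      have := Bool.toNat_le b
      omega
    · have h1 : (2 * k + b.toNat) / 2 = k := by
        have := Bool.toNat_le b
        omega
      have h2 : decide ((2 * k + b.toNat) % 2 = 1) = b := by cases b <;> simp
      rw [List.length_cons, bitsOf, h1, h2, h]

theorem PT.addCarry {Γ : Ctx} : PT Γ fun l : List Bool => addCarry true l := by
  let f : Bool × List Bool → Bool → Bool × List Bool := fun s b =>
    (s.1 && b, (bif s.1 then !b else b) :: s.2)
  have := PT.foldl (Γ := Γ) (l := fun l : List Bool => l) (i := fun _ => (true, []))
    (f := fun _ => f) PT.id (PT.const _) (by fun_prop) ⟨20, fun _ s b => by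
      obtain ⟨c, l⟩ := s
      have h1 := tsize_bool_le (c && b)
      have h2 := tsize_bool_le (bif c then !b else b)
      simp [f]; omega⟩
  refine (PT.reverse (PT.snd this)).of_eq fun l => ?_
  have key : ∀ (l : List Bool) c s, (l.foldl f (c, s)).2.reverse =
      s.reverse ++ ResourceGames.addCarry c l := by
    intro l
    induction l with
    | nil => simp [ResourceGames.addCarry]
    | cons b l ih =>
      intro c s
      rw [List.foldl_cons]
      refine (ih (c && b) _).trans ?_
      cases c <;> simp [ResourceGames.addCarry]
  simpa using key l true []

open Classical in
/-- Without a bound for the time, all strings of a given length can be tried. -/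
theorem PT.search {Γ : Ctx} (hT : ¬ Γ.timed) {α : Type} [TreeEnc α] {clock : α → List Bool}
    {D : α → List Bool → Bool} (hc : PT Γ clock) (hD : PT Γ fun p : α × List Bool => D p.1 p.2) :
    PT Γ fun a => decide (∃ y, y.length = (clock a).length ∧ D a y = true) := by
  -- The state consists of the parameter, the current string, whether a solution has been found, and
  -- whether to go on. The last flag is computed from the string before it is incremented, so the
  -- string of all ones is still tested.
  let step : α × List Bool × Bool × Bool → α × List Bool × Bool × Bool := fun p =>
    (p.1, ResourceGames.addCarry true p.2.1, p.2.2.1 || D p.1 p.2.1, !p.2.1.all fun b => b)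
  have hstep : PT Γ step := by
    have h1 := PT.addCarry (Γ := Γ)
    have h2 := hD.comp (f := fun p : α × List Bool × Bool × Bool => (p.1, p.2.1)) (by fun_prop)
    have h3 := PT.all (Γ := Γ) (l := fun p : α × List Bool × Bool × Bool => p.2.1)
      (g := fun _ b => b) (by fun_prop) (by fun_prop)
    fun_prop
  let start : α → α × List Bool × Bool × Bool := fun a =>
    (a, (clock a).map fun _ => false, false, true)
  have hstart : PT Γ start := by
    have := PT.map (g := fun _ _ => false) hc (PT.const false)
    fun_prop
  -- For `k = 2 ^ n` the counter has wrapped around to zeros; this does no harm, as the last flag is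
  -- then `false`.
  have hit : ∀ a k, k ≤ 2 ^ (clock a).length → step^[k] (start a) =
      (a, bitsOf (clock a).length k,
        decide (∃ j < k, D a (bitsOf (clock a).length j) = true),
        decide (k < 2 ^ (clock a).length)) := by
    intro a k
    induction k with
    | zero => intro _; simp [start, bitsOf_zero]
    | succ k ih =>
      intro hk
      rw [Function.iterate_succ_apply', ih (by omega)]
      simp only [step, addCarry_bitsOf, all_bitsOf (show k < 2 ^ (clock a).length by omega)]
      have e1 : (!decide (k + 1 = 2 ^ (clock a).length)) = decide (k + 1 < 2 ^ (clock a).length) := by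
        rw [← decide_not, decide_eq_decide]; omega
      have e2 : (decide (∃ j < k, D a (bitsOf (clock a).length j) = true) ||
          D a (bitsOf (clock a).length k)) =
          decide (∃ j < k + 1, D a (bitsOf (clock a).length j) = true) := by
        rw [Bool.eq_iff_iff]
        simp only [Bool.or_eq_true, decide_eq_true_eq]
        constructor
        · rintro (⟨j, hj, h⟩ | h)
          · exact ⟨j, by omega, h⟩
          · exact ⟨k, by omega, h⟩
        · rintro ⟨j, hj, h⟩
          rcases Nat.lt_succ_iff_lt_or_eq.1 hj with hj | rfl
          · exact .inl ⟨j, hj, h⟩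
          · exact .inr h
      rw [e1, e2]
  have hloop := Ctx.Comp.whileLoop (Γ := Γ) (s := fun p : α × List Bool × Bool × Bool => tree p)
    (c := fun p => tree p.2.2.2) (f := step) (PT.snd (PT.snd (PT.snd PT.id))) hstep start
    (fun a => 2 ^ (clock a).length) (10 * Polynomial.X + 10)
    (fun a k hk => by
      rw [hit a k hk.le, decide_eq_true hk]
      intro h; cases h)
    (fun a => by
      rw [hit a _ le_rfl, decide_eq_false (lt_irrefl _)]
      rfl)
    (fun a k hk => by
      rw [hit a k hk]
      change tsize _ ≤ Polynomial.eval (tsize (start a)) _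
      have h1 := tsize_bits_le (bitsOf (clock a).length k)
      have h2 := length_lt_tsize ((clock a).map fun _ => false)
      have h3 := tsize_bool_le (decide (∃ j < k, D a (bitsOf (clock a).length j) = true))
      have h4 := tsize_bool_le (decide (k < 2 ^ (clock a).length))
      rw [length_bitsOf] at h1
      rw [List.length_map] at h2
      simp only [start, tsize_pair, Polynomial.eval_add, Polynomial.eval_mul, Polynomial.eval_X,
        Polynomial.eval_ofNat]
      omega)
    -- The number of rounds is exponential, which is allowed only because time does not matter.
    (fun h => absurd h hT)
  refine Ctx.Comp.trans hstart (Ctx.Comp.trans hloop ?_)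
  have hproj := Ctx.Comp.restrict
    (PT.fst (PT.snd (PT.snd (PT.id (Γ := Γ) (α := α × List Bool × Bool × Bool)))))
    fun a => step^[2 ^ (clock a).length] (start a)
  refine hproj.congr fun a => ?_
  simp only [Function.comp_apply, hit a _ le_rfl]
  congr 1
  rw [decide_eq_decide]
  constructor
  · rintro ⟨j, -, h⟩
    exact ⟨_, length_bitsOf _ _, h⟩
  · rintro ⟨y, hy, h⟩
    obtain ⟨k, hk, hky⟩ := exists_bitsOf y
    rw [hy] at hk hky
    exact ⟨k, hk, hky ▸ h⟩

end ResourceGames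

namespace ResourceGames

open Ctx TreeEnc

/-! ### Formulas, games and their codes as data -/

variable {L : Logic} {Γ : Ctx}

noncomputable instance : DecidableEq L.Fml := Classical.decEq _

/-- The code of a formula. -/
def Logic.Fml.code (A : L.Fml) : List Bool := A.val.encode

theorem Logic.Fml.code_injective : Function.Injective (code (L := L)) := fun _ _ h =>
  Subtype.ext (Formula.prefixFree_encode.injective h)

/-- A formula is represented by its code. -/
instance : TreeEnc L.Fml := ⟨fun A => tree A.code⟩

theorem tsize_code (A : L.Fml) : tsize A.code = tsize A := rfl

theorem PT.code_id : PT Γ (Logic.Fml.code (L := L)) := Ctx.Comp.refl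

@[fun_prop] theorem PT.code {α : Type} [TreeEnc α] {f : α → L.Fml} (hf : PT Γ f) :
    PT Γ fun a => (f a).code := PT.code_id.comp hf

/-- A formula and its code have the same tree, so computing a formula means computing its code. -/
theorem PT.of_code {α : Type} [TreeEnc α] {f : α → L.Fml} {g : α → List Bool} (hg : PT Γ g)
    (h : ∀ a, g a = (f a).code) : PT Γ f :=
  Ctx.Comp.congr hg fun a => congrArg tree (h a)

theorem decEq_fml : PT.DecEq Γ L.Fml := by
  have := PT.decide_eq_bits.comp (Γ := Γ)
    (f := fun p : L.Fml × L.Fml => (p.1.code, p.2.code)) (by fun_prop)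
  refine this.of_eq fun p => ?_
  rw [decide_eq_decide, Logic.Fml.code_injective.eq_iff]

theorem encodeList_eq_flatMap {α : Type} (e : α → List Bool) (l : List α) :
    encodeList e l = l.flatMap (fun a => true :: e a) ++ [false] := by
  induction l with
  | nil => rfl
  | cons a l ih => simp [encodeList, ih]

theorem PT.encodeList {α : Type} [TreeEnc α] {e : α → List Bool} (he : PT Γ e) :
    PT Γ fun l => encodeList e l :=
  (PT.append (PT.flatMap (l := fun l : List α => l) (g := fun _ a => true :: e a) PT.id
    (by fun_prop)) (PT.const [false])).of_eq fun l => (encodeList_eq_flatMap e l).symm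

theorem PT.encodeFmls : PT Γ fun l : List L.Fml => encodeFmls l := PT.encodeList PT.code_id

theorem PT.encodePlayer : PT Γ fun x : L.Fml × List L.Fml × List L.Fml => encodePlayer x := by
  have h2 := PT.encodeFmls (Γ := Γ) (L := L)
  have h3 := h2.comp (f := fun x : L.Fml × List L.Fml × List L.Fml => x.2.1) (by fun_prop)
  have h4 := h2.comp (f := fun x : L.Fml × List L.Fml × List L.Fml => x.2.2) (by fun_prop)
  have h5 : PT Γ fun x : L.Fml × List L.Fml × List L.Fml => x.1.code := by fun_prop
  exact PT.append h5 (PT.append h3 h4)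

/-- Inclusion of the multisets given by two lists. -/
noncomputable def subBag (l l' : List L.Fml) : Bool := (l.diff l').isEmpty

theorem subBag_iff (l l' : List L.Fml) :
    subBag l l' = true ↔ (l : Multiset L.Fml) ≤ (l' : Multiset L.Fml) := by
  rw [subBag, List.isEmpty_iff, ← Multiset.coe_eq_zero, ← Multiset.coe_sub, tsub_eq_zero_iff_le]

@[fun_prop] theorem PT.subBag {α : Type} [TreeEnc α] {f g : α → List L.Fml} (hf : PT Γ f)
    (hg : PT Γ g) : PT Γ fun a => subBag (f a) (g a) :=
  PT.isEmpty (PT.diff decEq_fml hf hg)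

open Classical in
/-- `X ⊢ γ` in the logic. -/
noncomputable def proves (X : List L.Fml) (γ : L.Fml) : Bool := decide (L.Proves X γ)

theorem proves_iff (X : List L.Fml) (γ : L.Fml) : proves X γ = true ↔ L.Proves X γ := by
  simp [proves]

theorem encodeFmls_eq (l : List L.Fml) :
    encodeFmls l = encodeList Formula.encode (l.map Subtype.val) := by
  induction l with
  | nil => rfl
  | cons A l ih => exact congrArg (fun t => true :: (A.val.encode ++ t)) ih

/-- The codes of the two sides are merely concatenated; since the code of lists is prefix-free, the
sequent is determined by the string. -/
theorem encodeFmls_mem_iff (X : List L.Fml) (γ : L.Fml) :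
    encodeFmls X ++ encodeFmls [γ] ∈ SequentValidity L ↔ L.Proves X γ := by
  rw [encodeFmls_eq, encodeFmls_eq]
  have hp := Formula.prefixFree_encode.encodeList
  constructor
  · rintro ⟨Δ, Δ', e, hΔ⟩
    obtain ⟨h1, h2⟩ := hp _ _ _ _ e
    have h3 := hp.injective h2
    rw [← h1, ← h3] at hΔ
    exact hΔ
  · intro hX
    exact ⟨_, _, rfl, hX⟩

open Classical in
/-- Proofs can be found if sequent validity is available. -/
theorem PT.proves (h : PT Γ fun w : List Bool => decide (w ∈ SequentValidity L)) :
    PT Γ fun p : List L.Fml × L.Fml => proves p.1 p.2 := by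
  have h0 := PT.encodeFmls (Γ := Γ) (L := L)
  have h1 := h0.comp (f := fun p : List L.Fml × L.Fml => p.1) (by fun_prop)
  have h2 := h0.comp (f := fun p : List L.Fml × L.Fml => [p.2]) (by fun_prop)
  refine (h.comp (PT.append h1 h2)).of_eq fun p => ?_
  rw [ResourceGames.proves, decide_eq_decide]
  exact encodeFmls_mem_iff p.1 p.2

/-! #### A decoder -/

/-- Names of atoms. -/
structure AtomName : Type where
  name : List Bool

namespace AtomName

/-- The code of the name. -/
def code (p : AtomName) : List Bool := encodeList (fun b => [b]) p.name

/-- A name is represented by its code. -/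
instance : TreeEnc AtomName := ⟨fun p => tree p.code⟩

/-- The name with another letter in front. -/
def cons (b : Bool) (p : AtomName) : AtomName := ⟨b :: p.name⟩

theorem tsize_code (p : AtomName) : tsize p.code = tsize p := rfl

theorem pt_code : PT Γ code := Ctx.Comp.refl

theorem pt_cons (b : Bool) : PT Γ (cons b) := by
  have h := pt_code (Γ := Γ)
  have h2 : PT Γ fun p : AtomName => true :: b :: p.code := by fun_prop
  exact h2

theorem tsize_cons_le (b : Bool) (p : AtomName) : tsize (cons b p) ≤ tsize p + 10 := by
  have h : tsize (cons b p) = tsize (true :: b :: p.code) := rfl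
  have h1 := tsize_bool_le b
  have h2 := tsize_bool_le true
  have h3 := tsize_code p
  simp only [tsize_cons] at h
  omega

/-- The atom with the given name. -/
def toFml (p : AtomName) : L.Fml := ⟨.atom p.name, trivial⟩

theorem pt_toFml : PT Γ (toFml (L := L)) := by
  have h := pt_code (Γ := Γ)
  have h2 : PT Γ fun p : AtomName => [false, false, false, false] ++ p.code := by fun_prop
  exact h2

theorem tsize_toFml_le (p : AtomName) : tsize (p.toFml : L.Fml) ≤ tsize p + 20 := by
  have h1 : tsize (p.toFml : L.Fml) = tsize ([false, false, false, false] ++ p.code) := rfl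
  have h2 := tsize_append [false, false, false, false] p.code
  have h3 := tsize_bits_le [false, false, false, false]
  have h4 := tsize_code p
  simp only [List.length_cons, List.length_nil] at h3
  omega

end AtomName

/-- A player: goal, endowment, contribution, and alternatives to the two. -/
abbrev Player (L : Logic) : Type :=
  L.Fml × List L.Fml × List L.Fml × List L.Fml × List L.Fml

/-- The memory of the decoder: the name of an atom, formulas, lists of formulas, players. -/
abbrev Store (L : Logic) : Type :=
  AtomName × List L.Fml × List (List L.Fml) × List (Player L)

namespace Store

open Classical in
/-- Do something if a connective belongs to the logic. -/
noncomputable def allow (c : Connective) (f : c ∈ L.connectives → Store L → Store L) :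
    Store L → Store L :=
  if h : c ∈ L.connectives then f h else id

/-- Append a formula. -/
def constant (A : L.Fml) (s : Store L) : Store L := (s.1, A :: s.2.1, s.2.2)

/-- Apply a unary function to the first formula. -/
def unary (f : L.Fml → L.Fml) (s : Store L) : Store L :=
  match s.2.1 with
  | [] => s
  | A :: l => (s.1, f A :: l, s.2.2)

/-- Apply a binary function to two formulas. -/
def binaryStep (f : L.Fml × L.Fml → L.Fml) (p : Store L × L.Fml × List L.Fml) : Store L :=
  match p.2.2 with
  | [] => p.1
  | B :: l => (p.1.1, f (p.2.1, B) :: l, p.1.2.2)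

/-- Apply a binary function to the first two formulas. -/
def binary (f : L.Fml × L.Fml → L.Fml) (s : Store L) : Store L :=
  match s.2.1 with
  | [] => s
  | A :: l => binaryStep f (s, A, l)

/-- The name becomes an atom. -/
def atom (s : Store L) : Store L := (⟨[]⟩, s.1.toFml :: s.2.1, s.2.2)

/-- Another letter of the name. -/
def letter (b : Bool) (s : Store L) : Store L := (s.1.cons b, s.2)

/-- The formulas become a list of formulas. -/
def endList (s : Store L) : Store L := (s.1, [], s.2.1 :: s.2.2.1, s.2.2.2)

/-- A formula and the last four lists of formulas become a player. -/
def endPlayer (s : Store L) : Store L :=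
  match s.2.1 with
  | [] => s
  | A :: _ => (s.1, [], [], (A, s.2.2.1.tail.tail.tail.headD [], s.2.2.1.tail.tail.headD [],
      s.2.2.1.tail.headD [], s.2.2.1.headD []) :: s.2.2.2)

/-- Execute an instruction. -/
noncomputable def exec : Bool → Bool → Bool → Bool → Store L → Store L
  | false, false, false, false => atom
  | false, false, false, true => allow .top fun h => constant ⟨.top, h⟩
  | false, false, true, false => allow .zero fun h => constant ⟨.zero, h⟩
  | false, false, true, true => allow .one fun h => constant ⟨.one, h⟩
  | false, true, false, false => allow .bot fun h => constant ⟨.bot, h⟩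
  | false, true, false, true => allow .neg fun h => unary fun A => ⟨.neg A.1, h, A.2⟩
  | false, true, true, false =>
      allow .par fun h => binary fun A => ⟨.par A.1.1 A.2.1, h, A.1.2, A.2.2⟩
  | false, true, true, true =>
      allow .tensor fun h => binary fun A => ⟨.tensor A.1.1 A.2.1, h, A.1.2, A.2.2⟩
  | true, false, false, false =>
      allow .lolli fun h => binary fun A => ⟨.lolli A.1.1 A.2.1, h, A.1.2, A.2.2⟩
  | true, false, false, true =>
      allow .amp fun h => binary fun A => ⟨.amp A.1.1 A.2.1, h, A.1.2, A.2.2⟩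
  | true, false, true, false =>
      allow .plus fun h => binary fun A => ⟨.plus A.1.1 A.2.1, h, A.1.2, A.2.2⟩
  | true, false, true, true => letter true
  | true, true, false, false => letter false
  | true, true, false, true => endList
  | true, true, true, false => endPlayer
  | true, true, true, true => id

/-! ### Computability of the decoder -/

theorem pt_headD {α β : Type} [TreeEnc α] [TreeEnc β] {l : α → List β} (hl : PT Γ l)
    (b : β) : PT Γ fun a => (l a).headD b :=
  (PT.list_cases hl (PT.const b) (g := fun _ c _ => c) (by fun_prop)).of_eq fun a => by
    cases l a <;> rfl

/-- The function is computable and adds at most 100 to the size. -/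
def Good (Γ : Ctx) (f : Store L → Store L) : Prop :=
  PT Γ f ∧ ∀ s, tsize (f s) ≤ tsize s + 100

theorem Good.id : Good Γ (id : Store L → Store L) := ⟨PT.id, fun _ => Nat.le_add_right _ _⟩

theorem good_allow {c : Connective} {f : c ∈ L.connectives → Store L → Store L}
    (hf : ∀ h, Good Γ (f h)) : Good Γ (allow c f) := by
  unfold allow
  -- The connectives are fixed with the logic, so this test is made when the fragment is constructed
  -- and not when it runs.
  split_ifs with h
  exacts [hf h, Good.id]

theorem good_constant (A : L.Fml) (hA : A.code.length = 4) : Good Γ (constant A) := by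
  refine ⟨by unfold constant; fun_prop, fun s => ?_⟩
  have h1 := tsize_bits_le A.code
  rw [tsize_code, hA] at h1
  obtain ⟨a, b, c, d⟩ := s
  simp only [constant, tsize_pair, tsize_cons]
  omega

theorem good_unary {f : L.Fml → L.Fml} (t : List Bool) (ht : t.length = 4)
    (hf : ∀ A, (f A).code = t ++ A.code) : Good Γ (unary f) := by
  have hF : PT Γ f := PT.of_code (g := fun A => t ++ A.code) (by fun_prop) fun A => (hf A).symm
  refine ⟨(PT.list_cases (Γ := Γ) (l := fun s : Store L => s.2.1) (f := fun s => s)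
    (g := fun s A l => (s.1, f A :: l, s.2.2)) (by fun_prop) PT.id (by fun_prop)).of_eq
    (by rintro ⟨a, _ | ⟨A, b⟩, c⟩ <;> rfl), fun s => ?_⟩
  obtain ⟨a, b, c, d⟩ := s
  cases b with
  | nil => exact Nat.le_add_right _ _
  | cons A l =>
    have h1 := tsize_append t A.code
    have h2 := tsize_bits_le t
    rw [← hf, tsize_code, tsize_code] at h1
    simp only [unary, tsize_pair, tsize_cons]
    omega

theorem good_binary {f : L.Fml × L.Fml → L.Fml} (t : List Bool) (ht : t.length = 4)
    (hf : ∀ A, (f A).code = t ++ (A.1.code ++ A.2.code)) : Good Γ (binary f) := by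
  have hF : PT Γ f := PT.of_code (g := fun A => t ++ (A.1.code ++ A.2.code)) (by fun_prop)
    fun A => (hf A).symm
  have h1 : PT Γ (binaryStep f) :=
    (PT.list_cases (Γ := Γ) (l := fun p : Store L × L.Fml × List L.Fml => p.2.2)
    (f := fun p => p.1) (g := fun p B l => (p.1.1, f (p.2.1, B) :: l, p.1.2.2))
    (by fun_prop) (by fun_prop) (by fun_prop)).of_eq
    (by rintro ⟨s, A, _ | ⟨B, b⟩⟩ <;> rfl)
  refine ⟨(PT.list_cases (Γ := Γ) (l := fun s : Store L => s.2.1) (f := fun s => s)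
    (g := fun s A l => binaryStep f (s, A, l)) (by fun_prop) PT.id h1).of_eq
    (by rintro ⟨a, _ | ⟨A, b⟩, c⟩ <;> rfl), fun s => ?_⟩
  obtain ⟨a, b, c, d⟩ := s
  rcases b with _ | ⟨A, _ | ⟨B, l⟩⟩
  · exact Nat.le_add_right _ _
  · exact Nat.le_add_right _ _
  · have h1 := tsize_append t (A.code ++ B.code)
    have h2 := tsize_bits_le t
    have h3 := tsize_append A.code B.code
    have h4 := tsize_code (f (A, B))
    rw [hf] at h4
    rw [tsize_code, tsize_code] at h3
    dsimp only at h4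
    simp only [binary, binaryStep, tsize_pair, tsize_cons]
    omega

theorem good_atom : Good Γ (atom (L := L)) := by
  have h := AtomName.pt_toFml (Γ := Γ) (L := L)
  refine ⟨by unfold atom; fun_prop, fun s => ?_⟩
  obtain ⟨a, b, c⟩ := s
  have h1 := AtomName.tsize_toFml_le (L := L) a
  have h4 : tsize (⟨[]⟩ : AtomName) ≤ 5 := tsize_bits_le [false]
  simp only [atom, tsize_pair, tsize_cons]
  omega

theorem good_letter (b : Bool) : Good Γ (letter (L := L) b) := by
  have h := AtomName.pt_cons (Γ := Γ) b
  refine ⟨by unfold letter; fun_prop, fun s => ?_⟩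
  obtain ⟨a, c⟩ := s
  have h1 := AtomName.tsize_cons_le b a
  simp only [letter, tsize_pair]
  omega

theorem good_endList : Good Γ (endList (L := L)) := by
  refine ⟨by unfold endList; fun_prop, fun s => ?_⟩
  simp only [endList, tsize_pair, tsize_cons, tsize_nil]
  have := one_le_tsize s.2.1
  obtain ⟨a, b, c, d⟩ := s
  simp only [tsize_pair] at this ⊢
  omega

theorem good_endPlayer : Good Γ (endPlayer (L := L)) := by
  have hh := fun (l : Store L × L.Fml × List L.Fml → List (List L.Fml)) (hl : PT Γ l) =>
    pt_headD hl []
  have h0 := hh (fun p => p.1.2.2.1) (by fun_prop)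
  have h1 := hh (fun p => p.1.2.2.1.tail) (by fun_prop)
  have h2 := hh (fun p => p.1.2.2.1.tail.tail) (by fun_prop)
  have h3 := hh (fun p => p.1.2.2.1.tail.tail.tail) (by fun_prop)
  refine ⟨(PT.list_cases (Γ := Γ) (l := fun s : Store L => s.2.1) (f := fun s => s)
      (g := fun s A _ => (s.1, [], [], (A, s.2.2.1.tail.tail.tail.headD [],
        s.2.2.1.tail.tail.headD [], s.2.2.1.tail.headD [], s.2.2.1.headD []) :: s.2.2.2))
      (by fun_prop) PT.id (by fun_prop)).of_eq
      (by rintro ⟨a, _ | ⟨A, b⟩, c⟩ <;> rfl), fun s => ?_⟩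
  have key : ∀ l : List (List L.Fml), tsize (l.headD []) + tsize l.tail ≤ tsize l + 1 := by
    intro l
    cases l <;> simp; omega
  obtain ⟨a, b, l, d⟩ := s
  cases b with
  | nil => simp [endPlayer]
  | cons A b =>
    have k0 := key l
    have k1 := key l.tail
    have k2 := key l.tail.tail
    have k3 := key l.tail.tail.tail
    simp only [endPlayer, tsize_pair, tsize_cons, tsize_nil]
    omega

theorem good_exec : ∀ b₁ b₂ b₃ b₄ : Bool, Good Γ (exec (L := L) b₁ b₂ b₃ b₄)
  | false, false, false, false => good_atom
  | false, false, false, true => good_allow fun _ => good_constant _ rfl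
  | false, false, true, false => good_allow fun _ => good_constant _ rfl
  | false, false, true, true => good_allow fun _ => good_constant _ rfl
  | false, true, false, false => good_allow fun _ => good_constant _ rfl
  | false, true, false, true =>
      good_allow fun _ => good_unary [false, true, false, true] rfl fun _ => rfl
  | false, true, true, false =>
      good_allow fun _ => good_binary [false, true, true, false] rfl fun _ => rfl
  | false, true, true, true =>
      good_allow fun _ => good_binary [false, true, true, true] rfl fun _ => rfl
  | true, false, false, false =>
      good_allow fun _ => good_binary [true, false, false, false] rfl fun _ => rfl
  | true, false, false, true =>
      good_allow fun _ => good_binary [true, false, false, true] rfl fun _ => rfl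
  | true, false, true, false =>
      good_allow fun _ => good_binary [true, false, true, false] rfl fun _ => rfl
  | true, false, true, true => good_letter true
  | true, true, false, false => good_letter false
  | true, true, false, true => good_endList
  | true, true, true, false => good_endPlayer
  | true, true, true, true => Good.id

/-- Read one bit of a program, whose instructions consist of four bits. -/
noncomputable def step (s : List Bool × Store L) (b : Bool) : List Bool × Store L :=
  bif s.1.tail.tail.isEmpty then (b :: s.1, s.2)
  else ([], exec (s.1.tail.tail.headD false) (s.1.tail.headD false) (s.1.headD false) b s.2)

/-- The empty memory. -/
def empty : Store L := (⟨[]⟩, [], [], [])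

/-- Execute a program. -/
noncomputable def decode (y : List Bool) : Store L := (y.foldl step ([], empty)).2

/-- Each instruction adds a bounded amount to the store, so executing a program is a fold of the
admissible kind. -/
theorem pt_decode : PT Γ (decode (L := L)) := by
  have h1 : PT Γ fun p : Bool × Bool × Bool × Bool × Store L =>
      exec p.1 p.2.1 p.2.2.1 p.2.2.2.1 p.2.2.2.2 :=
    PT.bool_family (f := fun b₁ (p : Bool × Bool × Bool × Store L) =>
      exec b₁ p.1 p.2.1 p.2.2.1 p.2.2.2) fun b₁ =>
    PT.bool_family (f := fun b₂ (p : Bool × Bool × Store L) =>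
      exec b₁ b₂ p.1 p.2.1 p.2.2) fun b₂ =>
    PT.bool_family (f := fun b₃ (p : Bool × Store L) => exec b₁ b₂ b₃ p.1 p.2) fun b₃ =>
    PT.bool_family (f := fun b₄ (p : Store L) => exec b₁ b₂ b₃ b₄ p) fun b₄ =>
      (good_exec b₁ b₂ b₃ b₄).1
  have hh := fun (l : List Bool × (List Bool × Store L) × Bool → List Bool) (hl : PT Γ l) =>
    pt_headD hl false
  have h2 := hh (fun p => p.2.1.1) (by fun_prop)
  have h3 := hh (fun p => p.2.1.1.tail) (by fun_prop)
  have h4 := hh (fun p => p.2.1.1.tail.tail) (by fun_prop)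
  -- The pending bits are stored latest first, so the first bit of an instruction is the third
  -- entry. The default `false` is never used when an instruction is executed after exactly three
  -- pending bits.
  have h5 := h1.comp (f := fun p : List Bool × (List Bool × Store L) × Bool =>
    (p.2.1.1.tail.tail.headD false, p.2.1.1.tail.headD false, p.2.1.1.headD false, p.2.2,
      p.2.1.2)) (by fun_prop)
  have := PT.foldl (Γ := Γ) (l := fun y : List Bool => y) (i := fun _ => ([], empty (L := L)))
    (f := fun _ => step) PT.id (PT.const _) (by unfold step; fun_prop) ⟨200, fun _ s b => by
      unfold step
      have h6 := (good_exec (Γ := Γ) (L := L) (s.1.tail.tail.headD false) (s.1.tail.headD false)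
        (s.1.headD false) b).2 s.2
      have h7 := tsize_bool_le b
      have h8 := one_le_tsize s.1
      obtain ⟨c, d⟩ := s
      cases c.tail.tail.isEmpty <;>
        simp only [cond_false, cond_true, tsize_pair, tsize_cons, tsize_nil,
          Polynomial.eval_ofNat] at * <;> omega⟩
  exact PT.snd this

/-! #### Every store is the result of a short program -/

/-- A program with `n` instructions leads from `s` to `s'`. -/
def Builds (n : ℕ) (s s' : Store L) : Prop :=
  ∃ y : List Bool, y.length = 4 * n ∧
    ∀ t, (y ++ t).foldl step ([], s) = t.foldl step ([], s')

variable {n m : ℕ} {s s' s'' : Store L}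

theorem Builds.refl : Builds 0 s s := ⟨[], rfl, fun _ => rfl⟩

theorem Builds.exec (b₁ b₂ b₃ b₄ : Bool) : Builds 1 s (exec b₁ b₂ b₃ b₄ s) :=
  ⟨[b₁, b₂, b₃, b₄], rfl, fun _ => rfl⟩

theorem Builds.trans (h : Builds n s s') (h' : Builds m s' s'') : Builds (n + m) s s'' := by
  obtain ⟨y, hy, h⟩ := h
  obtain ⟨y', hy', h'⟩ := h'
  exact ⟨y ++ y', by simp; omega, fun t => by rw [List.append_assoc, h, h']⟩

/-- The instruction of four ones does nothing and serves as padding. Padding is needed because a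
guessed string has exactly the length of its clock. -/
theorem Builds.mono (h : Builds n s s') (hm : n ≤ m) : Builds m s s' := by
  have : ∀ k, Builds k s s := by
    intro k
    induction k with
    | zero => exact .refl
    | succ k ih => exact ih.trans (.exec true true true true)
  have := (this (m - n)).trans h
  rwa [Nat.sub_add_cancel hm] at this

theorem Builds.exists_decode (h : Builds n empty s) : ∃ y, y.length = 4 * n ∧ decode y = s := by
  obtain ⟨y, hy, h⟩ := h
  refine ⟨y, hy, ?_⟩
  have := h []
  rw [List.append_nil] at this
  rw [decode, this]
  rfl

theorem Builds.allow (h : Builds n s s') {c : Connective}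
    {f : c ∈ L.connectives → Store L → Store L} (b₁ b₂ b₃ b₄ : Bool)
    (e : Store.exec b₁ b₂ b₃ b₄ = Store.allow c f) (hc : c ∈ L.connectives)
    (hm : n + 1 ≤ m) : Builds m s (f hc s') := by
  have h1 := Builds.exec (s := s') b₁ b₂ b₃ b₄
  rw [e, Store.allow, dif_pos hc] at h1
  exact (h.trans h1).mono hm

theorem builds_name (p : List Bool) (r : List L.Fml × List (List L.Fml) × List (Player L)) :
    Builds (encodeList (fun b => [b]) p).length (⟨[]⟩, r) (⟨p⟩, r) := by
  induction p with
  | nil => exact Builds.refl.mono (Nat.zero_le _)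
  | cons b p ih =>
    refine (ih.trans (m := 1) ?_).mono (by simp [encodeList])
    cases b with
    | true => exact .exec true false true true
    | false => exact .exec true true false false

/-- The program is the formula in postfix order. The right operand is built first, so that the left
one lies on top when `binary` takes them. Each connective needs one instruction and has four bits in
the code, so the length of the code is a generous bound. -/
theorem builds_formula (A : Formula) (hA : A.UsesOnly L.connectives) (l : List L.Fml)
    (r : List (List L.Fml) × List (Player L)) :
    Builds (A.encode.length) (⟨[]⟩, l, r) (⟨[]⟩, (⟨A, hA⟩ : L.Fml) :: l, r) := by
  induction A generalizing l with
  | atom p =>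
    exact ((builds_name p (l, r)).trans (.exec false false false false)).mono
      (by simp [Formula.encode])
  | top => exact Builds.refl.allow false false false true rfl hA (by simp [Formula.encode])
  | zero => exact Builds.refl.allow false false true false rfl hA (by simp [Formula.encode])
  | one => exact Builds.refl.allow false false true true rfl hA (by simp [Formula.encode])
  | bot => exact Builds.refl.allow false true false false rfl hA (by simp [Formula.encode])
  | neg A ih =>
    exact (ih hA.2 l).allow false true false true rfl hA.1 (by simp [Formula.encode])
  | par A B ih₁ ih₂ =>
    exact ((ih₂ hA.2.2 l).trans (ih₁ hA.2.1 _)).allow false true true false rfl hA.1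
      (by simp [Formula.encode]; omega)
  | tensor A B ih₁ ih₂ =>
    exact ((ih₂ hA.2.2 l).trans (ih₁ hA.2.1 _)).allow false true true true rfl hA.1
      (by simp [Formula.encode]; omega)
  | lolli A B ih₁ ih₂ =>
    exact ((ih₂ hA.2.2 l).trans (ih₁ hA.2.1 _)).allow true false false false rfl hA.1
      (by simp [Formula.encode]; omega)
  | amp A B ih₁ ih₂ =>
    exact ((ih₂ hA.2.2 l).trans (ih₁ hA.2.1 _)).allow true false false true rfl hA.1
      (by simp [Formula.encode]; omega)
  | plus A B ih₁ ih₂ =>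
    exact ((ih₂ hA.2.2 l).trans (ih₁ hA.2.1 _)).allow true false true false rfl hA.1
      (by simp [Formula.encode]; omega)

theorem builds_fml (A : L.Fml) (l : List L.Fml) (r : List (List L.Fml) × List (Player L)) :
    Builds A.code.length (⟨[]⟩, l, r) (⟨[]⟩, A :: l, r) := builds_formula A.1 A.2 l r

/-- The length of the code of a multiset, apart from the end mark. -/
def weight (l : List L.Fml) : ℕ := (l.map fun A => A.code.length + 1).sum

theorem length_encodeFmls (l : List L.Fml) : (encodeFmls l).length = weight l + 1 := by
  induction l with
  | nil => rfl
  | cons A l ih =>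
    have e : encodeFmls (A :: l) = true :: (A.code ++ encodeFmls l) := rfl
    rw [e, List.length_cons, List.length_append, ih]
    simp only [weight, List.map_cons, List.sum_cons]
    omega

theorem builds_list (l l' : List L.Fml) (r : List (List L.Fml) × List (Player L)) :
    Builds (weight l) (⟨[]⟩, l', r) (⟨[]⟩, l ++ l', r) := by
  induction l with
  | nil => exact .refl
  | cons A l ih =>
    refine (ih.trans (builds_fml A _ _)).mono ?_
    simp only [weight, List.map_cons, List.sum_cons]
    omega

/-- The number of instructions for a player. -/
def playerWeight (p : Player L) : ℕ :=
  weight p.2.1 + weight p.2.2.1 + weight p.2.2.2.1 + weight p.2.2.2.2 + p.1.code.length + 5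

theorem builds_player (p : Player L) (ps : List (Player L)) :
    Builds (playerWeight p) (⟨[]⟩, [], [], ps) (⟨[]⟩, [], [], p :: ps) := by
  obtain ⟨g, l₁, l₂, l₃, l₄⟩ := p
  have key : ∀ (l : List L.Fml) (r : List (List L.Fml)), Builds (weight l + 1)
      (⟨[]⟩, [], r, ps) (⟨[]⟩, [], l :: r, ps) := by
    intro l r
    have h := (builds_list l [] (r, ps)).trans (.exec true true false true)
    rwa [List.append_nil] at h
  -- Later lists lie on top, so `endPlayer` finds `l₁` in the fourth place. The four ends of lists
  -- and the end of the player account for the 5 in `playerWeight`.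
  refine (((((key l₁ []).trans (key l₂ _)).trans (key l₃ _)).trans (key l₄ _)).trans
    ((builds_fml g [] _).trans (.exec true true true false))).mono ?_
  simp only [playerWeight]
  omega

theorem builds_players (ps : List (Player L)) :
    Builds (ps.map playerWeight).sum empty (⟨[]⟩, [], [], ps) := by
  induction ps with
  | nil => exact .refl
  | cons p ps ih => exact (ih.trans (builds_player p ps)).mono (by simp; omega)

theorem weight_append (l l' : List L.Fml) : weight (l ++ l') = weight l + weight l' := by
  simp [weight]

theorem weight_le_of_le {l l' : List L.Fml} (h : (l : Multiset L.Fml) ≤ l') :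
    weight l ≤ weight l' := by
  have e : ∀ l : List L.Fml, weight l =
      ((l : Multiset L.Fml).map fun A : L.Fml => A.code.length + 1).sum := by
    intro l; simp [weight]
  rw [e, e, ← add_tsub_cancel_of_le h, Multiset.map_add, Multiset.sum_add]
  omega

end Store

end ResourceGames

namespace ResourceGames

open Ctx TreeEnc Store

/-! ### Rational construction in terms of lists of players -/

variable {L : Logic} {Γ : Ctx} {n : ℕ}

/-- The outcome of the alternative contributions. -/
def outcome (D : List (Player L)) : List L.Fml := D.flatMap fun p => p.2.2.2.2

/-- Strict inclusion of the multisets given by two lists. -/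
noncomputable def strictSubBag (l l' : List L.Fml) : Bool := subBag l l' && !subBag l' l

theorem strictSubBag_iff (l l' : List L.Fml) :
    strictSubBag l l' = true ↔ (l : Multiset L.Fml) < (l' : Multiset L.Fml) := by
  rw [lt_iff_le_not_ge, ← subBag_iff, ← subBag_iff, strictSubBag]
  simp

/-- The preference for a new contribution over the old one, in terms of whether the goal is
realized now and then and whether the new contribution is strictly smaller. -/
def prefers : Preference → Bool → Bool → Bool → Bool
  | .dichotomous, new, old, _ => new && !old
  | .parsimonious, new, old, less =>
      (!new && (!old && less)) || ((new && !old) || (new && (old && less)))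

/-- The player can deviate to a preferred contribution. -/
noncomputable def deviates (π : Preference) (X : List L.Fml) (p : Player L) (C : List L.Fml) :
    Bool :=
  subBag C p.2.2.2.1 &&
    prefers π (proves (X.diff p.2.2.2.2 ++ C) p.1) (proves X p.1) (strictSubBag C p.2.2.2.2)

/-- Some player can deviate to a preferred contribution. -/
noncomputable def unstable (π : Preference) (D : List (Player L)) (C : List L.Fml) : Bool :=
  D.any fun p => deviates π (outcome D) p C

/-- The players code the input, and the alternatives are a redistribution and a profile with
the same outcome. -/
noncomputable def valid (w : List Bool) (D : List (Player L)) : Bool :=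
  decide (encodeList encodePlayer (D.map fun p => (p.1, p.2.1, p.2.2.1)) = w) &&
  (D.all (fun p => subBag p.2.2.1 p.2.1 && subBag p.2.2.2.2 p.2.2.2.1) &&
  (subBag (D.flatMap fun p => p.2.1) (D.flatMap fun p => p.2.2.2.1) &&
  (subBag (D.flatMap fun p => p.2.2.2.1) (D.flatMap fun p => p.2.1) &&
  (subBag (D.flatMap fun p => p.2.2.1) (outcome D) &&
  subBag (outcome D) (D.flatMap fun p => p.2.2.1)))))

/-- The game of the players with their alternative endowments. -/
def alternativeGame (d : Fin n → Player L) : Game L :=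
  ⟨n, fun i => (d i).1, fun i => ((d i).2.2.2.1 : Multiset L.Fml)⟩

theorem coe_flatMap_ofFn (d : Fin n → Player L) (f : Player L → List L.Fml) :
    (((List.ofFn d).flatMap f : List L.Fml) : Multiset L.Fml) =
      ∑ i, (f (d i) : Multiset L.Fml) := by
  have h : ∀ D : List (Player L), ((D.flatMap f : List L.Fml) : Multiset L.Fml) =
      (D.map fun p => (f p : Multiset L.Fml)).sum := by
    intro D
    induction D with
    | nil => rfl
    | cons p D ih => rw [List.flatMap_cons, ← Multiset.coe_add, ih, List.map_cons, List.sum_cons]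
  rw [h, List.map_ofFn, List.sum_ofFn]
  rfl

theorem prefers_iff (π : Preference) (d : Fin n → Player L) (i : Fin n) (C : List L.Fml) :
    prefers π (proves ((outcome (List.ofFn d)).diff (d i).2.2.2.2 ++ C) (d i).1)
      (proves (outcome (List.ofFn d)) (d i).1) (strictSubBag C (d i).2.2.2.2) = true ↔
    (alternativeGame d).StronglyPrefers π i
      (Function.update (fun i => ((d i).2.2.2.2 : Multiset L.Fml)) i C)
      (fun i => ((d i).2.2.2.2 : Multiset L.Fml)) := by
  have h1 : proves (outcome (List.ofFn d)) (d i).1 = true ↔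
      (alternativeGame d).Sat i (fun i => ((d i).2.2.2.2 : Multiset L.Fml)) := by
    rw [proves_iff, outcome, coe_flatMap_ofFn]
    rfl
  have h2 : proves ((outcome (List.ofFn d)).diff (d i).2.2.2.2 ++ C) (d i).1 = true ↔
      (alternativeGame d).Sat i
        (Function.update (fun i => ((d i).2.2.2.2 : Multiset L.Fml)) i C) := by
    -- The old contribution is a summand of the outcome, so the truncated difference is the sum over
    -- the other players.
    have e : (((outcome (List.ofFn d)).diff (d i).2.2.2.2 ++ C : List L.Fml) : Multiset L.Fml) =
        ∑ j, (Function.update (fun i => ((d i).2.2.2.2 : Multiset L.Fml)) i C) j := by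
      rw [← Multiset.coe_add, ← Multiset.coe_sub, outcome, coe_flatMap_ofFn,
        Finset.sum_update_of_mem (Finset.mem_univ i),
        Finset.sdiff_singleton_eq_erase,
        ← Finset.add_sum_erase Finset.univ (fun i => ((d i).2.2.2.2 : Multiset L.Fml))
          (Finset.mem_univ i), add_tsub_cancel_left, add_comm]
    rw [proves_iff, e]
    rfl
  have h3 : strictSubBag C (d i).2.2.2.2 = true ↔
      (Function.update (fun i => ((d i).2.2.2.2 : Multiset L.Fml)) i C) i <
        ((d i).2.2.2.2 : Multiset L.Fml) := by
    rw [Function.update_self, strictSubBag_iff]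
  cases π with
  | dichotomous =>
    refine Iff.trans ?_ (and_congr h2 (not_congr h1))
    simp [prefers]
  | parsimonious =>
    refine Iff.trans ?_ (or_congr (and_congr (not_congr h2) (and_congr (not_congr h1) h3))
      (or_congr (and_congr h2 (not_congr h1)) (and_congr h2 (and_congr h1 h3))))
    simp [prefers]

/-- The search for the deviating player is part of `unstable`, so that only the contribution `C`
remains to be quantified. Every multiset `C` is represented by a list. -/
theorem isEquilibrium_iff (π : Preference) (d : Fin n → Player L) :
    (∀ C, unstable π (List.ofFn d) C = false) ↔
    ∀ i, ∀ C ≤ ((d i).2.2.2.1 : Multiset L.Fml), ¬ (alternativeGame d).StronglyPrefers π i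
      (Function.update (fun i => ((d i).2.2.2.2 : Multiset L.Fml)) i C)
      (fun i => ((d i).2.2.2.2 : Multiset L.Fml)) := by
  have h : ∀ C, unstable π (List.ofFn d) C = true ↔
      ∃ i, (C : Multiset L.Fml) ≤ ((d i).2.2.2.1 : Multiset L.Fml) ∧
      (alternativeGame d).StronglyPrefers π i
        (Function.update (fun i => ((d i).2.2.2.2 : Multiset L.Fml)) i C)
        (fun i => ((d i).2.2.2.2 : Multiset L.Fml)) := by
    intro C
    simp only [unstable, List.any_eq_true, List.mem_ofFn, exists_exists_eq_and, deviates,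
      Bool.and_eq_true, subBag_iff, prefers_iff]
  simp only [← Bool.not_eq_true, h]
  constructor
  · intro h i C hC hp
    induction C using Quotient.inductionOn with
    | h C => exact h C ⟨i, hC, hp⟩
  · rintro h C ⟨i, hC, hp⟩
    exact h i C hC hp

theorem valid_iff (w : List Bool) (d : Fin n → Player L) : valid w (List.ofFn d) = true ↔
    encodeList encodePlayer (List.ofFn fun i => ((d i).1, (d i).2.1, (d i).2.2.1)) = w ∧
    (∀ i, ((d i).2.2.1 : Multiset L.Fml) ≤ ((d i).2.1 : Multiset L.Fml)) ∧
    (∀ i, ((d i).2.2.2.2 : Multiset L.Fml) ≤ ((d i).2.2.2.1 : Multiset L.Fml)) ∧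
    (∑ i, ((d i).2.1 : Multiset L.Fml) = ∑ i, ((d i).2.2.2.1 : Multiset L.Fml)) ∧
    (∑ i, ((d i).2.2.1 : Multiset L.Fml) = ∑ i, ((d i).2.2.2.2 : Multiset L.Fml)) := by
  have h : ∀ X Y : Multiset L.Fml, X = Y ↔ X ≤ Y ∧ Y ≤ X := fun _ _ => le_antisymm_iff
  simp only [valid, outcome, Bool.and_eq_true, decide_eq_true_iff, List.all_eq_true,
    List.forall_mem_ofFn_iff, subBag_iff, coe_flatMap_ofFn, forall_and, h,
    List.map_ofFn, and_assoc]
  rfl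

/-- One list of players carries the game and profile coded by `w` together with the redistribution
and the new profile; that it matches `w` is checked by encoding, so no decoding of `w` is involved.
-/
theorem mem_rationalConstruction_iff (π : Preference) (w : List Bool) :
    w ∈ RationalConstruction L π ↔
      ∃ D : List (Player L), valid w D = true ∧ ∀ C, unstable π D C = false := by
  constructor
  · rintro ⟨G, P, hP, ⟨ε, C, hε, hC, rfl⟩, ε', hε', P', hP', hout, -, hNE⟩
    obtain ⟨E', rfl⟩ : ∃ E' : Fin G.n → List L.Fml, ε' = fun i => (E' i : Multiset L.Fml) :=
      ⟨fun i => (ε' i).toList, by simp⟩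
    obtain ⟨C', rfl⟩ : ∃ C' : Fin G.n → List L.Fml, P' = fun i => (C' i : Multiset L.Fml) :=
      ⟨fun i => Multiset.toList (P' i), funext fun i => (Multiset.coe_toList _).symm⟩
    refine ⟨List.ofFn fun i => (G.goal i, ε i, C i, E' i, C' i),
      (valid_iff _ _).2 ⟨rfl, fun i => hC i ▸ hε i ▸ hP i, hP', ?_, ?_⟩,
      (isEquilibrium_iff π _).2 hNE⟩
    · have h : ∑ i, G.endow i = ∑ i, (E' i : Multiset L.Fml) := hε'
      simp only [hε] at h
      exact h
    · have h : ∑ i, (C' i : Multiset L.Fml) = ∑ i, P i := hout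
      simp only [hC] at h
      exact h.symm
  · rintro ⟨D, hD, hC⟩
    obtain ⟨n, d, rfl⟩ : ∃ n, ∃ d : Fin n → Player L, D = List.ofFn d :=
      ⟨_, D.get, (List.ofFn_get D).symm⟩
    obtain ⟨h1, h2, h3, h4, h5⟩ := (valid_iff w d).1 hD
    refine ⟨⟨n, fun i => (d i).1, fun i => ((d i).2.1 : Multiset L.Fml)⟩,
      fun i => ((d i).2.2.1 : Multiset L.Fml), h2,
      ⟨fun i => (d i).2.1, fun i => (d i).2.2.1, fun _ => rfl, fun _ => rfl, h1.symm⟩,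
      fun i => ((d i).2.2.2.1 : Multiset L.Fml), h4, fun i => ((d i).2.2.2.2 : Multiset L.Fml),
      h3, h5.symm, h3, (isEquilibrium_iff π d).1 hC⟩

/-! #### Affine logics -/

/-- Repeated left weakening by the formulas of `Y - X`. The right side does not change, so the
intuitionistic restriction stays satisfied. -/
theorem Logic.Proves.mono (hL : L.Affine) {X Y : Multiset L.Fml} {γ : L.Fml}
    (h : L.Proves X γ) (hX : X ≤ Y) : L.Proves Y γ := by
  rw [← add_tsub_cancel_of_le hX, add_comm]
  induction Y - X using Multiset.induction with
  | empty => rwa [zero_add]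
  | cons A Z ih =>
    -- The last rule of a proof certifies that its conclusion is a sequent of the logic.
    have hs : L.IsSequent ⟨(Z + X).map Subtype.val, {γ.val}⟩ := by
      cases ih with | rule _ _ hs _ => exact hs
    have h1 : L.Provable ⟨A.val ::ₘ (Z + X).map Subtype.val, {γ.val}⟩ :=
      .rule hL (.weakL _ _ A.val) ⟨Multiset.forall_mem_cons.2 ⟨A.2, hs.1⟩, hs.2⟩
        (List.forall_mem_singleton.2 ih)
    have e : Multiset.map Subtype.val (A ::ₘ Z + X) =
        A.val ::ₘ (Z + X).map Subtype.val := by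
      rw [Multiset.cons_add]
      exact Multiset.map_cons _ _ _
    exact (congrArg (fun M => L.Provable ⟨M, {γ.val}⟩) e).mpr h1

/-- The contributions to which a player has to be able to deviate in an affine logic. -/
noncomputable def candidates (p : Player L) : List (List L.Fml) :=
  p.2.2.2.1 :: [] :: p.2.2.2.2.map fun A => p.2.2.2.2.erase A

/-- By monotonicity each kind of profitable deviation can be replaced by an extreme one: the largest
contribution if the goal is gained, the empty one if the goal is missed before and after, the old
one without a single formula if the goal is kept. This replaces the quantifier over all
contributions by a list of linear length. -/
theorem exists_deviates_iff (hL : L.Affine) (π : Preference) (X : List L.Fml) (p : Player L)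
    (hp : subBag p.2.2.2.2 p.2.2.2.1 = true) :
    (∃ C, deviates π X p C = true) ↔ (candidates p).any (deviates π X p) = true := by
  rw [List.any_eq_true]
  refine ⟨?_, fun ⟨C, _, h⟩ => ⟨C, h⟩⟩
  rintro ⟨C, hC⟩
  obtain ⟨g, E, C₀, E', C'⟩ := p
  have mono : ∀ A B : List L.Fml, (A : Multiset L.Fml) ≤ B →
      proves (X.diff C' ++ A) g = true → proves (X.diff C' ++ B) g = true := by
    intro A B h hA
    rw [proves_iff] at hA ⊢
    refine hA.mono hL ?_
    rw [← Multiset.coe_add, ← Multiset.coe_add]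
    exact add_le_add_right h _
  simp only [deviates, Bool.and_eq_true, subBag_iff] at hC hp
  obtain ⟨hE, hC⟩ := hC
  have hfull : proves (X.diff C' ++ C) g = true → proves X g = false →
      ∃ A ∈ candidates (g, E, C₀, E', C'), deviates π X (g, E, C₀, E', C') A = true := by
    intro h1 h2
    refine ⟨E', by simp [candidates], ?_⟩
    have h3 := mono C E' hE h1
    have h4 : subBag E' E' = true := (subBag_iff _ _).2 le_rfl
    cases π <;> simp [deviates, prefers, h2, h3, h4]
  cases π with
  | dichotomous =>
    simp only [prefers, Bool.and_eq_true, Bool.not_eq_true'] at hC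
    exact hfull hC.1 hC.2
  | parsimonious =>
    simp only [prefers, Bool.or_eq_true, Bool.and_eq_true, Bool.not_eq_true',
      strictSubBag_iff] at hC
    rcases hC with ⟨h1, h2, h3⟩ | ⟨h1, h2⟩ | ⟨h1, h2, h3⟩
    -- The goal already fails with `C`, hence also with the smaller empty contribution, which is
    -- strictly below `C'` because `C` is.
    · refine ⟨[], by simp [candidates], ?_⟩
      have h4 : proves (X.diff C' ++ []) g = false := by
        rw [← Bool.not_eq_true] at h1 ⊢
        exact fun h => h1 (mono _ _ (Multiset.zero_le _) h)
      have h5 := (strictSubBag_iff [] C').2 (lt_of_le_of_lt (Multiset.zero_le _) h3)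
      have h6 : subBag [] E' = true := (subBag_iff _ _).2 (Multiset.zero_le _)
      rw [List.append_nil] at h4
      simp [deviates, prefers, h4, h5, h6, h2]
    · exact hfull h1 h2
    -- Since `C` is strictly below `C'`, some `A` is saved and `C` is still contained in `C'.erase
    -- A`; the goal survives by monotonicity.
    · obtain ⟨A, hA⟩ := Multiset.lt_iff_cons_le.1 h3
      have hA' : A ∈ C' := Multiset.mem_of_le hA (Multiset.mem_cons_self _ _)
      refine ⟨C'.erase A, by simp [candidates]; exact .inr (.inr ⟨A, hA', rfl⟩), ?_⟩
      have h4 : proves (X.diff C' ++ C'.erase A) g = true := by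
        refine mono _ _ ?_ h1
        have := Multiset.erase_le_erase A hA
        rwa [Multiset.erase_cons_head, Multiset.coe_erase] at this
      have h5 := (strictSubBag_iff (C'.erase A) C').2 (by
        rw [← Multiset.coe_erase]; exact Multiset.erase_lt.2 hA')
      have h6 : subBag (C'.erase A) E' = true := by
        rw [subBag_iff, ← Multiset.coe_erase]
        exact (Multiset.erase_le _ _).trans hp
      simp [deviates, prefers, h4, h5, h6, h2]

theorem forall_unstable_iff (hL : L.Affine) (π : Preference) (w : List Bool)
    (D : List (Player L)) (hD : valid w D = true) : (∀ C, unstable π D C = false) ↔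
      (D.all fun p => !(candidates p).any (deviates π (outcome D) p)) = true := by
  simp only [valid, Bool.and_eq_true, List.all_eq_true] at hD
  simp only [unstable, List.any_eq_false, List.all_eq_true, Bool.not_eq_true']
  rw [forall_comm]
  refine forall_congr' fun p => ?_
  rw [forall_comm]
  refine forall_congr' fun hp => ?_
  have h := not_congr (exists_deviates_iff hL π (outcome D) p (hD.2.1 p hp).2)
  simpa only [not_exists, List.any_eq_true, not_and] using h

/-! #### Computability -/

section

variable {α : Type} [TreeEnc α]

@[fun_prop] theorem pt_outcome {f : α → List (Player L)} (hf : PT Γ f) :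
    PT Γ fun a => outcome (f a) := by
  unfold outcome
  exact PT.flatMap (g := fun _ p => p.2.2.2.2) hf (by fun_prop)

@[fun_prop] theorem pt_strictSubBag {f g : α → List L.Fml} (hf : PT Γ f) (hg : PT Γ g) :
    PT Γ fun a => strictSubBag (f a) (g a) := by
  unfold strictSubBag; fun_prop

@[fun_prop] theorem pt_prefers (π : Preference) {new old less : α → Bool}
    (hn : PT Γ new) (ho : PT Γ old) (hl : PT Γ less) :
    PT Γ fun a => prefers π (new a) (old a) (less a) := by
  cases π <;> unfold prefers <;> fun_prop

theorem pt_deviates (hL : PT Γ fun p : List L.Fml × L.Fml => proves p.1 p.2) (π : Preference) :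
    PT Γ fun a : List L.Fml × Player L × List L.Fml => deviates π a.1 a.2.1 a.2.2 := by
  have h1 := PT.diff decEq_fml (l := fun a : List L.Fml × Player L × List L.Fml => a.1)
    (l' := fun a => a.2.1.2.2.2.2) (Γ := Γ) (by fun_prop) (by fun_prop)
  have h2 := hL.comp (f := fun a : List L.Fml × Player L × List L.Fml =>
    (a.1.diff a.2.1.2.2.2.2 ++ a.2.2, a.2.1.1)) (by fun_prop)
  have h3 := hL.comp (f := fun a : List L.Fml × Player L × List L.Fml =>
    (a.1, a.2.1.1)) (by fun_prop)
  unfold deviates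
  fun_prop

theorem pt_unstable (hL : PT Γ fun p : List L.Fml × L.Fml => proves p.1 p.2) (π : Preference) :
    PT Γ fun a : List (Player L) × List L.Fml => unstable π a.1 a.2 := by
  have h1 := (pt_deviates hL π).comp (f := fun q : (List (Player L) × List L.Fml) × Player L =>
    (outcome q.1.1, q.2, q.1.2)) (by fun_prop)
  dsimp only at h1
  have h2 : PT Γ fun a : List (Player L) × List L.Fml => a.1 := by fun_prop
  exact PT.any (g := fun a p => deviates π (outcome a.1) p a.2) h2 h1

theorem pt_candidates : PT Γ (candidates (L := L)) := by
  have := PT.map (Γ := Γ) (l := fun p : Player L => p.2.2.2.2)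
    (g := fun p A => p.2.2.2.2.erase A) (by fun_prop)
    (PT.erase decEq_fml (by fun_prop) (by fun_prop))
  unfold candidates
  fun_prop

theorem pt_candidates_any (hL : PT Γ fun p : List L.Fml × L.Fml => proves p.1 p.2)
    (π : Preference) : PT Γ fun D : List (Player L) =>
      D.all fun p => !(candidates p).any (deviates π (outcome D) p) := by
  have h1 := (pt_candidates (Γ := Γ) (L := L)).comp
    (f := fun q : List (Player L) × Player L => q.2) (by fun_prop)
  have h2 := (pt_deviates hL π).comp
    (f := fun q : (List (Player L) × Player L) × List L.Fml => (outcome q.1.1, q.1.2, q.2))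
    (by fun_prop)
  dsimp only at h1 h2
  have h3 : PT Γ fun q : List (Player L) × Player L =>
      (candidates q.2).any (deviates π (outcome q.1) q.2) :=
    PT.any (l := fun q : List (Player L) × Player L => candidates q.2)
      (g := fun q => deviates π (outcome q.1) q.2) h1 h2
  exact PT.all (l := fun D : List (Player L) => D)
    (g := fun D p => !(candidates p).any (deviates π (outcome D) p)) PT.id (PT.not h3)

theorem pt_valid : PT Γ fun a : List Bool × List (Player L) => valid a.1 a.2 := by
  have h1 := PT.map (Γ := Γ) (l := fun a : List Bool × List (Player L) => a.2)
    (g := fun _ p => (p.1, p.2.1, p.2.2.1)) (by fun_prop) (by fun_prop)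
  have h2 := PT.decide_eq_bits.comp (PT.prodMk ((PT.encodeList PT.encodePlayer).comp h1)
    (PT.fst (Γ := Γ) PT.id))
  have h3 := PT.all (Γ := Γ) (l := fun a : List Bool × List (Player L) => a.2)
    (g := fun _ p => subBag p.2.2.1 p.2.1 && subBag p.2.2.2.2 p.2.2.2.1) (by fun_prop)
    (by fun_prop)
  have h4 := PT.flatMap (Γ := Γ) (l := fun a : List Bool × List (Player L) => a.2)
    (g := fun _ p => p.2.1) (by fun_prop) (by fun_prop)
  have h5 := PT.flatMap (Γ := Γ) (l := fun a : List Bool × List (Player L) => a.2)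
    (g := fun _ p => p.2.2.1) (by fun_prop) (by fun_prop)
  have h6 := PT.flatMap (Γ := Γ) (l := fun a : List Bool × List (Player L) => a.2)
    (g := fun _ p => p.2.2.2.1) (by fun_prop) (by fun_prop)
  unfold valid
  exact PT.and h2 (by fun_prop)

end

/-! #### Short codes -/

/-- The players coded by a program. -/
noncomputable def players (y : List Bool) : List (Player L) := (decode y).2.2.2

/-- The formulas coded by a program. -/
noncomputable def contribution (z : List Bool) : List L.Fml := (decode z).2.1

theorem pt_players : PT Γ (players (L := L)) := PT.snd (PT.snd (PT.snd pt_decode))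

theorem pt_contribution : PT Γ (contribution (L := L)) := PT.fst (PT.snd pt_decode)

/-- A list, four times. -/
def fourfold (w : List Bool) : List Bool := w ++ w ++ (w ++ w)

theorem length_fourfold (w : List Bool) : (fourfold w).length = 4 * w.length := by
  simp [fourfold]; omega

@[fun_prop] theorem pt_fourfold : PT Γ fourfold := by unfold fourfold; fun_prop

/-- The space for a deviation. -/
def deviationClock (D : List (Player L)) : List Bool :=
  fourfold (encodeFmls (D.flatMap fun p => p.2.2.2.1))

theorem pt_deviationClock : PT Γ (deviationClock (L := L)) :=
  pt_fourfold.comp (PT.encodeFmls.comp (PT.flatMap (l := fun D : List (Player L) => D)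
    (g := fun _ p => p.2.2.2.1) PT.id (by fun_prop)))

theorem weight_flatMap (D : List (Player L)) (f : Player L → List L.Fml) :
    weight (D.flatMap f) = (D.map fun p => weight (f p)).sum := by
  induction D with
  | nil => rfl
  | cons p D ih => simp [weight_append, ih]

/-- A contribution that matters is contained in the alternative endowment of some player, so it is
built by at most as many instructions as the code of all these endowments has bits. An instruction
has four bits, hence `fourfold` in the clock. -/
theorem exists_contribution {π : Preference} {D : List (Player L)} {C : List L.Fml}
    (h : unstable π D C = true) :
    ∃ z, z.length = (deviationClock D).length ∧ contribution z = C := by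
  have hw : weight C ≤ (encodeFmls (D.flatMap fun p => p.2.2.2.1)).length := by
    simp only [unstable, List.any_eq_true, deviates, Bool.and_eq_true, subBag_iff] at h
    obtain ⟨p, hp, hC, -⟩ := h
    rw [length_encodeFmls, weight_flatMap]
    have h1 : weight p.2.2.2.1 ≤ (D.map fun p => weight p.2.2.2.1).sum :=
      List.single_le_sum (fun _ _ => Nat.zero_le _) _ (List.mem_map_of_mem hp)
    exact (weight_le_of_le hC).trans (h1.trans (Nat.le_succ _))
  obtain ⟨z, hz, e⟩ := ((builds_list C [] ([], [])).mono hw).exists_decode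
  refine ⟨z, by rw [hz, deviationClock, length_fourfold], ?_⟩
  rw [contribution, e, List.append_nil]

theorem exists_players {w : List Bool} {D : List (Player L)} (h : valid w D = true) :
    ∃ y, y.length = (fourfold (fourfold w)).length ∧ players y = D := by
  simp only [valid, Bool.and_eq_true, decide_eq_true_iff, subBag_iff] at h
  obtain ⟨rfl, -, -, h1, -, h2⟩ := h
  have h3 := weight_le_of_le h1
  have h4 := weight_le_of_le h2
  rw [outcome] at h4
  simp only [weight_flatMap] at h3 h4
  -- The alternatives cannot be bounded player by player, only in total: `h3` and `h4` compare their
  -- weights with those of the given endowments and contributions. Adding the given weights on the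
  -- left and the alternative ones on the right gives an inequality that does hold for each player.
  have h5 : (D.map playerWeight).sum + (D.map fun p => weight p.2.1).sum +
      (D.map fun p => weight p.2.2.1).sum ≤
      3 * (encodeList encodePlayer (D.map fun p => (p.1, p.2.1, p.2.2.1))).length +
      (D.map fun p => weight p.2.2.2.1).sum + (D.map fun p => weight p.2.2.2.2).sum := by
    clear h1 h2 h3 h4
    induction D with
    | nil => simp
    | cons p D ih =>
      have e : (encodePlayer (p.1, p.2.1, p.2.2.1)).length =
          p.1.code.length + (weight p.2.1 + 1 + (weight p.2.2.1 + 1)) := by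
        rw [← length_encodeFmls, ← length_encodeFmls, ← List.length_append,
          ← List.length_append]
        rfl
      simp only [List.map_cons, List.sum_cons, encodeList, List.length_cons, List.length_append,
        e, playerWeight] at ih ⊢
      omega
  -- The estimate even holds with the factor 3; it is rounded up so that four bits per instruction
  -- give the length of a twofold `fourfold`.
  have h6 : (D.map playerWeight).sum ≤
      4 * (encodeList encodePlayer (D.map fun p => (p.1, p.2.1, p.2.2.1))).length := by
    omega
  obtain ⟨y, hy, e⟩ := ((builds_players D).mono h6).exists_decode
  refine ⟨y, by rw [hy, length_fourfold, length_fourfold], ?_⟩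
  rw [players, e]

/-- Both quantifiers now range over strings of prescribed polynomial length. Restricting them loses
nothing, as valid players and profitable deviations have short programs. -/
theorem mem_rationalConstruction_iff_short (π : Preference) (w : List Bool) :
    w ∈ RationalConstruction L π ↔ ∃ y, y.length = (fourfold (fourfold w)).length ∧
      valid w (players (L := L) y) = true ∧
      ¬ ∃ z, z.length = (deviationClock (players (L := L) y)).length ∧
        unstable π (players (L := L) y) (contribution z) = true := by
  rw [mem_rationalConstruction_iff]
  constructor
  · rintro ⟨D, hD, h⟩
    obtain ⟨y, hy, rfl⟩ := exists_players hD
    exact ⟨y, hy, hD, by simp [h]⟩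
  · rintro ⟨y, -, hD, h⟩
    refine ⟨_, hD, fun C => ?_⟩
    rw [← Bool.not_eq_true]
    intro hC
    obtain ⟨z, hz, rfl⟩ := exists_contribution hC
    exact h ⟨z, hz, hC⟩

end ResourceGames

namespace ResourceGames

open Ctx TreeEnc Store

/-! ### The complexity of rational construction -/

/-- The context of the oracle machines with the oracle `A`. -/
def oracleCtx (A : Language Bool) : Ctx where
  κ := Empty
  Sym := Bool
  bit := Function.Embedding.refl _
  oracle := A
  timed := True

variable {L : Logic}

open Classical in
theorem pt_oracle (A : Language Bool) : PT (oracleCtx A) fun w : List Bool => decide (w ∈ A) :=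
  PT.oracle trivial

theorem pt_inputClock {Γ : Ctx} : PT Γ fun w => fourfold (fourfold w) := by fun_prop

theorem pt_validPlayers {Γ : Ctx} :
    PT Γ fun p : List Bool × List Bool => valid p.1 (players (L := L) p.2) := by
  have h := pt_players (Γ := Γ) (L := L)
  exact pt_valid.comp (f := fun p : List Bool × List Bool => (p.1, players p.2)) (by fun_prop)

/-- Only the players are guessed; stability is then checked on the candidates, deterministically,
with the oracle for validity. -/
theorem rationalConstruction_mem_sigmaP_two (π : Preference) (hL : L.Affine)
    (h : SequentValidity L ∈ NP) : RationalConstruction L π ∈ SigmaP 2 := by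
  refine mem_NPOracle_of_guess (Γ := oracleCtx (SequentValidity L))
    (clock := fun w => fourfold (fourfold w))
    (D := fun p => valid p.1 (players (L := L) p.2) && (players (L := L) p.2).all fun q =>
      !(candidates q).any (deviates π (outcome (players (L := L) p.2)) q)) trivial pt_inputClock
    (PT.and pt_validPlayers ?_) (mem_sigmaP_one h) fun w => ?_
  · have h := pt_players (Γ := oracleCtx (SequentValidity L)) (L := L)
    exact (pt_candidates_any (PT.proves (pt_oracle _)) π).comp
      (f := fun p : List Bool × List Bool => players p.2) (by fun_prop)
  · rw [mem_rationalConstruction_iff]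
    simp only [Bool.and_eq_true]
    constructor
    · rintro ⟨D, hD, hC⟩
      obtain ⟨y, hy, rfl⟩ := exists_players hD
      exact ⟨y, hy, hD, (forall_unstable_iff hL π w _ hD).1 hC⟩
    · rintro ⟨y, -, hD, hC⟩
      exact ⟨_, hD, (forall_unstable_iff hL π w _ hD).2 hC⟩

/-- The programs of players one of which can deviate to a preferred contribution. -/
def deviation (L : Logic) (π : Preference) : Language Bool :=
  {y | ∃ z : List Bool, z.length = (deviationClock (players (L := L) y)).length ∧
    unstable π (players (L := L) y) (contribution z) = true}

theorem pt_playersClock {Γ : Ctx} : PT Γ fun y => deviationClock (players (L := L) y) :=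
  pt_deviationClock.comp pt_players

theorem pt_unstablePlayers {Γ : Ctx}
    (hL : PT Γ fun p : List L.Fml × L.Fml => proves p.1 p.2) (π : Preference) :
    PT Γ fun p : List Bool × List Bool =>
      unstable π (players (L := L) p.1) (contribution p.2) := by
  have h1 := pt_players (Γ := Γ) (L := L)
  have h2 := pt_contribution (Γ := Γ) (L := L)
  exact (pt_unstable hL π).comp
    (f := fun p : List Bool × List Bool => (players p.1, contribution p.2)) (by fun_prop)

/-- The contribution is guessed, and its effect on each player is checked with the oracle for
validity. -/
theorem deviation_mem_sigmaP_two (π : Preference) (h : SequentValidity L ∈ NP) :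
    deviation L π ∈ SigmaP 2 :=
  mem_NPOracle_of_guess (Γ := oracleCtx (SequentValidity L))
    (clock := fun y => deviationClock (players (L := L) y))
    (D := fun p => unstable π (players (L := L) p.1) (contribution p.2)) trivial
    pt_playersClock (pt_unstablePlayers (PT.proves (pt_oracle _)) π) (mem_sigmaP_one h)
    fun _ => Iff.rfl

open Classical in
theorem pt_validStable {Γ : Ctx} (π : Preference)
    (h : PT Γ fun y : List Bool => decide (y ∈ deviation L π)) :
    PT Γ fun p : List Bool × List Bool =>
      valid p.1 (players (L := L) p.2) && !decide (p.2 ∈ deviation L π) := by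
  have h1 := h.comp (f := fun p : List Bool × List Bool => p.2) (by fun_prop)
  exact PT.and pt_validPlayers (PT.not h1)

open Classical in
theorem mem_rationalConstruction_iff_deviation (π : Preference) (w : List Bool) :
    w ∈ RationalConstruction L π ↔ ∃ y, y.length = (fourfold (fourfold w)).length ∧
      (valid w (players (L := L) y) && !decide (y ∈ deviation L π)) = true := by
  rw [mem_rationalConstruction_iff_short]
  simp only [Bool.and_eq_true, Bool.not_eq_true', decide_eq_false_iff_not]
  rfl

-- The instances of `deviation` are programs, so the guessed string itself is the query; the negated
-- answer provides the universal quantifier.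
open Classical in
theorem rationalConstruction_mem_sigmaP_three (π : Preference) (h : SequentValidity L ∈ NP) :
    RationalConstruction L π ∈ SigmaP 3 :=
  mem_NPOracle_of_guess (Γ := oracleCtx (deviation L π))
    (clock := fun w => fourfold (fourfold w))
    (D := fun p => valid p.1 (players (L := L) p.2) && !decide (p.2 ∈ deviation L π)) trivial
    pt_inputClock (pt_validStable π (pt_oracle _)) (deviation_mem_sigmaP_two π h)
    (mem_rationalConstruction_iff_deviation π)

-- Two nested exhaustive searches, with the machine for validity called inside. Everything takes
-- place in the context of that machine, whose stacks are available as extra stacks.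
open Classical in
theorem rationalConstruction_mem_PSPACE (π : Preference) (h : SequentValidity L ∈ PSPACE) :
    RationalConstruction L π ∈ PSPACE := by
  obtain ⟨M, hd, ho, hs, hh, hM⟩ := h
  have h1 := M.pt_language hd ho hs hh
  rw [hM] at h1
  have h2 : PT M.ctx fun y : List Bool => decide (y ∈ deviation L π) :=
    PT.search (fun h => h) pt_playersClock (pt_unstablePlayers (PT.proves h1) π)
  have h3 : PT M.ctx fun w : List Bool => decide (∃ y, y.length = (fourfold (fourfold w)).length ∧
      (valid w (players (L := L) y) && !decide (y ∈ deviation L π)) = true) :=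
    PT.search (D := fun w y => valid w (players (L := L) y) && !decide (y ∈ deviation L π))
      (fun h => h) pt_inputClock (pt_validStable π h2)
  exact mem_PSPACE_of_pt (fun h => h) rfl h3 fun w =>
    (mem_rationalConstruction_iff_deviation π w).trans decide_eq_true_iff.symm

end ResourceGames

theorem mainTheorem11 (L : ResourceGames.Logic) (π : ResourceGames.Preference) :
    (L.Affine → ResourceGames.SequentValidity L ∈ ResourceGames.NP →
      ResourceGames.RationalConstruction L π ∈ ResourceGames.SigmaP 2) ∧
    (ResourceGames.SequentValidity L ∈ ResourceGames.NP →
      ResourceGames.RationalConstruction L π ∈ ResourceGames.SigmaP 3) ∧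
    (ResourceGames.SequentValidity L ∈ ResourceGames.PSPACE →
      ResourceGames.RationalConstruction L π ∈ ResourceGames.PSPACE) :=
  ⟨ResourceGames.rationalConstruction_mem_sigmaP_two π,
    ResourceGames.rationalConstruction_mem_sigmaP_three π,
    ResourceGames.rationalConstruction_mem_PSPACE π⟩
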